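/- Let $0<r<1$, write $\|a\|_{\mathrm{hyb}}=\max\{1,|a|\}$ for $a\in\mathbb C\setminus\{0\}$ and $\|0\|_{\mathrm{hyb}}=0$, and let $A_r$ be the ring of Laurent series $f=\sum_n a_nt^n\in\mathbb C((t))$ with $\|f\|_{\mathrm{hyb}}=\sum_n\|a_n\|_{\mathrm{hyb}}\,r^n<\infty$. Let $C^{\mathrm{hyb}}(r)=\mathcal M(A_r)$ be its Berkovich spectrum (the multiplicative seminorms on $A_r$ bounded by $\|\cdot\|_{\mathrm{hyb}}$, with the topology of pointwise convergence), and let $\tau:\overline{\mathbb D}_r\to C^{\mathrm{hyb}}(r)$ be the canonical homeomorphism, for which $|f|_{\tau(0)}=r^{\mathrm{ord}_0 f}$ and $|f|_{\tau(t)}=r^{\log|f(t)|/\log|t|}$ for $t\ne0$. A tropical Fubini–Study function on $C^{\mathrm{hyb}}(r)$ is a function $m^{-1}\max_j(\log|f_j|+c_j)$, where $m\ge1$ is an integer, $(f_j)$ is a finite family in $A_r$ without common zeroes, and $c_j\in\mathbb R$. Let $\mathrm{PSH}(C^{\mathrm{hyb}}(r))$ be the set of pointwise limits of decreasing nets of such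 functions that are not $-\infty$ at any point whose seminorm has zero kernel. For $R>0$ put $\mathbb D_R=\{|t|<R\}$ and $\mathbb D_R^*=\mathbb D_R\setminus\{0\}$, let $\mathrm{SH}(\mathbb D_R)$ be the set of subharmonic functions $\mathbb D_R\to[-\infty,\infty)$ that are not identically $-\infty$, and view $\mathrm{SH}(\mathbb D_R)+\mathbb R\log|t|$ as a set of functions on $\mathbb D_R^*$. For such a function $f$ let $\nu_0(f)=\sup\{\gamma\in\mathbb R: f\le\gamma\log|t|+O(1)\text{ near }0\}$ be its generalized Lelong number at $0$. All sets of functions are ordered pointwise. **Proposition.** (1) For $\varphi\in\mathrm{PSH}(C^{\mathrm{hyb}}(r))$ put $\rho_r(\varphi)(t)=\log_r|t|\cdot\varphi(\tau(t))$ for $t\in\mathbb D_r^*$. Then $\rho_r(\varphi)$ belongs to $\mathrm{SH}(\mathbb D_r)+\mathbb R\log|t|$, unless it is identically $-\infty$ on $\mathbb D_r^*$. The map $\rho_r$ is order-preserving, and $\rho_r(\varphi)=\rho_r(\psi)$ if and only if $\varphi=\psi$ on $\tau(\mathbb D_r^*)$; moreover, $\rho_r$ is injective on the set of continuous functions in $\mathrm{PSH}(C^{\mathrm{hyb}}(r))$.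 If $\varphi$ is continuous, then $\rho_r(\varphi)\in\mathrm{SH}(\mathbb D_r)+\mathbb R\log|t|$ and $\varphi(\tau(0))=\log r\cdot\nu_0(\rho_r(\varphi))$. (2) For every $r'>r$ there is an order-preserving map $$\rho_{r',r}:\mathrm{SH}(\mathbb D_{r'})+\mathbb R\log|t|\longrightarrow\mathrm{PSH}(C^{\mathrm{hyb}}(r))$$ such that $\rho_{r',r}(f)(\tau(t))=f(t)/\log_r|t|$ for $0<|t|\le r$ and $\rho_{r',r}(f)(\tau(0))=\log r\cdot\nu_0(f)$. It is injective up to restriction to the closed disk: $\rho_{r',r}(f)=\rho_{r',r}(g)$ if and only if $f=g$ on $\overline{\mathbb D}_r\setminus\{0\}$. Finally, $\rho_r(\rho_{r',r}(f))$ is the restriction of $f$ to $\mathbb D_r^*$, and it lies in $\mathrm{SH}(\mathbb D_r)+\mathbb R\log|t|$. -/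

import Mathlib

open Filter Topology MeasureTheory

noncomputable section

namespace Hybrid

/-! ### Berkovich spectra and plurisubharmonic functions on them -/

/-- The Berkovich spectrum `ℳ(A)` of a commutative ring `A` with a norm: the multiplicative
seminorms on `A` which are bounded above by the norm. -/
structure BerkovichSpectrum (A : Type*) [CommRing A] [Norm A] extends MulRingSeminorm A where
  le_norm' : ∀ f : A, toFun f ≤ ‖f‖

section Berkovich

variable {A : Type*} [CommRing A] [Norm A]

/-- The value `|f|_x` of `f` at a point `x` of the spectrum. -/
def BerkovichSpectrum.eval (x : BerkovichSpectrum A) (f : A) : ℝ := x.toMulRingSeminorm f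

/-- The topology of pointwise convergence on `A`. -/
instance : TopologicalSpace (BerkovichSpectrum A) :=
  TopologicalSpace.induced BerkovichSpectrum.eval Pi.topologicalSpace

/-- A point of the spectrum is Zariski dense if its kernel is zero. -/
def BerkovichSpectrum.IsZariskiDense (x : BerkovichSpectrum A) : Prop :=
  ∀ f : A, x.eval f = 0 → f = 0

/-- `log |f|_x`, with the value `-∞` (that is, `⊥`) where `|f|_x = 0`. -/
def logAbs (f : A) (x : BerkovichSpectrum A) : EReal :=
  ENNReal.log (ENNReal.ofReal (x.eval f))

/-- Tropical Fubini-Study functions on `ℳ(A)`: the functions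
`m⁻¹ max_j (log |f_j| + c_j)`, for a finite family of elements `f_j` of `A` without common zeroes
on `Spec A`, real numbers `c_j`, and an integer `m ≥ 1`. -/
def IsTropicalFS (φ : BerkovichSpectrum A → EReal) : Prop :=
  ∃ (m : ℕ) (k : ℕ) (f : Fin k → A) (c : Fin k → ℝ), 1 ≤ m ∧
    (∀ p : PrimeSpectrum A, ∃ j, f j ∉ p.asIdeal) ∧
    ∀ x, φ x = (((m : ℝ)⁻¹ : ℝ) : EReal) * ⨆ j, (logAbs (f j) x + (c j : EReal))

variable (A) in
/-- Plurisubharmonic functions on `ℳ(A)`: the pointwise limits of decreasing nets of tropical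
Fubini-Study functions that are not `-∞` at any Zariski dense point. -/
def PSH : Set (BerkovichSpectrum A → EReal) :=
  {φ | (∃ (ι : Type) (_ : Preorder ι) (_ : IsDirectedOrder ι) (_ : Nonempty ι)
          (u : ι → BerkovichSpectrum A → EReal),
          Antitone u ∧ (∀ i, IsTropicalFS (u i)) ∧
          ∀ x, Tendsto (fun i => u i x) atTop (𝓝 (φ x))) ∧
       ∀ x : BerkovichSpectrum A, x.IsZariskiDense → φ x ≠ ⊥}

end Berkovich

/-! ### The hybrid ring and the hybrid circle -/

/-- The hybrid norm on `ℂ`: `max 1 |z|` for `z ≠ 0`, and `0` for `z = 0`. -/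
def hybNorm (z : ℂ) : ℝ := if z = 0 then 0 else max 1 ‖z‖

lemma hybNorm_nonneg (z : ℂ) : 0 ≤ hybNorm z := by
  unfold hybNorm; split_ifs <;> positivity

lemma norm_le_hybNorm (z : ℂ) : ‖z‖ ≤ hybNorm z := by
  unfold hybNorm; split_ifs with h <;> simp [h]

lemma hybNorm_zero : hybNorm 0 = 0 := by simp [hybNorm]

lemma one_le_hybNorm {z : ℂ} (h : z ≠ 0) : 1 ≤ hybNorm z := by simp [hybNorm, h]

lemma hybNorm_add_le (z w : ℂ) : hybNorm (z + w) ≤ hybNorm z + hybNorm w := by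
  by_cases hz : z = 0
  · simp [hz, hybNorm_zero]
  by_cases hw : w = 0
  · simp [hw, hybNorm_zero]
  by_cases h : z + w = 0
  · rw [h, hybNorm_zero]; exact add_nonneg (hybNorm_nonneg _) (hybNorm_nonneg _)
  have : hybNorm (z + w) = max 1 ‖z + w‖ := by simp [hybNorm, h]
  rw [this]
  refine max_le ?_ ?_
  · linarith [one_le_hybNorm hz, hybNorm_nonneg w]
  · exact (norm_add_le _ _).trans (add_le_add (norm_le_hybNorm _) (norm_le_hybNorm _))

lemma hybNorm_mul_le (z w : ℂ) : hybNorm (z * w) ≤ hybNorm z * hybNorm w := by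
  by_cases hz : z = 0
  · simp [hz, hybNorm_zero]
  by_cases hw : w = 0
  · simp [hw, hybNorm_zero]
  have : hybNorm (z * w) = max 1 ‖z * w‖ := by simp [hybNorm, hz, hw]
  rw [this]
  refine max_le (one_le_mul_of_one_le_of_one_le (one_le_hybNorm hz) (one_le_hybNorm hw)) ?_
  rw [norm_mul]
  exact mul_le_mul (norm_le_hybNorm _) (norm_le_hybNorm _) (norm_nonneg _) (hybNorm_nonneg _)

lemma hybNorm_neg (z : ℂ) : hybNorm (-z) = hybNorm z := by simp [hybNorm]

lemma hybNorm_sum_le {ι : Type*} (s : Finset ι) (a : ι → ℂ) :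
    hybNorm (∑ i ∈ s, a i) ≤ ∑ i ∈ s, hybNorm (a i) :=
  Finset.le_sum_of_subadditive hybNorm hybNorm_zero.le hybNorm_add_le s a

/-- The change of summation indices `(n, i) ↦ (i, n - i)`. -/
def shiftEquiv : ℤ × ℤ ≃ ℤ × ℤ where
  toFun p := (p.2, p.1 - p.2)
  invFun q := (q.1 + q.2, q.1)
  left_inv p := by simp
  right_inv q := by simp

lemma coeff_mul_eq_sum (f g : LaurentSeries ℂ) (n : ℤ) :
    ∃ s : Finset ℤ, (f * g).coeff n = ∑ i ∈ s, f.coeff i * g.coeff (n - i) ∧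
      ∀ i ∉ s, f.coeff i * g.coeff (n - i) = 0 := by
  classical
  refine ⟨(Finset.antidiagonal f.isPWO_support g.isPWO_support n).image Prod.fst, ?_, ?_⟩
  · rw [HahnSeries.coeff_mul, Finset.sum_image]
    · refine Finset.sum_congr rfl fun p hp => ?_
      rw [Finset.mem_antidiagonal] at hp
      rw [show n - p.1 = p.2 by linarith [hp.2.2]]
    · intro p hp q hq hpq
      have hp' := (Finset.mem_antidiagonal.1 (Finset.mem_coe.1 hp)).2.2
      have hq' := (Finset.mem_antidiagonal.1 (Finset.mem_coe.1 hq)).2.2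
      ext
      · exact hpq
      · linarith
  · intro i hi
    by_contra h
    apply hi
    rw [Finset.mem_image]
    refine ⟨(i, n - i), Finset.mem_antidiagonal.2 ⟨?_, ?_, by simp⟩, rfl⟩
    · exact fun h0 => h (by simp [h0])
    · exact fun h0 => h (by simp [h0])

lemma summable_mul_coeff {r : ℝ} (hr : 0 < r) {f g : LaurentSeries ℂ}
    (hf : Summable fun n : ℤ => hybNorm (f.coeff n) * r ^ n)
    (hg : Summable fun n : ℤ => hybNorm (g.coeff n) * r ^ n) :
    Summable fun n : ℤ => hybNorm ((f * g).coeff n) * r ^ n := by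
  have hnn : ∀ (h : LaurentSeries ℂ) (n : ℤ), 0 ≤ hybNorm (h.coeff n) * r ^ n := fun h n =>
    mul_nonneg (hybNorm_nonneg _) (zpow_nonneg hr.le _)
  have h1 := hf.mul_of_nonneg hg (fun n => hnn f n) (fun n => hnn g n)
  have h2 := (shiftEquiv.summable_iff.2 h1)
  refine Summable.of_nonneg_of_le (fun n => hnn _ n) (fun n => ?_) h2.prod
  obtain ⟨s, hs, -⟩ := coeff_mul_eq_sum f g n
  have h3 : Summable fun i : ℤ => ((fun x : ℤ × ℤ => hybNorm (f.coeff x.1) * r ^ x.1 *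
      (hybNorm (g.coeff x.2) * r ^ x.2)) ∘ shiftEquiv) (n, i) := h2.prod_factor n
  refine le_trans ?_ (h3.sum_le_tsum s fun i _ => mul_nonneg (hnn f _) (hnn g _))
  rw [hs]
  refine (mul_le_mul_of_nonneg_right (hybNorm_sum_le _ _) (zpow_nonneg hr.le _)).trans ?_
  rw [Finset.sum_mul]
  refine Finset.sum_le_sum fun i _ => ?_
  have h4 : r ^ n = r ^ i * r ^ (n - i) := by rw [← zpow_add₀ hr.ne']; simp
  simp only [Function.comp, shiftEquiv, Equiv.coe_fn_mk]
  rw [h4]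
  calc hybNorm (f.coeff i * g.coeff (n - i)) * (r ^ i * r ^ (n - i))
      ≤ hybNorm (f.coeff i) * hybNorm (g.coeff (n - i)) * (r ^ i * r ^ (n - i)) :=
        mul_le_mul_of_nonneg_right (hybNorm_mul_le _ _)
          (mul_nonneg (zpow_nonneg hr.le _) (zpow_nonneg hr.le _))
    _ = _ := by ring

/-- The hybrid ring `A_r` of the Laurent series `∑ a_n t^n` over `ℂ` such that
`∑ ‖a_n‖_hyb r^n < ∞`. -/
def hybridRing (r : Set.Ioo (0 : ℝ) 1) : Subring (LaurentSeries ℂ) where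
  carrier := {f | Summable fun n : ℤ => hybNorm (f.coeff n) * (r : ℝ) ^ n}
  mul_mem' hf hg := summable_mul_coeff r.2.1 hf hg
  one_mem' := by
    refine summable_of_ne_finset_zero (s := {0}) fun n hn => ?_
    have : n ≠ 0 := by simpa using hn
    simp [HahnSeries.coeff_one, this, hybNorm_zero]
  add_mem' {f g} hf hg := by
    refine Summable.of_nonneg_of_le
      (fun n => mul_nonneg (hybNorm_nonneg _) (zpow_nonneg r.2.1.le _)) (fun n => ?_)
      (Summable.add hf hg)
    rw [← add_mul, HahnSeries.coeff_add]
    exact mul_le_mul_of_nonneg_right (hybNorm_add_le _ _) (zpow_nonneg r.2.1.le _)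
  zero_mem' := by simp [hybNorm_zero, summable_zero]
  neg_mem' {f} hf := by simpa [hybNorm_neg] using hf

/-- The hybrid norm `‖∑ a_n t^n‖_hyb = ∑ ‖a_n‖_hyb r^n`. -/
instance (r : Set.Ioo (0 : ℝ) 1) : Norm (hybridRing r) where
  norm f := ∑' n : ℤ, hybNorm ((f : LaurentSeries ℂ).coeff n) * (r : ℝ) ^ n

/-- The hybrid circle `C^hyb(r) = ℳ(A_r)`. -/
abbrev HybridCircle (r : Set.Ioo (0 : ℝ) 1) : Type := BerkovichSpectrum (hybridRing r)

section Points

variable {r : Set.Ioo (0 : ℝ) 1}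

/-- The value at `t` of the function on the closed punctured disk of radius `r` defined by an
element of `A_r`. -/
def evalAt (t : ℂ) (f : hybridRing r) : ℂ := ∑' n : ℤ, (f : LaurentSeries ℂ).coeff n * t ^ n

lemma summable_hyb (f : hybridRing r) :
    Summable fun n : ℤ => hybNorm ((f : LaurentSeries ℂ).coeff n) * (r : ℝ) ^ n := f.2

lemma exponent_pos {t : ℂ} (ht0 : t ≠ 0) (ht : ‖t‖ ≤ r) :
    0 < Real.log r / Real.log ‖t‖ :=
  div_pos_of_neg_of_neg (Real.log_neg r.2.1 r.2.2)
    (Real.log_neg (norm_pos_iff.2 ht0) (ht.trans_lt r.2.2))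

lemma exponent_le_one {t : ℂ} (ht0 : t ≠ 0) (ht : ‖t‖ ≤ r) :
    Real.log r / Real.log ‖t‖ ≤ 1 := by
  have h := Real.log_neg (norm_pos_iff.2 ht0) (ht.trans_lt r.2.2)
  rw [div_le_one_of_neg h]
  exact Real.log_le_log (norm_pos_iff.2 ht0) ht

lemma norm_rpow_exponent {t : ℂ} (ht0 : t ≠ 0) (ht : ‖t‖ ≤ r) :
    ‖t‖ ^ (Real.log r / Real.log ‖t‖) = (r : ℝ) := by
  have h := Real.log_neg (norm_pos_iff.2 ht0) (ht.trans_lt r.2.2)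
  rw [Real.rpow_def_of_pos (norm_pos_iff.2 ht0), mul_div_cancel₀ _ h.ne, Real.exp_log r.2.1]

lemma term_rpow_le {t : ℂ} (ht0 : t ≠ 0) (ht : ‖t‖ ≤ r) (f : hybridRing r) (n : ℤ) :
    ‖(f : LaurentSeries ℂ).coeff n * t ^ n‖ ^ (Real.log r / Real.log ‖t‖) ≤
      hybNorm ((f : LaurentSeries ℂ).coeff n) * (r : ℝ) ^ n := by
  have h0 := exponent_pos ht0 ht
  rw [norm_mul, norm_zpow, Real.mul_rpow (norm_nonneg _) (zpow_nonneg (norm_nonneg _) _)]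
  have h1 : (‖t‖ ^ n) ^ (Real.log r / Real.log ‖t‖) = (r : ℝ) ^ n := by
    rw [← Real.rpow_intCast, ← Real.rpow_mul (norm_nonneg _), mul_comm,
      Real.rpow_mul (norm_nonneg _), norm_rpow_exponent ht0 ht, Real.rpow_intCast]
  rw [h1]
  refine mul_le_mul_of_nonneg_right ?_ (zpow_nonneg r.2.1.le _)
  by_cases hz : (f : LaurentSeries ℂ).coeff n = 0
  · simp [hz, hybNorm_zero, Real.zero_rpow h0.ne']
  by_cases h2 : ‖(f : LaurentSeries ℂ).coeff n‖ ≤ 1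
  · exact (Real.rpow_le_one (norm_nonneg _) h2 h0.le).trans (one_le_hybNorm hz)
  · refine le_trans ?_ (norm_le_hybNorm _)
    conv_rhs => rw [← Real.rpow_one ‖(f : LaurentSeries ℂ).coeff n‖]
    exact Real.rpow_le_rpow_of_exponent_le (not_le.1 h2).le (exponent_le_one ht0 ht)

lemma rpow_add_le {p : ℝ} (h0 : 0 ≤ p) (h1 : p ≤ 1) {a b : ℝ} (ha : 0 ≤ a) (hb : 0 ≤ b) :
    (a + b) ^ p ≤ a ^ p + b ^ p := by
  lift a to NNReal using ha
  lift b to NNReal using hb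
  exact_mod_cast NNReal.rpow_add_le_add_rpow a b h0 h1

lemma norm_sum_rpow_le {t : ℂ} (ht0 : t ≠ 0) (ht : ‖t‖ ≤ r) (f : hybridRing r) (s : Finset ℤ) :
    (∑ n ∈ s, ‖(f : LaurentSeries ℂ).coeff n * t ^ n‖) ^ (Real.log r / Real.log ‖t‖) ≤ ‖f‖ := by
  have h0 := exponent_pos ht0 ht
  have h1 := exponent_le_one ht0 ht
  have key : (∑ n ∈ s, ‖(f : LaurentSeries ℂ).coeff n * t ^ n‖) ^ (Real.log r / Real.log ‖t‖) ≤
      ∑ n ∈ s, ‖(f : LaurentSeries ℂ).coeff n * t ^ n‖ ^ (Real.log r / Real.log ‖t‖) := by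
    classical
    induction s using Finset.induction_on with
    | empty => simp [Real.zero_rpow h0.ne']
    | insert a s ha ih =>
      rw [Finset.sum_insert ha, Finset.sum_insert ha]
      refine (rpow_add_le h0.le h1 (norm_nonneg _)
        (Finset.sum_nonneg fun _ _ => norm_nonneg _)).trans ?_
      exact add_le_add le_rfl ih
  refine key.trans ((Finset.sum_le_sum fun n _ => term_rpow_le ht0 ht f n).trans ?_)
  exact (summable_hyb f).sum_le_tsum s
    fun n _ => mul_nonneg (hybNorm_nonneg _) (zpow_nonneg r.2.1.le _)

lemma norm_nonneg_hyb (f : hybridRing r) : 0 ≤ ‖f‖ :=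
  tsum_nonneg fun _ => mul_nonneg (hybNorm_nonneg _) (zpow_nonneg r.2.1.le _)

lemma norm_sum_le_rpow_inv {t : ℂ} (ht0 : t ≠ 0) (ht : ‖t‖ ≤ r) (f : hybridRing r)
    (s : Finset ℤ) :
    ∑ n ∈ s, ‖(f : LaurentSeries ℂ).coeff n * t ^ n‖ ≤
      ‖f‖ ^ (Real.log r / Real.log ‖t‖)⁻¹ :=
  (Real.le_rpow_inv_iff_of_pos (Finset.sum_nonneg fun _ _ => norm_nonneg _)
    (norm_nonneg_hyb f) (exponent_pos ht0 ht)).2 (norm_sum_rpow_le ht0 ht f s)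

lemma summable_norm_evalAt {t : ℂ} (ht0 : t ≠ 0) (ht : ‖t‖ ≤ r) (f : hybridRing r) :
    Summable fun n : ℤ => ‖(f : LaurentSeries ℂ).coeff n * t ^ n‖ :=
  summable_of_sum_le (fun _ => norm_nonneg _) (norm_sum_le_rpow_inv ht0 ht f)

lemma evalAt_le {t : ℂ} (ht0 : t ≠ 0) (ht : ‖t‖ ≤ r) (f : hybridRing r) :
    ‖evalAt t f‖ ^ (Real.log r / Real.log ‖t‖) ≤ ‖f‖ := by
  rw [← Real.le_rpow_inv_iff_of_pos (norm_nonneg _) (norm_nonneg_hyb f) (exponent_pos ht0 ht)]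
  have hs := summable_norm_evalAt ht0 ht f
  exact (norm_tsum_le_tsum_norm hs).trans (hs.tsum_le_of_sum_le (norm_sum_le_rpow_inv ht0 ht f))

lemma evalAt_add {t : ℂ} (ht0 : t ≠ 0) (ht : ‖t‖ ≤ r) (f g : hybridRing r) :
    evalAt t (f + g) = evalAt t f + evalAt t g := by
  unfold evalAt
  rw [← (summable_norm_evalAt ht0 ht f).of_norm.tsum_add (summable_norm_evalAt ht0 ht g).of_norm]
  exact tsum_congr fun n => by simp [add_mul]

lemma evalAt_neg (t : ℂ) (f : hybridRing r) : evalAt t (-f) = -evalAt t f := by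
  unfold evalAt
  rw [← tsum_neg]
  exact tsum_congr fun n => by simp

lemma evalAt_zero (t : ℂ) : evalAt t (0 : hybridRing r) = 0 := by simp [evalAt]

lemma evalAt_one (t : ℂ) : evalAt t (1 : hybridRing r) = 1 := by
  unfold evalAt
  rw [tsum_eq_single 0]
  · simp [HahnSeries.coeff_one]
  · intro n hn
    simp [HahnSeries.coeff_one, hn]

lemma hasSum_conv {a b c : ℤ → ℂ} (ha : Summable fun n => ‖a n‖) (hb : Summable fun n => ‖b n‖)
    (hc : ∀ n, HasSum (fun i => a i * b (n - i)) (c n)) :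
    HasSum c ((∑' n, a n) * ∑' n, b n) := by
  have h1 : HasSum (fun x : ℤ × ℤ => a x.1 * b x.2) ((∑' n, a n) * ∑' n, b n) :=
    ha.of_norm.hasSum.mul hb.of_norm.hasSum (summable_mul_of_summable_norm ha hb)
  have h2 : HasSum (fun x : ℤ × ℤ => a x.2 * b (x.1 - x.2)) ((∑' n, a n) * ∑' n, b n) :=
    shiftEquiv.hasSum_iff.2 h1
  exact h2.prod_fiberwise hc

lemma evalAt_mul {t : ℂ} (ht0 : t ≠ 0) (ht : ‖t‖ ≤ r) (f g : hybridRing r) :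
    evalAt t (f * g) = evalAt t f * evalAt t g := by
  refine (hasSum_conv (summable_norm_evalAt ht0 ht f) (summable_norm_evalAt ht0 ht g)
    (fun n => ?_)).tsum_eq
  obtain ⟨s, hs, hs'⟩ := coeff_mul_eq_sum (f : LaurentSeries ℂ) g n
  have h4 : ∀ i : ℤ, t ^ n = t ^ i * t ^ (n - i) := fun i => by
    rw [← zpow_add₀ ht0]; simp
  have h5 : ((f * g : hybridRing r) : LaurentSeries ℂ).coeff n * t ^ n =
      ∑ i ∈ s, (f : LaurentSeries ℂ).coeff i * t ^ i *
        ((g : LaurentSeries ℂ).coeff (n - i) * t ^ (n - i)) := by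
    rw [Subring.coe_mul, hs, Finset.sum_mul]
    refine Finset.sum_congr rfl fun i _ => ?_
    rw [h4 i]; ring
  rw [h5]
  refine hasSum_sum_of_ne_finset_zero fun i hi => ?_
  rw [mul_mul_mul_comm, hs' i hi, zero_mul]

/-- The point `f ↦ r ^ (log |f(t)| / log |t|) = |f(t)| ^ (log r / log |t|)` of the hybrid circle,
for `0 < |t| ≤ r`. -/
def archPoint (t : ℂ) (ht0 : t ≠ 0) (ht : ‖t‖ ≤ r) : HybridCircle r where
  toFun f := ‖evalAt t f‖ ^ (Real.log r / Real.log ‖t‖)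
  map_zero' := by simp [evalAt_zero, Real.zero_rpow (exponent_pos ht0 ht).ne']
  add_le' f g := by
    rw [evalAt_add ht0 ht]
    exact (Real.rpow_le_rpow (norm_nonneg _) (norm_add_le _ _) (exponent_pos ht0 ht).le).trans
      (rpow_add_le (exponent_pos ht0 ht).le (exponent_le_one ht0 ht) (norm_nonneg _)
        (norm_nonneg _))
  neg' f := by simp [evalAt_neg]
  map_one' := by simp [evalAt_one]
  map_mul' f g := by
    rw [evalAt_mul ht0 ht, norm_mul, Real.mul_rpow (norm_nonneg _) (norm_nonneg _)]
  le_norm' f := evalAt_le ht0 ht f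

open Classical in
/-- The `t`-adic absolute value `r ^ ord_0(f)`. -/
def adicAbs (f : hybridRing r) : ℝ :=
  if f = 0 then 0 else (r : ℝ) ^ (f : LaurentSeries ℂ).order

lemma adicAbs_of_ne {f : hybridRing r} (hf : f ≠ 0) :
    adicAbs f = (r : ℝ) ^ (f : LaurentSeries ℂ).order := by simp [adicAbs, hf]

lemma adicAbs_nonneg (f : hybridRing r) : 0 ≤ adicAbs f := by
  unfold adicAbs
  split_ifs
  · exact le_rfl
  · exact zpow_nonneg r.2.1.le _

/-- The point `f ↦ r ^ ord_0(f)` of the hybrid circle. -/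
def adicPoint : HybridCircle r where
  toFun := adicAbs
  map_zero' := by simp [adicAbs]
  add_le' f g := by
    by_cases hf : f = 0
    · simp [hf, adicAbs_nonneg]
    by_cases hg : g = 0
    · simp [hg, adicAbs_nonneg]
    by_cases h : f + g = 0
    · rw [h]
      simpa [adicAbs] using! add_nonneg (adicAbs_nonneg f) (adicAbs_nonneg g)
    have h' : (f : LaurentSeries ℂ) + g ≠ 0 := fun h0 => h (Subtype.ext h0)
    have hm := HahnSeries.min_order_le_order_add h'
    rw [adicAbs_of_ne h]
    rcases min_le_iff.1 hm with h1 | h1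
    · refine le_trans ?_ (le_add_of_nonneg_right (adicAbs_nonneg g))
      rw [adicAbs_of_ne hf]
      exact zpow_le_zpow_right_of_le_one₀ r.2.1 r.2.2.le h1
    · refine le_trans ?_ (le_add_of_nonneg_left (adicAbs_nonneg f))
      rw [adicAbs_of_ne hg]
      exact zpow_le_zpow_right_of_le_one₀ r.2.1 r.2.2.le h1
  neg' f := by
    by_cases hf : f = 0
    · simp [hf]
    · rw [adicAbs_of_ne hf, adicAbs_of_ne (neg_ne_zero.2 hf), Subring.coe_neg,
        HahnSeries.order_neg]
  map_one' := by simp [adicAbs]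
  map_mul' f g := by
    by_cases hf : f = 0
    · simp [hf, adicAbs]
    by_cases hg : g = 0
    · simp [hg, adicAbs]
    have hf' : (f : LaurentSeries ℂ) ≠ 0 := fun h0 => hf (Subtype.ext h0)
    have hg' : (g : LaurentSeries ℂ) ≠ 0 := fun h0 => hg (Subtype.ext h0)
    have h : f * g ≠ 0 := fun h0 => mul_ne_zero hf' hg' (congrArg Subtype.val h0)
    rw [adicAbs_of_ne h, adicAbs_of_ne hf, adicAbs_of_ne hg, ← zpow_add₀ r.2.1.ne']
    congr 1
    exact HahnSeries.order_mul hf' hg'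
  le_norm' f := by
    by_cases hf : f = 0
    · rw [hf]
      simpa [adicAbs] using! norm_nonneg_hyb (0 : hybridRing r)
    have hf' : (f : LaurentSeries ℂ) ≠ 0 := fun h0 => hf (Subtype.ext h0)
    rw [adicAbs_of_ne hf]
    have h1 := (summable_hyb f).le_tsum (f : LaurentSeries ℂ).order
      fun n _ => mul_nonneg (hybNorm_nonneg _) (zpow_nonneg r.2.1.le _)
    refine le_trans ?_ h1
    exact le_mul_of_one_le_left (zpow_nonneg r.2.1.le _)
      (one_le_hybNorm (HahnSeries.coeff_order_eq_zero.not.2 hf'))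

open Classical in
/-- The map `τ` from the closed disk of radius `r` to the hybrid circle, sending `0` to
`f ↦ r ^ ord_0(f)` and `t ≠ 0` to `f ↦ r ^ (log |f(t)| / log |t|)`. -/
def tau (t : Metric.closedBall (0 : ℂ) r) : HybridCircle r :=
  if h : (t : ℂ) = 0 then adicPoint else archPoint t h (mem_closedBall_zero_iff.1 t.2)

end Points

/-! ### Subharmonic functions on disks and Lelong numbers -/

/-- The mean value over the circle of centre `z` and radius `s` of an extended-real-valued function
which is bounded above on this circle, as the difference of the means of its positive part (which
is finite) and of its negative part. -/
def circleMean (u : ℂ → EReal) (z : ℂ) (s : ℝ) : EReal :=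
  ((ENNReal.ofReal (2 * Real.pi)⁻¹ *
      ∫⁻ θ in Set.Ioc 0 (2 * Real.pi), (u (circleMap z s θ)).toENNReal : ENNReal) : EReal) -
  ((ENNReal.ofReal (2 * Real.pi)⁻¹ *
      ∫⁻ θ in Set.Ioc 0 (2 * Real.pi), (-u (circleMap z s θ)).toENNReal : ENNReal) : EReal)

/-- Subharmonic functions on a connected open set `U` of `ℂ`: upper semicontinuous with values in
`[-∞, ∞)`, not identically `-∞`, and satisfying the sub-mean value inequality. -/
structure IsSubharmonicOn (u : ℂ → EReal) (U : Set ℂ) : Prop where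
  usc : UpperSemicontinuousOn u U
  lt_top : ∀ z ∈ U, u z < ⊤
  exists_ne_bot : ∃ z ∈ U, u z ≠ ⊥
  le_mean : ∀ (z : ℂ) (s : ℝ), 0 < s → Metric.closedBall z s ⊆ U → u z ≤ circleMean u z s

/-- The open punctured disk `𝔻_R^*` of radius `R`. -/
abbrev PuncturedDisk (R : ℝ) : Type := {t : ℂ // 0 < ‖t‖ ∧ ‖t‖ < R}

/-- `SH(𝔻_R) + ℝ log |t|`, as a set of functions on the punctured disk of radius `R`: the
functions `u + c log |t|` with `u` subharmonic on the disk of radius `R` and `c` real. -/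
def SHLog (R : ℝ) : Set (PuncturedDisk R → EReal) :=
  {f | ∃ u : ℂ → EReal, IsSubharmonicOn u (Metric.ball 0 R) ∧
    ∃ c : ℝ, ∀ t : PuncturedDisk R, f t = u t + ((c * Real.log ‖(t : ℂ)‖ : ℝ) : EReal)}

/-- The (generalized) Lelong number at `0`:
the supremum of the real numbers `γ` such that `f ≤ γ log |t| + O(1)` near `0`. -/
def lelong {R : ℝ} (f : PuncturedDisk R → EReal) : EReal :=
  ⨆ γ : {γ : ℝ // ∃ C ε : ℝ, 0 < ε ∧ ∀ t : PuncturedDisk R, ‖(t : ℂ)‖ < ε →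
    f t ≤ ((γ * Real.log ‖(t : ℂ)‖ + C : ℝ) : EReal)}, ((γ : ℝ) : EReal)

/-! ### The rescaling -/

/-- The inclusion of the punctured open disk of radius `r` in the closed disk of radius `r`. -/
def PuncturedDisk.toClosedDisk {r : ℝ} (t : PuncturedDisk r) : Metric.closedBall (0 : ℂ) r :=
  ⟨t, mem_closedBall_zero_iff.2 t.2.2.le⟩

/-- The restriction of functions from a punctured disk to a smaller one. -/
def restrictDisk {r R : ℝ} (h : r < R) (f : PuncturedDisk R → EReal) : PuncturedDisk r → EReal :=
  fun t => f ⟨t, t.2.1, t.2.2.trans h⟩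

/-- The rescaling `ρ_r(φ)(t) = log_r |t| * φ(τ(t))`, for `0 < |t| < r`. -/
def rho (r : Set.Ioo (0 : ℝ) 1) (φ : HybridCircle r → EReal) : PuncturedDisk (r : ℝ) → EReal :=
  fun t => ((Real.logb r ‖(t : ℂ)‖ : ℝ) : EReal) * φ (tau t.toClosedDisk)

end Hybrid

end

/-!
# Plurisubharmonic functions on the hybrid circle

*The hybrid circle.* Let `x` be a bounded multiplicative seminorm on `A_r`. On the constants it is
`|·| ^ s` for some `s ∈ [0, 1]` (`exists_eval_hybC_eq_rpow`), and `|t|_x = r`. If `s = 0`, then `x`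
is non-archimedean and equal to the `t`-adic point `τ 0`. If `s > 0`, a Gelfand–Mazur argument shows
that some `t - a` vanishes at `x` (`exists_eval_hybX_sub_eq_zero`), so that `x = τ a`. Hence `τ` is
surjective (`tau_surjective`); it is continuous and injective on a compact space, the images of the
points of the punctured open disk are dense (`denseRange_tau`), and `τ 0` is the only point with
zero kernel (`eq_adicPoint_of_isZariskiDense`).

*From the hybrid circle to the disk.* If `f = t ^ n g(t)`, with `g` holomorphic, then the rescaling
of `log |f|` is `log |f(t)|`, and that of a constant `c` is `c log_r |t|`. The rescaling of a
tropical Fubini–Study function is therefore a maximum of functions `a log |g| + b log |t|`, and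
after subtraction of a large negative multiple of `log |t|`, uniform along a decreasing net, all
exponents are nonnegative and Jensen's inequality gives the sub-mean value inequality
(`elog_le_circleMean`, `IsTropicalFS.exists_rescaling`). A decreasing net of upper semicontinuous
functions on a hereditarily Lindelöf space has the same infimum as a decreasing sequence extracted
from it, so monotone convergence shows that the infimum is subharmonic or `-∞`
(`isSubharmonicOn_iInf`, `rho_mem_SHLog`). For continuous `φ`, the quotient
`ρ_r(φ)(t) / log |t| = φ(τ t) / log r` tends to `φ(τ 0) / log r` at the origin, and this limit is the
Lelong number (`apply_tau_zero_eq_lelong`); injectivity on continuous functions is density.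

*From the disk to the hybrid circle.* The values prescribed for `ρ_{r',r}(f)` define a function
`extendDisk` on the hybrid circle. The Lelong number entering it is finite: comparison with
multiples of `log |t|` on annuli shows that a subharmonic function does not tend to `-∞` faster than
all of them (`IsSubharmonicOn.le_of_annulus`, `IsSubharmonicOn.exists_not_le`). The definition of
the Lelong number as a supremum makes `extendDisk` upper semicontinuous at `τ 0`. It remains to see
that it is the limit of a decreasing net of tropical Fubini–Study functions. The tropical
Fubini–Study functions lying strictly above it form such a net as soon as one of them fits below any
larger continuous function `k` (`exists_tropicalFS_between`, `extendDisk_mem_PSH`). By compactness,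
and since maxima of tropical Fubini–Study functions are again such functions, a function below `k`
is only needed to lie above `extendDisk` at one given point (`exists_tropicalFS_at`). For this, one
subtracts `γ log |t|` from `f`, with `γ` slightly less than the Lelong number, and truncates the
result from below by a constant: the truncation is bounded and subharmonic across the origin
(`IsSubharmonicOn.exists_truncation`). Its convolution with the kernel `log⁺ (s / |z|)` is the
logarithmic potential of a positive density, because the circle average of `log |z - ·|` exceeds
`log |z|` by that kernel (`integral_logDefect_mul`). Replacing the density by finitely many point
masses with rational weights turns the potential into `m⁻¹ log |P|` with a polynomial `P`
(`exists_discretization`, `exists_polynomial_of_weights`, `exists_polynomial_approx`), and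
`γ log |t| + max (m⁻¹ log |P|, -N)` comes from a tropical Fubini–Study function
(`isTropicalFS_polynomial`).
-/

namespace Hybrid

open Real (posLog)

/-! ### Logarithmic kernels on the plane -/

/-- The defect `log⁺ (s / |z|)` of `log |z|` from harmonicity at scale `s`: the difference between
the mean value of `log |·|` over the circle of radius `s` around `z` and `log |z|`. -/
noncomputable def logDefect (s : ℝ) (z : ℂ) : ℝ := posLog (s * ‖z‖⁻¹)

lemma logDefect_nonneg (s : ℝ) (z : ℂ) : 0 ≤ logDefect s z := Real.posLog_nonneg

lemma measurable_posLog : Measurable posLog := Real.continuous_posLog.measurable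

lemma logDefect_eq_zero {s : ℝ} (hs : 0 < s) {z : ℂ} (hz : s ≤ ‖z‖) : logDefect s z = 0 := by
  rw [logDefect, Real.posLog_eq_zero_iff, abs_of_nonneg (by positivity), ← div_eq_mul_inv]
  exact div_le_one_of_le₀ hz (norm_nonneg _)

lemma logDefect_one_integrable : Integrable (logDefect 1) := by
  have h : Integrable (fun z : ℂ => (fun y : ℝ => posLog (1 * y⁻¹)) ‖z‖) := by
    refine (integrable_fun_norm_addHaar volume (f := fun y : ℝ => posLog (1 * y⁻¹))).2 ?_
    simp only [Complex.finrank_real_complex, Nat.add_one_sub_one, pow_one, smul_eq_mul, one_mul]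
    -- the radial density `y log⁺ (1/y)` is at most `1`, and vanishes for `y ≥ 1`
    have h1 : IntegrableOn (fun _ : ℝ => (1 : ℝ)) (Set.Ioo 0 1) := by simp
    have h2 : IntegrableOn (fun y : ℝ => (Set.Ioo (0 : ℝ) 1).indicator (fun _ => (1 : ℝ)) y)
        (Set.Ioi 0) := ((integrable_indicator_iff measurableSet_Ioo).2 h1).integrableOn
    refine h2.mono' ?_ ?_
    · exact (measurable_id.mul (measurable_posLog.comp measurable_inv)).aestronglyMeasurable
    · refine (ae_restrict_iff' measurableSet_Ioi).2 (ae_of_all _ fun y hy => ?_)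
      have hy : 0 < y := hy
      rw [Real.norm_of_nonneg (mul_nonneg hy.le Real.posLog_nonneg)]
      by_cases hy1 : y < 1
      · rw [Set.indicator_of_mem (show y ∈ Set.Ioo (0 : ℝ) 1 from ⟨hy, hy1⟩)]
        have h3 : posLog y⁻¹ ≤ y⁻¹ := by
          rw [Real.posLog_apply]
          exact max_le (by positivity) ((Real.log_le_sub_one_of_pos (by positivity)).trans
            (by linarith))
        calc y * posLog y⁻¹ ≤ y * y⁻¹ := by gcongr
          _ = 1 := mul_inv_cancel₀ hy.ne'
      · have : posLog y⁻¹ = 0 := by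
          rw [Real.posLog_eq_zero_iff, abs_of_nonneg (by positivity)]
          exact inv_le_one_of_one_le₀ (not_lt.1 hy1)
        rw [this, mul_zero]
        exact Set.indicator_nonneg (fun _ _ => zero_le_one) _
  exact h

lemma logDefect_scale {s : ℝ} (hs : 0 < s) (z : ℂ) : logDefect s z = logDefect 1 (s⁻¹ • z) := by
  rw [logDefect, logDefect, norm_smul, Real.norm_of_nonneg (by positivity)]
  congr 1
  field_simp

lemma logDefect_integrable {s : ℝ} (hs : 0 < s) : Integrable (logDefect s) := by
  have := (integrable_comp_smul_iff volume (logDefect 1) (R := s⁻¹) (by positivity)).2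
    logDefect_one_integrable
  exact this.congr (ae_of_all _ fun z => (logDefect_scale hs z).symm)

lemma integral_logDefect {s : ℝ} (hs : 0 < s) :
    ∫ z, logDefect s z = s ^ 2 * ∫ z, logDefect 1 z := by
  simp_rw [logDefect_scale hs]
  rw [Measure.integral_comp_inv_smul]
  simp [abs_of_pos hs]

lemma integral_logDefect_pos {s : ℝ} (hs : 0 < s) : 0 < ∫ z, logDefect s z := by
  rw [integral_pos_iff_support_of_nonneg (logDefect_nonneg s) (logDefect_integrable hs)]
  have h : Metric.ball (0 : ℂ) s \ {0} ⊆ Function.support (logDefect s) := by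
    rintro z ⟨hz, hz0⟩
    have hz0 : 0 < ‖z‖ := norm_pos_iff.2 hz0
    have hz : ‖z‖ < s := by simpa using hz
    rw [Function.mem_support, logDefect, Ne, Real.posLog_eq_zero_iff, not_le,
      abs_of_nonneg (by positivity), ← div_eq_mul_inv]
    exact (one_lt_div hz0).2 hz
  refine lt_of_lt_of_le ?_ (measure_mono h)
  rw [measure_sdiff_null (measure_singleton _)]
  exact Metric.measure_ball_pos _ _ hs

lemma log_norm_eq (z : ℂ) : Real.log ‖z‖ = posLog ‖z‖ - logDefect 1 z := by
  rw [logDefect, one_mul, Real.posLog_sub_posLog_inv]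

/-- The logarithmic potential kernel is integrable against bounded measurable functions with bounded
support. -/
lemma integrable_log_mul {σ : ℂ → ℝ} (hσ : Measurable σ) {B R : ℝ} (hB : ∀ w, |σ w| ≤ B)
    (hR : ∀ w, R < ‖w‖ → σ w = 0) (z : ℂ) :
    Integrable (fun w => Real.log ‖z - w‖ * σ w) := by
  simp_rw [log_norm_eq, sub_mul]
  refine Integrable.sub ?_ ?_
  · have h1 : IntegrableOn (fun w : ℂ => posLog ‖z - w‖ * B) (Metric.closedBall 0 R) :=
      ((Real.continuous_posLog.comp
        (by fun_prop)).mul continuous_const).continuousOn.integrableOn_compact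
        (isCompact_closedBall _ _)
    refine ((integrable_indicator_iff Metric.isClosed_closedBall.measurableSet).2 h1).mono'
      ((measurable_posLog.comp (by fun_prop)).mul hσ).aestronglyMeasurable (ae_of_all _ fun w => ?_)
    by_cases hw : w ∈ Metric.closedBall (0 : ℂ) R
    · rw [Set.indicator_of_mem hw, norm_mul, Real.norm_of_nonneg Real.posLog_nonneg]
      exact mul_le_mul_of_nonneg_left (hB w) Real.posLog_nonneg
    · rw [Set.indicator_of_notMem hw, hR w (by simpa using hw)]
      simp
  · refine Integrable.mul_bdd (c := B) ?_ hσ.aestronglyMeasurable (ae_of_all _ hB)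
    exact (logDefect_integrable one_pos).comp_sub_left z

/-- The circle average of `log |· - w|` exceeds its value at the centre by `logDefect`. -/
lemma circleAverage_log_sub {s : ℝ} (hs : 0 < s) {z w : ℂ} (hzw : z ≠ w) :
    Real.circleAverage (fun u : ℂ => Real.log ‖u - w‖) z s =
      Real.log ‖z - w‖ + logDefect s (z - w) := by
  have h0 : 0 < ‖z - w‖ := norm_pos_iff.2 (sub_ne_zero.2 hzw)
  rw [circleAverage_log_norm_sub_const_eq_log_radius_add_posLog hs.ne', logDefect]
  have h1 := Real.posLog_sub_posLog_inv (x := s⁻¹ * ‖z - w‖)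
  rw [Real.log_mul (by positivity) h0.ne', Real.log_inv, mul_inv, inv_inv] at h1
  linarith

/-! ### Averages over rotations -/

lemma measurePreserving_rotate (θ : ℝ) :
    MeasurePreserving (fun w : ℂ => Complex.exp (θ * Complex.I) * w) volume volume := by
  have h : (fun w : ℂ => Complex.exp (θ * Complex.I) * w) = rotation (Circle.exp θ) := by
    ext w
    simp [rotation_apply, Circle.coe_exp]
  rw [h]
  exact (rotation (Circle.exp θ)).measurePreserving

/-- Rotating the variable and averaging over all rotations does not change an integral. -/
lemma integral_eq_integral_circleAverage {F : ℂ → ℝ} (hF : Integrable F) :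
    ∫ w, F w = ∫ w : ℂ, Real.circleAverage F 0 ‖w‖ := by
  set μ : Measure ℝ := volume.restrict (Set.Ioc 0 (2 * Real.pi)) with hμ
  have hpi : (0 : ℝ) ≤ 2 * Real.pi := by positivity
  have hmeas : Measurable (Function.uncurry fun (θ : ℝ) (w : ℂ) =>
      Complex.exp (θ * Complex.I) * w) := by
    unfold Function.uncurry; fun_prop
  have hmp : MeasurePreserving (fun p : ℝ × ℂ => (p.1, Complex.exp (p.1 * Complex.I) * p.2))
      (μ.prod volume) (μ.prod volume) :=
    (MeasurePreserving.id μ).skew_product hmeas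
      (ae_of_all _ fun θ => (measurePreserving_rotate θ).map_eq)
  have hint : Integrable (fun p : ℝ × ℂ => F (Complex.exp (p.1 * Complex.I) * p.2))
      (μ.prod volume) := by
    have h1 : Integrable (fun p : ℝ × ℂ => F p.2) (μ.prod volume) := hF.comp_snd μ
    exact hmp.integrable_comp_of_integrable h1
  have hswap := integral_integral_swap (f := fun (θ : ℝ) (w : ℂ) =>
    F (Complex.exp (θ * Complex.I) * w)) hint
  have h2 : ∀ θ : ℝ, ∫ w, F (Complex.exp (θ * Complex.I) * w) = ∫ w, F w := fun θ =>
    (measurePreserving_rotate θ).integral_comp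
      (by exact (rotation (Circle.exp θ)).toHomeomorph.measurableEmbedding) F
  have h3 : ∀ w : ℂ, ∫ θ, F (Complex.exp (θ * Complex.I) * w) ∂μ =
      2 * Real.pi * Real.circleAverage F 0 ‖w‖ := by
    intro w
    rw [Real.circleAverage_eq_integral_add w.arg, smul_eq_mul, ← mul_assoc,
      mul_inv_cancel₀ (by positivity), one_mul, intervalIntegral.integral_of_le hpi]
    refine integral_congr_ae (ae_of_all _ fun θ => ?_)
    simp only [circleMap, zero_add]
    congr 1
    conv_lhs => rw [← Complex.norm_mul_exp_arg_mul_I w]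
    push_cast
    rw [add_mul, Complex.exp_add]
    ring
  simp_rw [h2, h3] at hswap
  rw [integral_const_mul, integral_const] at hswap
  simp only [hμ, measureReal_restrict_apply MeasurableSet.univ, Set.univ_inter,
    Real.volume_real_Ioc_of_le hpi, smul_eq_mul, sub_zero] at hswap
  exact mul_left_cancel₀ (by positivity) hswap

/-! ### Smoothing by logarithmic defects -/

lemma circleAverage_eq_setIntegral (G : ℂ → ℝ) (w : ℂ) (s : ℝ) :
    Real.circleAverage G w s =
      (2 * Real.pi)⁻¹ * ∫ θ in Set.Ioc 0 (2 * Real.pi), G (circleMap w s θ) := by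
  rw [Real.circleAverage, intervalIntegral.integral_of_le (by positivity), smul_eq_mul]

lemma measurable_circleAverage {G : ℂ → ℝ} (hG : Measurable G) (s : ℝ) :
    Measurable fun w => Real.circleAverage G w s := by
  simp_rw [circleAverage_eq_setIntegral]
  refine Measurable.const_mul ?_ _
  refine StronglyMeasurable.measurable (StronglyMeasurable.integral_prod_right'
    (f := fun p : ℂ × ℝ => G (circleMap p.1 s p.2)) ?_)
  refine (hG.comp ?_).stronglyMeasurable
  unfold circleMap
  fun_prop

lemma circleIntegrable_of_bounded {G : ℂ → ℝ} (hG : Measurable G) {M : ℝ} (hM : ∀ w, |G w| ≤ M)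
    (w : ℂ) (s : ℝ) : CircleIntegrable G w s := by
  rw [CircleIntegrable, intervalIntegrable_iff]
  exact Measure.integrableOn_of_bounded (by simp [ENNReal.mul_eq_top])
    (hG.comp (continuous_circleMap w s).measurable).aestronglyMeasurable
    (ae_of_all _ fun θ => hM _)

lemma abs_circleAverage_le {G : ℂ → ℝ} {M : ℝ} (hM : ∀ w, |G w| ≤ M) (w : ℂ) (s : ℝ) :
    |Real.circleAverage G w s| ≤ M := by
  have h := norm_setIntegral_le_of_norm_le_const (μ := volume) (s := Set.Ioc 0 (2 * Real.pi))
    (f := fun θ => G (circleMap w s θ)) (C := M) measure_Ioc_lt_top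
    (fun θ _ => hM _)
  rw [Real.volume_real_Ioc_of_le (by positivity), sub_zero, Real.norm_eq_abs] at h
  rw [circleAverage_eq_setIntegral, abs_mul, abs_of_pos (by positivity)]
  rwa [inv_mul_le_iff₀ (by positivity), mul_comm (2 * Real.pi)]

/-- Convolving with the kernel `logDefect s` amounts to taking the logarithmic potential of the
difference between circle averages and values. -/
lemma integral_logDefect_mul {G : ℂ → ℝ} (hG : Measurable G) {M R s : ℝ} (hs : 0 < s)
    (hM : ∀ w, |G w| ≤ M) (hR : ∀ w, R < ‖w‖ → G w = 0) (z : ℂ) :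
    ∫ w, logDefect s (z - w) * G w =
      ∫ w, Real.log ‖z - w‖ * (Real.circleAverage G w s - G w) := by
  have hM0 : 0 ≤ M := (abs_nonneg _).trans (hM 0)
  have hpi : (0 : ℝ) ≤ 2 * Real.pi := by positivity
  set μ : Measure ℝ := volume.restrict (Set.Ioc 0 (2 * Real.pi)) with hμ
  have hnorm : ∀ θ : ℝ, ‖circleMap 0 s θ‖ = s := fun θ => by
    rw [norm_circleMap_zero, abs_of_pos hs]
  have hcm : ∀ (w : ℂ) (θ : ℝ), circleMap w s θ = w + circleMap 0 s θ := fun w θ => by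
    simp [circleMap]
  have hGs : ∀ (w : ℂ) (θ : ℝ), R + s < ‖w‖ → G (w + circleMap 0 s θ) = 0 := fun w θ hw => by
    refine hR _ ?_
    have := norm_sub_le (w + circleMap 0 s θ) (circleMap 0 s θ)
    rw [add_sub_cancel_right, hnorm] at this
    linarith
  have hcmeas : Measurable (circleMap 0 s) := (continuous_circleMap 0 s).measurable
  have hΨ : Integrable (fun p : ℝ × ℂ => Real.log ‖z - p.2‖ * G (p.2 + circleMap 0 s p.1))
      (μ.prod volume) := by
    have h1 : Integrable (fun w : ℂ => Real.log ‖z - w‖ *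
        (Metric.closedBall (0 : ℂ) (R + s)).indicator (fun _ => M) w) := by
      refine integrable_log_mul (B := M) (R := R + s)
        (measurable_const.indicator Metric.isClosed_closedBall.measurableSet) (fun w => ?_)
        (fun w hw => Set.indicator_of_notMem (by simpa using hw) _) z
      by_cases hw : w ∈ Metric.closedBall (0 : ℂ) (R + s)
      · rw [Set.indicator_of_mem hw, abs_of_nonneg hM0]
      · rw [Set.indicator_of_notMem hw]; simpa using hM0
    refine (h1.comp_snd μ).mono ?_ (ae_of_all _ fun p => ?_)
    · have h2 : Measurable fun p : ℝ × ℂ => G (p.2 + circleMap 0 s p.1) :=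
        hG.comp (measurable_snd.add (hcmeas.comp measurable_fst))
      have h3 : Measurable fun p : ℝ × ℂ => Real.log ‖z - p.2‖ := by fun_prop
      exact (h3.mul h2).aestronglyMeasurable
    · rw [norm_mul, norm_mul]
      refine mul_le_mul_of_nonneg_left ?_ (norm_nonneg _)
      by_cases hw : p.2 ∈ Metric.closedBall (0 : ℂ) (R + s)
      · rw [Set.indicator_of_mem hw, Real.norm_of_nonneg hM0]
        exact hM _
      · rw [hGs _ _ (by simpa using hw)]
        simp
  have hmp : MeasurePreserving (fun p : ℝ × ℂ => (p.1, p.2 - circleMap 0 s p.1))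
      (μ.prod volume) (μ.prod volume) := by
    refine (MeasurePreserving.id μ).skew_product (g := fun θ w => w - circleMap 0 s θ) ?_
      (ae_of_all _ fun θ => (measurePreserving_sub_right volume _).map_eq)
    exact measurable_snd.sub (hcmeas.comp measurable_fst)
  have hΦ : Integrable (fun p : ℝ × ℂ => Real.log ‖z + circleMap 0 s p.1 - p.2‖ * G p.2)
      (μ.prod volume) := by
    refine (hmp.integrable_comp_of_integrable hΨ).congr (ae_of_all _ fun p => ?_)
    simp only [Function.comp, sub_add_cancel]
    congr 3
    ring
  have e1 := integral_integral_swap (f := fun (θ : ℝ) (w : ℂ) =>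
    Real.log ‖z - w‖ * G (w + circleMap 0 s θ)) hΨ
  have e2 := integral_integral_swap (f := fun (θ : ℝ) (w : ℂ) =>
    Real.log ‖z + circleMap 0 s θ - w‖ * G w) hΦ
  have e3 : ∀ θ : ℝ, ∫ w, Real.log ‖z - w‖ * G (w + circleMap 0 s θ) =
      ∫ w, Real.log ‖z + circleMap 0 s θ - w‖ * G w := fun θ => by
    rw [← integral_sub_right_eq_self (fun w => Real.log ‖z - w‖ * G (w + circleMap 0 s θ))
      (circleMap 0 s θ)]
    refine integral_congr_ae (ae_of_all _ fun w => ?_)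
    simp only [sub_add_cancel]
    congr 3
    ring
  have e4 : ∀ w : ℂ, ∫ θ, Real.log ‖z - w‖ * G (w + circleMap 0 s θ) ∂μ =
      2 * Real.pi * (Real.log ‖z - w‖ * Real.circleAverage G w s) := fun w => by
    rw [integral_const_mul, circleAverage_eq_setIntegral]
    simp_rw [hcm w, ← hμ]
    field_simp
  have e5 : ∀ w : ℂ, ∫ θ, Real.log ‖z + circleMap 0 s θ - w‖ * G w ∂μ =
      2 * Real.pi * (Real.circleAverage (fun u : ℂ => Real.log ‖u - w‖) z s * G w) := fun w => by
    rw [integral_mul_const, circleAverage_eq_setIntegral]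
    simp_rw [hcm z, ← hμ]
    field_simp
  simp_rw [e3, e4] at e1
  simp_rw [e5] at e2
  rw [e1, integral_const_mul, integral_const_mul] at e2
  have e6 := mul_left_cancel₀ (by positivity) e2
  have hl := integrable_log_mul hG hM hR z
  have hA : Integrable fun w => Real.log ‖z - w‖ * Real.circleAverage G w s := by
    refine integrable_log_mul (measurable_circleAverage hG s) (B := M) (R := R + s)
      (fun w => abs_circleAverage_le hM w s) (fun w hw => ?_) z
    rw [circleAverage_eq_setIntegral]
    simp_rw [hcm w, hGs w _ hw]
    simp
  have hD : Integrable fun w => logDefect s (z - w) * G w :=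
    ((logDefect_integrable hs).comp_sub_left z).mul_bdd hG.aestronglyMeasurable
      (ae_of_all _ hM)
  have e7 : ∫ w, Real.circleAverage (fun u : ℂ => Real.log ‖u - w‖) z s * G w =
      ∫ w, (Real.log ‖z - w‖ * G w + logDefect s (z - w) * G w) := by
    refine integral_congr_ae ?_
    have : ∀ᵐ w : ℂ, w ≠ z := by simp [ae_iff]
    filter_upwards [this] with w hw
    rw [circleAverage_log_sub hs hw.symm]
    ring
  rw [e7, integral_add hl hD] at e6
  simp_rw [mul_sub]
  rw [integral_sub hA hl, e6]
  ring

/-- A function which is at most its mean values over small circles around `z` is at most its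
smoothing at `z`. -/
lemma mul_le_integral_logDefect_mul {G : ℂ → ℝ} (hG : Measurable G) {M s : ℝ} (hs : 0 < s)
    (hM : ∀ w, |G w| ≤ M) {z : ℂ}
    (hz : ∀ ρ, 0 < ρ → ρ ≤ s → G z ≤ Real.circleAverage G z ρ) :
    (∫ w, logDefect s w) * G z ≤ ∫ w, logDefect s (z - w) * G w := by
  have hF : Integrable fun w => logDefect s w * G (z + w) :=
    (logDefect_integrable hs).mul_bdd (hG.comp (by fun_prop)).aestronglyMeasurable
      (ae_of_all _ fun w => hM _)
  have h1 : ∫ w, logDefect s (z - w) * G w = ∫ w, logDefect s w * G (z + w) := by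
    rw [← integral_add_left_eq_self (μ := volume) (fun w : ℂ => logDefect s (z - w) * G w) z]
    refine integral_congr_ae (ae_of_all _ fun w => ?_)
    simp [logDefect]
  have h2 : ∀ w : ℂ, Real.circleAverage (fun w => logDefect s w * G (z + w)) 0 ‖w‖ =
      logDefect s w * Real.circleAverage G z ‖w‖ := fun w => by
    rw [circleAverage_eq_setIntegral, circleAverage_eq_setIntegral, mul_left_comm,
      ← integral_const_mul (logDefect s w)]
    congr 1
    refine integral_congr_ae (ae_of_all _ fun θ => ?_)
    simp [logDefect, circleMap]
  rw [h1, integral_eq_integral_circleAverage hF, ← integral_mul_const]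
  simp_rw [h2]
  refine integral_mono ((logDefect_integrable hs).mul_const _) ?_ fun w => ?_
  · have : Measurable fun w : ℂ => Real.circleAverage G z ‖w‖ := by
      simp_rw [circleAverage_eq_setIntegral]
      refine Measurable.const_mul ?_ _
      refine StronglyMeasurable.measurable (StronglyMeasurable.integral_prod_right'
        (f := fun p : ℂ × ℝ => G (circleMap z ‖p.1‖ p.2)) ?_)
      refine (hG.comp ?_).stronglyMeasurable
      unfold circleMap
      fun_prop
    exact (logDefect_integrable hs).mul_bdd this.aestronglyMeasurable
      (ae_of_all _ fun w => abs_circleAverage_le hM _ _)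
  · rcases eq_or_ne w 0 with rfl | hw
    · simp
    · by_cases hws : ‖w‖ ≤ s
      · exact mul_le_mul_of_nonneg_left (hz _ (norm_pos_iff.2 hw) hws) (logDefect_nonneg _ _)
      · simp [logDefect_eq_zero hs (not_le.1 hws).le]

/-- The smoothing is bounded by the values of the function at distance less than `s`. -/
lemma integral_logDefect_mul_le {G : ℂ → ℝ} (hG : Measurable G) {M s : ℝ} (hs : 0 < s)
    (hM : ∀ w, |G w| ≤ M) {z : ℂ} {h : ℝ} (hz : ∀ w, ‖z - w‖ < s → G w ≤ h) :
    ∫ w, logDefect s (z - w) * G w ≤ (∫ w, logDefect s w) * h := by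
  have h1 : ∫ w, logDefect s w = ∫ w, logDefect s (z - w) :=
    (integral_sub_left_eq_self (logDefect s) volume z).symm
  have hi := (logDefect_integrable hs).comp_sub_left z
  rw [h1, ← integral_mul_const]
  refine integral_mono (hi.mul_bdd hG.aestronglyMeasurable (ae_of_all _ hM))
    (hi.mul_const _) fun w => ?_
  by_cases hws : ‖z - w‖ < s
  · exact mul_le_mul_of_nonneg_left (hz w hws) (logDefect_nonneg _ _)
  · simp [logDefect_eq_zero hs (not_lt.1 hws)]

/-- The logarithmic potential of the area of an annulus around `0` is constant inside the
annulus. -/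
lemma integral_log_annulus {a b : ℝ} {z : ℂ} (hz : ‖z‖ < a) (B : ℝ) :
    ∫ w, Real.log ‖z - w‖ * {w : ℂ | a ≤ ‖w‖ ∧ ‖w‖ ≤ b}.indicator (fun _ => B) w =
      ∫ w, Real.log ‖w‖ * {w : ℂ | a ≤ ‖w‖ ∧ ‖w‖ ≤ b}.indicator (fun _ => B) w := by
  have hm : MeasurableSet {w : ℂ | a ≤ ‖w‖ ∧ ‖w‖ ≤ b} := by
    measurability
  have hF := integrable_log_mul (σ := {w : ℂ | a ≤ ‖w‖ ∧ ‖w‖ ≤ b}.indicator (fun _ => B))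
    (measurable_const.indicator hm) (B := |B|) (R := b) (fun w => by
      rw [Set.indicator_apply]; split_ifs <;> simp)
    (fun w hw => Set.indicator_of_notMem (fun h => absurd h.2 (not_le.2 hw)) _) z
  rw [integral_eq_integral_circleAverage hF]
  refine integral_congr_ae (ae_of_all _ fun w => ?_)
  have h1 : Real.circleAverage (fun w => Real.log ‖z - w‖ *
      {w : ℂ | a ≤ ‖w‖ ∧ ‖w‖ ≤ b}.indicator (fun _ => B) w) 0 ‖w‖ =
      Real.circleAverage (fun u : ℂ => Real.log ‖u - z‖) 0 ‖w‖ *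
      {w : ℂ | a ≤ ‖w‖ ∧ ‖w‖ ≤ b}.indicator (fun _ => B) w := by
    rw [circleAverage_eq_setIntegral, circleAverage_eq_setIntegral, mul_assoc,
      ← integral_mul_const]
    congr 1
    refine integral_congr_ae (ae_of_all _ fun θ => ?_)
    simp [Set.indicator_apply, norm_sub_rev z]
  simp only [h1]
  by_cases hw : w ∈ {w : ℂ | a ≤ ‖w‖ ∧ ‖w‖ ≤ b}
  · congr 1
    rw [circleAverage_log_norm_sub_const_of_mem_closedBall]
    simpa using hz.le.trans hw.1
  · simp [Set.indicator_of_notMem hw]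

/-! ### Discretization of logarithmic potentials -/

/-- The index of the cell containing `w` in the square grid of mesh `δ`. -/
noncomputable def gridCell (δ : ℝ) (w : ℂ) : ℤ × ℤ := (⌊w.re / δ⌋, ⌊w.im / δ⌋)

lemma measurable_gridCell (δ : ℝ) : Measurable (gridCell δ) := by
  unfold gridCell
  fun_prop

lemma norm_sub_le_of_gridCell_eq {δ : ℝ} (hδ : 0 < δ) {w w' : ℂ}
    (h : gridCell δ w = gridCell δ w') : ‖w - w'‖ ≤ 2 * δ := by
  have key : ∀ x y : ℝ, ⌊x / δ⌋ = ⌊y / δ⌋ → |x - y| ≤ δ := fun x y hxy => by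
    have h1 := Int.abs_sub_lt_one_of_floor_eq_floor hxy
    rw [← sub_div, abs_div, abs_of_pos hδ, div_lt_one hδ] at h1
    exact h1.le
  have h1 := key _ _ (congrArg Prod.fst h)
  have h2 := key _ _ (congrArg Prod.snd h)
  refine (Complex.norm_le_abs_re_add_abs_im _).trans ?_
  rw [Complex.sub_re, Complex.sub_im]
  linarith

lemma exists_finset_gridCell {δ : ℝ} (hδ : 0 < δ) (R : ℝ) :
    ∃ J : Finset (ℤ × ℤ), ∀ w : ℂ, ‖w‖ ≤ R → gridCell δ w ∈ J := by
  have key : ∀ x : ℝ, |x| ≤ R → ⌊x / δ⌋ ∈ Finset.Icc ⌊-R / δ⌋ ⌊R / δ⌋ := fun x hx => by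
    rw [abs_le] at hx
    rw [Finset.mem_Icc]
    exact ⟨Int.floor_le_floor (by gcongr; exact hx.1), Int.floor_le_floor (by gcongr; exact hx.2)⟩
  refine ⟨Finset.Icc ⌊-R / δ⌋ ⌊R / δ⌋ ×ˢ Finset.Icc ⌊-R / δ⌋ ⌊R / δ⌋, fun w hw => ?_⟩
  exact Finset.mem_product.2 ⟨key _ ((Complex.abs_re_le_norm w).trans hw),
    key _ ((Complex.abs_im_le_norm w).trans hw)⟩

/-- The logarithmic kernel truncated at `log η`. -/
noncomputable def truncLog (η x : ℝ) : ℝ := Real.log (max x η)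

lemma truncLog_lipschitz {η : ℝ} (hη : 0 < η) (x y : ℝ) :
    truncLog η x ≤ truncLog η y + |x - y| / η := by
  have hx : η ≤ max x η := le_max_right _ _
  have hy : η ≤ max y η := le_max_right _ _
  have hx0 := hη.trans_le hx
  have hy0 := hη.trans_le hy
  have h1 : Real.log (max x η / max y η) ≤ max x η / max y η - 1 :=
    Real.log_le_sub_one_of_pos (div_pos hx0 hy0)
  rw [Real.log_div hx0.ne' hy0.ne'] at h1
  have h2 : max x η / max y η - 1 ≤ |x - y| / η := by
    rw [div_sub_one hy0.ne']
    have h3 : max x η - max y η ≤ |x - y| :=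
      (le_abs_self _).trans (by simpa using abs_max_sub_max_le_max x η y η)
    exact (div_le_div_of_nonneg_right h3 hy0.le).trans
      (div_le_div_of_nonneg_left (abs_nonneg _) hη hy)
  unfold truncLog
  linarith

lemma abs_truncLog_le {η x R : ℝ} (hη : 0 < η) (hxR : x ≤ R) (hR : 0 ≤ R) :
    |truncLog η x| ≤ |Real.log η| + |Real.log (R + η)| := by
  have h1 : Real.log η ≤ truncLog η x := Real.log_le_log hη (le_max_right _ _)
  have h2 : truncLog η x ≤ Real.log (R + η) :=
    Real.log_le_log (hη.trans_le (le_max_right _ _)) (max_le (by linarith) (by linarith))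
  refine abs_le.2 ⟨?_, ?_⟩
  · linarith [neg_abs_le (Real.log η), abs_nonneg (Real.log (R + η))]
  · linarith [le_abs_self (Real.log (R + η)), abs_nonneg (Real.log η)]

lemma measurable_truncLog (η : ℝ) (z : ℂ) : Measurable fun w : ℂ => truncLog η ‖z - w‖ := by
  unfold truncLog
  fun_prop

/-- A measure with compact support can be replaced by finitely many point masses, in such a way
that the truncated potential increases by at most `ε` everywhere and the potential does not decrease
at a given point: in each cell of a fine grid the mass is put at a point where the kernel is at
least its average. -/
lemma exists_discretization (ν : Measure ℂ) [IsFiniteMeasure ν] {R : ℝ} (hR : 0 ≤ R)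
    (hν : ∀ᵐ w ∂ν, ‖w‖ ≤ R) (z₀ : ℂ) (hz₀ : ν {z₀} = 0)
    (hint : Integrable (fun w => Real.log ‖z₀ - w‖) ν) {η ε : ℝ} (hη : 0 < η) (hε : 0 < ε) :
    ∃ (J : Finset (ℤ × ℤ)) (a : ℤ × ℤ → ℝ) (p : ℤ × ℤ → ℂ), (∀ j, 0 ≤ a j) ∧ (∀ j, p j ≠ z₀) ∧
      (∀ z, ∑ j ∈ J, a j * truncLog η ‖z - p j‖ ≤ ∫ w, truncLog η ‖z - w‖ ∂ν + ε) ∧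
      ∫ w, Real.log ‖z₀ - w‖ ∂ν ≤ ∑ j ∈ J, a j * Real.log ‖z₀ - p j‖ := by
  set m := ν.real Set.univ with hm
  have hm0 : 0 ≤ m := measureReal_nonneg
  set δ := ε * η / (2 * (m + 1)) with hδ
  have hδ0 : 0 < δ := by positivity
  obtain ⟨J, hJ⟩ := exists_finset_gridCell hδ0 R
  set Q : ℤ × ℤ → Set ℂ := fun j => gridCell δ ⁻¹' {j} with hQ
  have hQm : ∀ j, MeasurableSet (Q j) := fun j => measurable_gridCell δ (measurableSet_singleton j)
  have hsum : ∀ f : ℂ → ℝ, Integrable f ν → ∫ w, f w ∂ν = ∑ j ∈ J, ∫ w in Q j, f w ∂ν := by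
    intro f hf
    rw [← integral_biUnion_finset J (fun j _ => hQm j)
      (fun i _ j _ hij => Disjoint.preimage _ (by simpa using hij)) (fun j _ => hf.integrableOn)]
    rw [Measure.restrict_eq_self_of_ae_mem]
    filter_upwards [hν] with w hw
    exact Set.mem_biUnion (hJ w hw) rfl
  have hp : ∀ j, ∃ p : ℂ, p ≠ z₀ ∧ (ν (Q j) ≠ 0 → p ∈ Q j ∧
      ∫ w in Q j, Real.log ‖z₀ - w‖ ∂ν ≤ ν.real (Q j) * Real.log ‖z₀ - p‖) := by
    intro j
    by_cases hj : ν (Q j) = 0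
    · exact ⟨z₀ + 1, by simp, fun h => absurd hj h⟩
    · have h0 : ν.restrict (Q j) ≠ 0 := by rwa [Ne, Measure.restrict_eq_zero]
      have hN : ν.restrict (Q j) ({z₀} ∪ (Q j)ᶜ) = 0 := by
        refine measure_union_null (le_antisymm ?_ (by simp)) ?_
        · exact (Measure.restrict_apply_le _ _).trans hz₀.le
        · rw [Measure.restrict_apply (hQm j).compl]; simp
      obtain ⟨p, hpN, hp⟩ := exists_notMem_null_average_le h0 hint.restrict hN
      simp only [Set.mem_union, Set.mem_singleton_iff, Set.mem_compl_iff, not_or, not_not] at hpN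
      refine ⟨p, hpN.1, fun _ => ⟨hpN.2, ?_⟩⟩
      rw [average_eq, smul_eq_mul, measureReal_restrict_apply MeasurableSet.univ,
        Set.univ_inter, inv_mul_le_iff₀] at hp
      · exact hp
      · exact ENNReal.toReal_pos hj (measure_ne_top _ _)
  choose p hp0 hp using hp
  refine ⟨J, fun j => ν.real (Q j), p, fun j => measureReal_nonneg, hp0, fun z => ?_, ?_⟩
  · have hi : Integrable (fun w => truncLog η ‖z - w‖) ν := by
      refine Integrable.of_bound (measurable_truncLog η z).aestronglyMeasurable
        (|Real.log η| + |Real.log (‖z‖ + R + η)|) ?_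
      filter_upwards [hν] with w hw
      exact abs_truncLog_le hη ((norm_sub_le _ _).trans (by linarith)) (by positivity)
    have h1 : ∀ j, ν.real (Q j) * truncLog η ‖z - p j‖ ≤
        ∫ w in Q j, (truncLog η ‖z - w‖ + 2 * δ / η) ∂ν := by
      intro j
      by_cases hj : ν (Q j) = 0
      · simp [Measure.real, hj, Measure.restrict_eq_zero.2 hj]
      · have h2 : ν.real (Q j) * truncLog η ‖z - p j‖ = ∫ w in Q j, truncLog η ‖z - p j‖ ∂ν := by
          simp
        rw [h2]
        refine setIntegral_mono_on (by simp) (hi.add (integrable_const _)).integrableOn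
          (hQm j) fun w hw => ?_
        refine (truncLog_lipschitz hη _ ‖z - w‖).trans ?_
        gcongr
        refine (abs_norm_sub_norm_le _ _).trans ?_
        rw [sub_sub_sub_cancel_left]
        exact norm_sub_le_of_gridCell_eq hδ0 (hw.trans ((hp j hj).1).symm)
    refine (Finset.sum_le_sum fun j _ => h1 j).trans ?_
    rw [← hsum (fun w => truncLog η ‖z - w‖ + 2 * δ / η) (hi.add (integrable_const _)),
      integral_add hi (integrable_const _)]
    gcongr
    simp only [integral_const, smul_eq_mul, ← hm]
    rw [hδ]
    calc m * (2 * (ε * η / (2 * (m + 1))) / η) = ε * (m / (m + 1)) := by field_simp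
      _ ≤ ε * 1 := by
        gcongr
        exact div_le_one_of_le₀ (by linarith) (by linarith)
      _ = ε := mul_one _
  · rw [hsum _ hint]
    refine Finset.sum_le_sum fun j _ => ?_
    by_cases hj : ν (Q j) = 0
    · simp [Measure.real, hj, Measure.restrict_eq_zero.2 hj]
    · exact (hp j hj).2

/-- A finite combination of logarithms with nonnegative real coefficients is approximated, uniformly
from above on a disk and from below at a given point, by the logarithm of a root of a
polynomial. -/
lemma exists_polynomial_of_weights {ι : Type*} (J : Finset ι) (a : ι → ℝ) (p : ι → ℂ)
    (ha : ∀ j, 0 ≤ a j) {z₀ : ℂ} (hp : ∀ j, p j ≠ z₀) {η ε r : ℝ} (hη : 0 < η) (hε : 0 < ε)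
    (hr : 0 ≤ r) (κ : ℝ) :
    ∃ (m : ℕ) (P : Polynomial ℂ), 1 ≤ m ∧
      (∀ z, ‖z‖ ≤ r → ‖P.eval z‖ ≤
        Real.exp (m * (∑ j ∈ J, a j * truncLog η ‖z - p j‖ + κ + ε))) ∧
      Real.exp (m * (∑ j ∈ J, a j * Real.log ‖z₀ - p j‖ + κ - ε)) ≤ ‖P.eval z₀‖ := by
  classical
  set L : ℝ := ∑ j ∈ J, (|Real.log η| + |Real.log (r + ‖p j‖ + η)| + |Real.log ‖z₀ - p j‖|) with hL
  have hL0 : 0 ≤ L := Finset.sum_nonneg fun _ _ => by positivity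
  obtain ⟨m, hm⟩ := exists_nat_gt (L / ε + 1)
  have hm1 : (1 : ℝ) < m := by linarith [div_nonneg hL0 hε.le]
  have hm0 : (0 : ℝ) < m := by linarith
  have hLm : L ≤ m * ε := by
    have : L / ε ≤ m := by linarith
    rwa [div_le_iff₀ hε] at this
  set n : ι → ℕ := fun j => ⌊m * a j⌋₊ with hn
  have hn1 : ∀ j, (n j : ℝ) ≤ m * a j := fun j => Nat.floor_le (by have := ha j; positivity)
  have hn2 : ∀ j, (m * a j : ℝ) ≤ n j + 1 := fun j => (Nat.lt_floor_add_one _).le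
  -- replacing `m * a j` by its integral part changes a combination by at most `|y|`
  have hn3 : ∀ j (y : ℝ), |(n j : ℝ) * y - m * (a j * y)| ≤ |y| := fun j y => by
    rw [← mul_assoc, ← sub_mul, abs_mul]
    refine mul_le_of_le_one_left (abs_nonneg _) ?_
    rw [abs_le]
    constructor <;> linarith [hn1 j, hn2 j]
  refine ⟨m, Polynomial.C (Real.exp (m * κ) : ℂ) *
    ∏ j ∈ J, (Polynomial.X - Polynomial.C (p j)) ^ n j, by exact_mod_cast hm1.le, ?_, ?_⟩
  · intro z hz
    have h1 : ∀ j ∈ J, ‖z - p j‖ ^ n j ≤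
        Real.exp (m * (a j * truncLog η ‖z - p j‖) +
          (|Real.log η| + |Real.log (r + ‖p j‖ + η)| + |Real.log ‖z₀ - p j‖|)) := by
      intro j _
      have h2 : ‖z - p j‖ ^ n j ≤ Real.exp (n j * truncLog η ‖z - p j‖) := by
        rw [Real.exp_nat_mul, truncLog, Real.exp_log (hη.trans_le (le_max_right _ _))]
        exact pow_le_pow_left₀ (norm_nonneg _) (le_max_left _ _) _
      refine h2.trans (Real.exp_le_exp.2 ?_)
      have h3 := (abs_le.1 (hn3 j (truncLog η ‖z - p j‖))).2
      have h4 := abs_truncLog_le (x := ‖z - p j‖) hη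
        ((norm_sub_le z (p j)).trans (add_le_add_left hz _)) (by positivity)
      linarith [abs_nonneg (Real.log ‖z₀ - p j‖)]
    simp only [Polynomial.eval_mul, Polynomial.eval_C, Polynomial.eval_prod, Polynomial.eval_pow,
      Polynomial.eval_sub, Polynomial.eval_X, norm_mul, norm_prod, norm_pow,
      Complex.norm_of_nonneg (Real.exp_nonneg _)]
    refine (mul_le_mul_of_nonneg_left (Finset.prod_le_prod (fun _ _ => by positivity) h1)
      (Real.exp_nonneg _)).trans ?_
    rw [← Real.exp_sum, ← Real.exp_add, Finset.sum_add_distrib, ← Finset.mul_sum]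
    refine Real.exp_le_exp.2 ?_
    rw [← hL]
    linarith
  · have h1 : ∀ j ∈ J, Real.exp (m * (a j * Real.log ‖z₀ - p j‖) -
          (|Real.log η| + |Real.log (r + ‖p j‖ + η)| + |Real.log ‖z₀ - p j‖|)) ≤
        ‖z₀ - p j‖ ^ n j := by
      intro j _
      have h0 : 0 < ‖z₀ - p j‖ := norm_pos_iff.2 (sub_ne_zero.2 (hp j).symm)
      have h2 : ‖z₀ - p j‖ ^ n j = Real.exp (n j * Real.log ‖z₀ - p j‖) := by
        rw [Real.exp_nat_mul, Real.exp_log h0]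
      rw [h2]
      refine Real.exp_le_exp.2 ?_
      have h3 := (abs_le.1 (hn3 j (Real.log ‖z₀ - p j‖))).1
      linarith [abs_nonneg (Real.log η), abs_nonneg (Real.log (r + ‖p j‖ + η))]
    simp only [Polynomial.eval_mul, Polynomial.eval_C, Polynomial.eval_prod, Polynomial.eval_pow,
      Polynomial.eval_sub, Polynomial.eval_X, norm_mul, norm_prod, norm_pow,
      Complex.norm_of_nonneg (Real.exp_nonneg _)]
    refine le_trans ?_ (mul_le_mul_of_nonneg_left (Finset.prod_le_prod
      (fun _ _ => (Real.exp_nonneg _)) h1) (Real.exp_nonneg _))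
    rw [← Real.exp_sum, ← Real.exp_add, Finset.sum_sub_distrib, ← Finset.mul_sum]
    refine Real.exp_le_exp.2 ?_
    rw [← hL]
    linarith

/-! ### Approximation by logarithms of polynomials -/

lemma truncLog_eq {η x : ℝ} (hη : 0 < η) (hx : 0 < x) :
    truncLog η x = Real.log x + Real.posLog (η * x⁻¹) := by
  rw [truncLog, Real.posLog_apply]
  rcases le_total x η with h | h
  · rw [max_eq_right h, max_eq_right]
    · rw [Real.log_mul hη.ne' (by positivity), Real.log_inv]; ring
    · refine Real.log_nonneg ?_
      rw [← div_eq_mul_inv]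
      exact (one_le_div hx).2 h
  · rw [max_eq_left h, max_eq_left, add_zero]
    refine Real.log_nonpos (by positivity) ?_
    rw [← div_eq_mul_inv]
    exact div_le_one_of_le₀ h hx.le

/-- Let `G` be at most its mean values over circles of radius at most `s` around the points of a
neighbourhood of the closed disk of radius `r`. Then there is a polynomial `P` such that
`m⁻¹ log |P|` exceeds `G` at a given point of the disk, and exceeds the local upper bounds of `G` by
at most `ε` on the disk.

The smoothing of `G` by `logDefect s` is the logarithmic potential of a positive measure, up to a
constant, once the density is made positive near the boundary by adding a multiple of the area of an
annulus. -/
theorem exists_polynomial_approx {G : ℂ → ℝ} (hG : Measurable G) {M R r s ε : ℝ} (hs : 0 < s)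
    (hM : ∀ w, |G w| ≤ M) (hR : ∀ w, R < ‖w‖ → G w = 0) (hr : 0 ≤ r) (hrs : r < R - s)
    (hsub : ∀ w, ‖w‖ < R - s → ∀ ρ, 0 < ρ → ρ ≤ s → G w ≤ Real.circleAverage G w ρ)
    {z₀ : ℂ} (hz₀ : ‖z₀‖ ≤ r) (hε : 0 < ε) {H : ℂ → ℝ}
    (hH : ∀ z, ‖z‖ ≤ r → ∀ w, ‖z - w‖ < s → G w ≤ H z) :
    ∃ (m : ℕ) (P : Polynomial ℂ), 1 ≤ m ∧
      (∀ z, ‖z‖ ≤ r → ‖P.eval z‖ ≤ Real.exp (m * (H z + ε))) ∧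
      Real.exp (m * G z₀) < ‖P.eval z₀‖ := by
  have hM0 : 0 ≤ M := (abs_nonneg _).trans (hM 0)
  set c := ∫ w, logDefect s w with hc
  have hc0 : 0 < c := integral_logDefect_pos hs
  set T : Set ℂ := {w : ℂ | R - s ≤ ‖w‖ ∧ ‖w‖ ≤ R + s} with hT
  have hTm : MeasurableSet T := by rw [hT]; measurability
  set σ₁ : ℂ → ℝ := fun w => Real.circleAverage G w s - G w with hσ₁
  set σ₂ : ℂ → ℝ := T.indicator (fun _ => 2 * M) with hσ₂
  set σ : ℂ → ℝ := fun w => c⁻¹ * (σ₁ w + σ₂ w) with hσ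
  have hσ₁m : Measurable σ₁ := (measurable_circleAverage hG s).sub hG
  have hσ₂m : Measurable σ₂ := measurable_const.indicator hTm
  have hσm : Measurable σ := (hσ₁m.add hσ₂m).const_mul _
  have hσ₁b : ∀ w, |σ₁ w| ≤ 2 * M := fun w => by
    refine (abs_sub _ _).trans ?_
    linarith [abs_circleAverage_le hM w s, hM w]
  have hσ₂b : ∀ w, |σ₂ w| ≤ 2 * M := fun w => by
    rw [hσ₂, Set.indicator_apply]
    split_ifs
    · rw [abs_of_nonneg (by positivity)]
    · simpa using hM0
  have hσ₁R : ∀ w, R + s < ‖w‖ → σ₁ w = 0 := fun w hw => by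
    have h1 : ∀ θ, G (circleMap w s θ) = 0 := fun θ => by
      refine hR _ ?_
      have h2 := norm_sub_norm_le w (w - circleMap w s θ)
      have h3 : ‖w - circleMap w s θ‖ = s := by
        rw [norm_sub_rev, ← dist_eq_norm]
        exact circleMap_mem_sphere w hs.le θ
      rw [sub_sub_cancel, h3] at h2
      linarith
    simp only [hσ₁, circleAverage_eq_setIntegral, h1, hR w (by linarith)]
    simp
  have hσ₂R : ∀ w, R + s < ‖w‖ → σ₂ w = 0 := fun w hw =>
    Set.indicator_of_notMem (fun h => absurd h.2 (not_le.2 hw)) _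
  have hσR : ∀ w, R + s < ‖w‖ → σ w = 0 := fun w hw => by
    simp only [hσ, hσ₁R w hw, hσ₂R w hw, add_zero, mul_zero]
  have hσb : ∀ w, |σ w| ≤ c⁻¹ * (4 * M) := fun w => by
    rw [hσ, abs_mul, abs_of_pos (inv_pos.2 hc0)]
    refine mul_le_mul_of_nonneg_left ((abs_add_le _ _).trans ?_) (inv_pos.2 hc0).le
    linarith [hσ₁b w, hσ₂b w]
  have hσ0 : ∀ w, 0 ≤ σ w := fun w => by
    refine mul_nonneg (inv_pos.2 hc0).le ?_
    rcases lt_or_ge ‖w‖ (R - s) with h | h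
    · rw [hσ₂, Set.indicator_of_notMem (fun h' => absurd h'.1 (not_le.2 h)), add_zero]
      exact sub_nonneg.2 (hsub w h s hs le_rfl)
    · rcases le_or_gt ‖w‖ (R + s) with h' | h'
      · rw [hσ₂, Set.indicator_of_mem (show w ∈ T from ⟨h, h'⟩)]
        linarith [(abs_le.1 (hσ₁b w)).1]
      · rw [hσ₁R w h', hσ₂R w h', add_zero]
  have hσi : Integrable σ := by
    have h1 : IntegrableOn (fun _ : ℂ => c⁻¹ * (4 * M)) (Metric.closedBall 0 (R + s)) :=
      continuousOn_const.integrableOn_compact (isCompact_closedBall _ _)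
    refine ((integrable_indicator_iff Metric.isClosed_closedBall.measurableSet).2 h1).mono'
      hσm.aestronglyMeasurable (ae_of_all _ fun w => ?_)
    by_cases hw : w ∈ Metric.closedBall (0 : ℂ) (R + s)
    · rw [Set.indicator_of_mem hw]
      exact hσb w
    · rw [Set.indicator_of_notMem hw, hσR w (by simpa using hw), norm_zero]
  set ν : Measure ℂ := volume.withDensity (fun w => ENNReal.ofReal (σ w)) with hν
  have : IsFiniteMeasure ν := isFiniteMeasure_withDensity_ofReal hσi.2
  have hνint : ∀ f : ℂ → ℝ, ∫ w, f w ∂ν = ∫ w, f w * σ w := fun f => by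
    rw [hν, integral_withDensity_eq_integral_toReal_smul hσm.ennreal_ofReal
      (ae_of_all _ fun _ => ENNReal.ofReal_lt_top)]
    refine integral_congr_ae (ae_of_all _ fun w => ?_)
    simp only [ENNReal.toReal_ofReal (hσ0 w), smul_eq_mul, mul_comm]
  have hνac : ν ≪ volume := withDensity_absolutelyContinuous _ _
  have hνR : ∀ᵐ w ∂ν, ‖w‖ ≤ R + s := by
    rw [hν, ae_withDensity_iff hσm.ennreal_ofReal]
    refine ae_of_all _ fun w hw => ?_
    by_contra h
    exact hw (by rw [hσR w (not_le.1 h), ENNReal.ofReal_zero])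
  have hlog : ∀ z, Integrable fun w => Real.log ‖z - w‖ * σ w := integrable_log_mul hσm hσb hσR
  have hlogν : Integrable (fun w => Real.log ‖z₀ - w‖) ν := by
    rw [hν, integrable_withDensity_iff hσm.ennreal_ofReal
      (ae_of_all _ fun _ => ENNReal.ofReal_lt_top)]
    refine (hlog z₀).congr (ae_of_all _ fun w => ?_)
    simp only [ENNReal.toReal_ofReal (hσ0 w)]
  -- the potential of `ν` is the smoothing of `G`, up to a constant
  set κ := c⁻¹ * ∫ w, Real.log ‖w‖ * σ₂ w with hκ
  have hpot : ∀ z, ‖z‖ ≤ r → ∫ w, Real.log ‖z - w‖ * σ w =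
      c⁻¹ * (∫ w, logDefect s (z - w) * G w) + κ := fun z hz => by
    rw [integral_logDefect_mul hG hs hM hR, hκ,
      ← integral_log_annulus (a := R - s) (b := R + s) (hz.trans_lt hrs) (2 * M), ← mul_add,
      ← integral_add (integrable_log_mul hσ₁m hσ₁b hσ₁R z)
        (integrable_log_mul hσ₂m hσ₂b hσ₂R z), ← integral_const_mul]
    refine integral_congr_ae (ae_of_all _ fun w => ?_)
    simp only [hσ]
    ring
  have hpotH : ∀ z, ‖z‖ ≤ r → ∫ w, Real.log ‖z - w‖ * σ w ≤ H z + κ := fun z hz => by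
    rw [hpot z hz]
    gcongr
    rw [inv_mul_le_iff₀ hc0]
    exact integral_logDefect_mul_le hG hs hM (hH z hz)
  have hpotG : G z₀ + κ ≤ ∫ w, Real.log ‖z₀ - w‖ * σ w := by
    rw [hpot z₀ hz₀]
    gcongr
    rw [le_inv_mul_iff₀ hc0]
    exact mul_le_integral_logDefect_mul hG hs hM (hsub z₀ (hz₀.trans_lt hrs))
  -- the truncation error is quadratic in the truncation level
  set D := c⁻¹ * (4 * M) * ∫ w, logDefect 1 w with hD
  have hD0 : 0 ≤ D := mul_nonneg (by positivity) (integral_nonneg (logDefect_nonneg 1))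
  obtain ⟨η, hη, hηD⟩ : ∃ η : ℝ, 0 < η ∧ D * η ^ 2 ≤ ε / 4 := by
    refine ⟨min 1 (ε / (4 * (D + 1))), by positivity, ?_⟩
    have h1 : min 1 (ε / (4 * (D + 1))) ^ 2 ≤ ε / (4 * (D + 1)) := by
      rw [sq]
      exact (mul_le_mul (min_le_left _ _) (min_le_right _ _) (by positivity) zero_le_one).trans
        (one_mul _).le
    calc D * min 1 (ε / (4 * (D + 1))) ^ 2 ≤ D * (ε / (4 * (D + 1))) := by gcongr
      _ = ε / 4 * (D / (D + 1)) := by field_simp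
      _ ≤ ε / 4 * 1 := by
        gcongr
        exact div_le_one_of_le₀ (by linarith) (by linarith)
      _ = ε / 4 := mul_one _
  have htr : ∀ z, ∫ w, truncLog η ‖z - w‖ * σ w ≤ (∫ w, Real.log ‖z - w‖ * σ w) + ε / 4 := by
    intro z
    have hi := ((logDefect_integrable hη).comp_sub_left z)
    have hi' : Integrable fun w => logDefect η (z - w) * σ w :=
      hi.mul_bdd hσm.aestronglyMeasurable (ae_of_all _ hσb)
    have h1 : ∫ w, truncLog η ‖z - w‖ * σ w =
        ∫ w, (Real.log ‖z - w‖ * σ w + logDefect η (z - w) * σ w) := by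
      refine integral_congr_ae ?_
      have : ∀ᵐ w : ℂ, w ≠ z := by simp [ae_iff]
      filter_upwards [this] with w hw
      rw [truncLog_eq hη (norm_pos_iff.2 (sub_ne_zero.2 hw.symm)), logDefect]
      ring
    rw [h1, integral_add (hlog z) hi']
    gcongr
    calc ∫ w, logDefect η (z - w) * σ w ≤ ∫ w, logDefect η (z - w) * (c⁻¹ * (4 * M)) :=
          integral_mono hi' (hi.mul_const _) fun w =>
            mul_le_mul_of_nonneg_left ((le_abs_self _).trans (hσb w)) (logDefect_nonneg _ _)
      _ = D * η ^ 2 := by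
        rw [integral_mul_const, integral_sub_left_eq_self (logDefect η) volume z,
          integral_logDefect hη, hD]
        ring
      _ ≤ ε / 4 := hηD
  obtain ⟨J, a, p, ha, hp, hup, hlow⟩ := exists_discretization ν (by linarith) hνR z₀
    (hνac (measure_singleton _)) hlogν hη (show 0 < ε / 4 by positivity)
  obtain ⟨m, P, hm, hP, hP₀⟩ := exists_polynomial_of_weights J a p ha hp hη
    (show 0 < ε / 8 by positivity) hr (ε / 4 - κ)
  have hm' : (0 : ℝ) < m := by exact_mod_cast hm
  refine ⟨m, P, hm, fun z hz => (hP z hz).trans ?_, lt_of_lt_of_le ?_ hP₀⟩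
  · have h1 := hup z
    rw [hνint] at h1
    refine Real.exp_le_exp.2 (mul_le_mul_of_nonneg_left ?_ hm'.le)
    linarith [htr z, hpotH z hz]
  · rw [hνint] at hlow
    refine Real.exp_lt_exp.2 (mul_lt_mul_of_pos_left ?_ hm')
    linarith

/-! ### Points of Berkovich spectra -/

namespace BerkovichSpectrum

section General

variable {A : Type*} [CommRing A] [Norm A] (x : BerkovichSpectrum A)

lemma eval_zero : x.eval 0 = 0 := map_zero x.toMulRingSeminorm

lemma eval_one : x.eval 1 = 1 := map_one x.toMulRingSeminorm

lemma eval_mul (f g : A) : x.eval (f * g) = x.eval f * x.eval g := map_mul x.toMulRingSeminorm f g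

lemma eval_pow (f : A) (n : ℕ) : x.eval (f ^ n) = x.eval f ^ n := map_pow x.toMulRingSeminorm f n

lemma eval_add_le (f g : A) : x.eval (f + g) ≤ x.eval f + x.eval g :=
  map_add_le_add x.toMulRingSeminorm f g

lemma eval_neg (f : A) : x.eval (-f) = x.eval f := map_neg_eq_map x.toMulRingSeminorm f

lemma eval_nonneg (f : A) : 0 ≤ x.eval f := apply_nonneg x.toMulRingSeminorm f

lemma eval_le_norm (f : A) : x.eval f ≤ ‖f‖ := x.le_norm' f

lemma eval_sub_rev (f g : A) : x.eval (f - g) = x.eval (g - f) := by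
  rw [← eval_neg, neg_sub]

lemma eval_le_add_sub (f g : A) : x.eval f ≤ x.eval g + x.eval (f - g) := by
  simpa using x.eval_add_le g (f - g)

lemma abs_eval_sub_le (f g : A) : |x.eval f - x.eval g| ≤ x.eval (f - g) := by
  refine abs_le.2 ⟨?_, ?_⟩
  · have := x.eval_le_add_sub g f
    rw [eval_sub_rev] at this
    linarith
  · linarith [x.eval_le_add_sub f g]

lemma eval_sum_le {ι : Type*} (s : Finset ι) (f : ι → A) :
    x.eval (∑ i ∈ s, f i) ≤ ∑ i ∈ s, x.eval (f i) :=
  Finset.le_sum_of_subadditive x.eval x.eval_zero.le x.eval_add_le s f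

lemma eval_injective : Function.Injective (BerkovichSpectrum.eval (A := A)) := by
  intro x y h
  have h1 : x.toMulRingSeminorm = y.toMulRingSeminorm := DFunLike.ext _ _ fun f => congrFun h f
  cases x; cases y; cases h1; rfl

instance : T2Space (BerkovichSpectrum A) :=
  T2Space.of_injective_continuous eval_injective continuous_induced_dom

lemma continuous_eval (f : A) : Continuous fun x : BerkovichSpectrum A => x.eval f :=
  (continuous_apply f).comp continuous_induced_dom

/-- A point at which the natural numbers have absolute value at most `1` is non-archimedean. -/
lemma eval_add_le_max (hx : ∀ n : ℕ, x.eval n ≤ 1) (f g : A) :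
    x.eval (f + g) ≤ max (x.eval f) (x.eval g) := by
  set q := x.eval (f + g)
  set M := max (x.eval f) (x.eval g)
  have hM0 : 0 ≤ M := (x.eval_nonneg f).trans (le_max_left _ _)
  by_contra! h
  have hq : 0 < q := hM0.trans_lt h
  have key : ∀ n : ℕ, q ^ n ≤ (n + 1) * M ^ n := by
    intro n
    rw [← x.eval_pow, add_pow]
    refine (x.eval_sum_le _ _).trans ?_
    calc ∑ k ∈ Finset.range (n + 1), x.eval (f ^ k * g ^ (n - k) * (n.choose k : ℕ))
        ≤ ∑ k ∈ Finset.range (n + 1), M ^ n := by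
          refine Finset.sum_le_sum fun k hk => ?_
          rw [x.eval_mul, x.eval_mul, x.eval_pow, x.eval_pow]
          have hk : k ≤ n := Nat.lt_succ_iff.1 (Finset.mem_range.1 hk)
          have h1 : x.eval f ^ k * x.eval g ^ (n - k) ≤ M ^ k * M ^ (n - k) :=
            mul_le_mul (pow_le_pow_left₀ (x.eval_nonneg f) (le_max_left _ _) _)
              (pow_le_pow_left₀ (x.eval_nonneg g) (le_max_right _ _) _)
              (pow_nonneg (x.eval_nonneg g) _) (pow_nonneg hM0 _)
          rw [← pow_add, Nat.add_sub_cancel' hk] at h1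
          exact (mul_le_mul h1 (hx _) (x.eval_nonneg _) (pow_nonneg hM0 _)).trans (mul_one _).le
      _ = (n + 1) * M ^ n := by simp
  have h1 : Tendsto (fun n : ℕ => n * (M / q) ^ n + (M / q) ^ n) atTop (𝓝 (0 + 0)) := by
    have h2 : M / q < 1 := (div_lt_one hq).2 h
    exact (tendsto_self_mul_const_pow_of_lt_one (by positivity) h2).add
      (tendsto_pow_atTop_nhds_zero_of_lt_one (by positivity) h2)
  rw [add_zero] at h1
  obtain ⟨n, hn⟩ := (h1.eventually (gt_mem_nhds one_pos)).exists
  have h2 := key n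
  rw [← add_one_mul, div_pow, mul_div_assoc', div_lt_one (by positivity)] at hn
  linarith

end General

end BerkovichSpectrum

/-! ### Polynomials in the hybrid ring -/

variable {r : Set.Ioo (0 : ℝ) 1}

lemma norm_def (f : hybridRing r) :
    ‖f‖ = ∑' n : ℤ, hybNorm ((f : LaurentSeries ℂ).coeff n) * (r : ℝ) ^ n := rfl

/-- The monomial `a t ^ n`, as an element of the hybrid ring. -/
noncomputable def mono (n : ℤ) (a : ℂ) : hybridRing r :=
  ⟨HahnSeries.single n a, by
    refine summable_of_ne_finset_zero (s := {n}) fun k hk => ?_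
    have : k ≠ n := by simpa using hk
    simp [HahnSeries.coeff_single_of_ne this, hybNorm_zero]⟩

lemma coe_mono (n : ℤ) (a : ℂ) :
    ((mono n a : hybridRing r) : LaurentSeries ℂ) = HahnSeries.single n a := rfl

lemma norm_mono (n : ℤ) (a : ℂ) : ‖(mono n a : hybridRing r)‖ = hybNorm a * (r : ℝ) ^ n := by
  rw [norm_def, tsum_eq_single n]
  · rw [coe_mono, HahnSeries.coeff_single_same]
  · intro k hk
    rw [coe_mono, HahnSeries.coeff_single_of_ne hk, hybNorm_zero, zero_mul]

lemma mono_mul_mono (n k : ℤ) (a b : ℂ) :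
    (mono n a * mono k b : hybridRing r) = mono (n + k) (a * b) :=
  Subtype.ext (by simp [coe_mono])

lemma mono_zero_one : (mono 0 1 : hybridRing r) = 1 := Subtype.ext (by simp [coe_mono])

/-- The constants in the hybrid ring. -/
noncomputable def hybC : ℂ →+* hybridRing r where
  toFun := mono 0
  map_one' := mono_zero_one
  map_mul' a b := by rw [mono_mul_mono, add_zero]
  map_zero' := Subtype.ext (by simp [coe_mono])
  map_add' a b := Subtype.ext (by simp [coe_mono])

lemma hybC_apply (a : ℂ) : (hybC a : hybridRing r) = mono 0 a := rfl

/-- The coordinate function `t` of the hybrid ring. -/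
noncomputable def hybX : hybridRing r := mono 1 1

lemma hybX_pow (n : ℕ) : (hybX ^ n : hybridRing r) = mono n 1 := by
  induction n with
  | zero => simp [mono_zero_one]
  | succ n ih => rw [pow_succ, ih, hybX, mono_mul_mono]; simp

/-- Polynomials, as elements of the hybrid ring. -/
noncomputable def hybPoly : Polynomial ℂ →+* hybridRing r := Polynomial.eval₂RingHom hybC hybX

lemma hybPoly_C (a : ℂ) : (hybPoly (Polynomial.C a) : hybridRing r) = hybC a := by
  simp [hybPoly]

lemma hybPoly_X : (hybPoly Polynomial.X : hybridRing r) = hybX := by simp [hybPoly]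

lemma exists_sum_mono_close (f : hybridRing r) {ε : ℝ} (hε : 0 < ε) :
    ∃ s : Finset ℤ, ‖f - ∑ n ∈ s, mono n ((f : LaurentSeries ℂ).coeff n)‖ < ε := by
  classical
  have hs := summable_hyb f
  obtain ⟨s, hs'⟩ := ((tendsto_order.1 (tendsto_tsum_compl_atTop_zero
    fun n : ℤ => hybNorm ((f : LaurentSeries ℂ).coeff n) * (r : ℝ) ^ n)).2 ε hε).exists
  refine ⟨s, lt_of_le_of_lt (le_of_eq ?_) hs'⟩
  have h1 : ∀ k : ℤ, ((f - ∑ n ∈ s, mono n ((f : LaurentSeries ℂ).coeff n) : hybridRing r) :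
      LaurentSeries ℂ).coeff k = if k ∈ s then 0 else (f : LaurentSeries ℂ).coeff k := by
    intro k
    rw [AddSubgroupClass.coe_sub, AddSubmonoidClass.coe_finsetSum, HahnSeries.coeff_sub,
      HahnSeries.coeff_sum]
    simp_rw [coe_mono, HahnSeries.coeff_single]
    by_cases hk : k ∈ s
    · rw [if_pos hk, Finset.sum_eq_single_of_mem k hk, if_pos rfl, sub_self]
      exact fun n _ hn => if_neg hn.symm
    · rw [if_neg hk, Finset.sum_eq_zero, sub_zero]
      exact fun n hn => if_neg (ne_of_mem_of_not_mem hn hk).symm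
  rw [norm_def]
  refine Eq.trans ?_ (tsum_subtype {n : ℤ | n ∉ s} fun n : ℤ =>
    hybNorm ((f : LaurentSeries ℂ).coeff n) * (r : ℝ) ^ n).symm
  refine tsum_congr fun k => ?_
  rw [h1, Set.indicator_apply]
  by_cases hk : k ∈ s <;> simp [hk, hybNorm_zero]

lemma exists_sum_mono_eq (s : Finset ℤ) (a : ℤ → ℂ) :
    ∃ (N : ℕ) (P : Polynomial ℂ),
      (∑ n ∈ s, mono n (a n) : hybridRing r) = mono (-N) 1 * hybPoly P := by
  obtain ⟨N, hN⟩ : ∃ N : ℕ, ∀ n ∈ s, 0 ≤ n + N := by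
    refine ⟨∑ n ∈ s, n.natAbs, fun n hn => ?_⟩
    have := Finset.single_le_sum (f := Int.natAbs) (fun _ _ => Nat.zero_le _) hn
    omega
  refine ⟨N, ∑ n ∈ s, Polynomial.C (a n) * Polynomial.X ^ (n + N).toNat, ?_⟩
  rw [map_sum, Finset.mul_sum]
  refine Finset.sum_congr rfl fun n hn => ?_
  rw [map_mul, map_pow, hybPoly_C, hybPoly_X, hybX_pow, hybC_apply, mono_mul_mono, mono_mul_mono,
    Int.toNat_of_nonneg (hN n hn)]
  simp

section Points

variable (x : HybridCircle r)

lemma eval_hybX : x.eval hybX = r := by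
  have h0 := r.2.1
  have h1 : x.eval hybX ≤ r := by
    refine (x.eval_le_norm _).trans (le_of_eq ?_)
    rw [hybX, norm_mono]
    simp [hybNorm]
  have h2 : x.eval (mono (-1) 1) ≤ (r : ℝ)⁻¹ := by
    refine (x.eval_le_norm _).trans (le_of_eq ?_)
    rw [norm_mono]
    simp [hybNorm]
  have h3 : x.eval hybX * x.eval (mono (-1) 1) = 1 := by
    rw [← x.eval_mul, hybX, mono_mul_mono]
    simp [mono_zero_one, x.eval_one]
  refine le_antisymm h1 ?_
  by_contra! h4
  have h5 : x.eval hybX * x.eval (mono (-1) 1) ≤ x.eval hybX * (r : ℝ)⁻¹ :=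
    mul_le_mul_of_nonneg_left h2 (x.eval_nonneg _)
  rw [h3, ← div_eq_mul_inv, le_div_iff₀ h0] at h5
  linarith

lemma eval_mono_neg (N : ℕ) : x.eval (mono (-N) 1) = ((r : ℝ) ^ N)⁻¹ := by
  have h : x.eval (mono (-N) 1) * x.eval (hybX ^ N) = 1 := by
    rw [← x.eval_mul, hybX_pow, mono_mul_mono]
    simp [mono_zero_one, x.eval_one]
  rw [x.eval_pow, eval_hybX] at h
  exact eq_inv_of_mul_eq_one_left h

/-- A point of the hybrid circle is determined by the absolute values of the constants and of the
linear polynomials. -/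
lemma hybridCircle_ext {x y : HybridCircle r} (hC : ∀ a, x.eval (hybC a) = y.eval (hybC a))
    (hX : ∀ a, x.eval (hybX - hybC a) = y.eval (hybX - hybC a)) : x = y := by
  refine BerkovichSpectrum.eval_injective (funext fun f => ?_)
  have hP : ∀ P : Polynomial ℂ, x.eval (hybPoly P) = y.eval (hybPoly P) := by
    intro P
    rw [(IsAlgClosed.splits P).eq_prod_roots]
    simp only [map_mul, hybPoly_C, BerkovichSpectrum.eval_mul, hC]
    congr 1
    generalize P.roots = S
    induction S using Multiset.induction_on with
    | empty => simp [BerkovichSpectrum.eval_one]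
    | cons a S ih =>
      simp only [Multiset.map_cons, Multiset.prod_cons, map_mul, BerkovichSpectrum.eval_mul, ih,
        map_sub, hybPoly_C, hybPoly_X, hX]
  have key : ∀ ε > 0, |x.eval f - y.eval f| ≤ 2 * ε := by
    intro ε hε
    obtain ⟨s, hs⟩ := exists_sum_mono_close f hε
    obtain ⟨N, P, hNP⟩ := exists_sum_mono_eq (r := r) s fun n => (f : LaurentSeries ℂ).coeff n
    rw [hNP] at hs
    have h1 : x.eval (mono (-N) 1 * hybPoly P) = y.eval (mono (-N) 1 * hybPoly P) := by
      rw [x.eval_mul, y.eval_mul, eval_mono_neg, eval_mono_neg, hP]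
    have h2 := (x.abs_eval_sub_le f (mono (-N) 1 * hybPoly P)).trans (x.eval_le_norm _)
    have h3 := (y.abs_eval_sub_le f (mono (-N) 1 * hybPoly P)).trans (y.eval_le_norm _)
    rw [← h1] at h3
    rw [abs_le] at h2 h3 ⊢
    constructor <;> linarith
  have h0 : |x.eval f - y.eval f| ≤ 0 := by
    refine le_of_forall_pos_le_add fun ε hε => ?_
    have := key (ε / 2) (by positivity)
    linarith
  exact sub_eq_zero.1 (abs_nonpos_iff.1 h0)

end Points

/-! ### Classification of the points of the hybrid circle -/

section Classification

variable (x : HybridCircle r)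

lemma eval_hybC_le {a : ℂ} (ha : a ≠ 0) : x.eval (hybC a) ≤ max 1 ‖a‖ := by
  refine (x.eval_le_norm _).trans (le_of_eq ?_)
  rw [hybC_apply, norm_mono]
  simp [hybNorm, ha]

lemma eval_hybC_pos {a : ℂ} (ha : a ≠ 0) : 0 < x.eval (hybC a) := by
  refine (x.eval_nonneg _).lt_of_ne' fun h => ?_
  have h1 : x.eval (hybC a) * x.eval (hybC a⁻¹) = 1 := by
    rw [← x.eval_mul, ← map_mul, mul_inv_cancel₀ ha, map_one, x.eval_one]
  rw [h, zero_mul] at h1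
  exact zero_ne_one h1

/-- A bounded multiplicative seminorm restricts to a power of the usual absolute value on the
constants: it is trivial on the unit circle, and a bounded homomorphism on the positive reals. -/
lemma exists_eval_hybC_eq_rpow :
    ∃ s : ℝ, 0 ≤ s ∧ s ≤ 1 ∧ ∀ a : ℂ, a ≠ 0 → x.eval (hybC a) = ‖a‖ ^ s := by
  have hunit : ∀ u : ℂ, ‖u‖ = 1 → x.eval (hybC u) = 1 := by
    intro u hu
    have hu0 : u ≠ 0 := norm_ne_zero_iff.1 (by rw [hu]; exact one_ne_zero)
    have h1 := eval_hybC_le x hu0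
    have h2 := eval_hybC_le x (inv_ne_zero hu0)
    rw [norm_inv, hu] at h2
    rw [hu] at h1
    simp only [inv_one, max_self] at h1 h2
    have h3 : x.eval (hybC u) * x.eval (hybC u⁻¹) = 1 := by
      rw [← x.eval_mul, ← map_mul, mul_inv_cancel₀ hu0, map_one, x.eval_one]
    refine le_antisymm h1 ?_
    rw [← h3]
    exact mul_le_of_le_one_right (x.eval_nonneg _) h2
  have hexp0 : ∀ t : ℝ, (Real.exp t : ℂ) ≠ 0 := fun t => by
    exact_mod_cast (Real.exp_pos t).ne'
  set ψ : ℝ →+ ℝ :=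
    { toFun := fun t => Real.log (x.eval (hybC (Real.exp t : ℂ)))
      map_zero' := by simp [x.eval_one]
      map_add' := fun t t' => by
        rw [Real.exp_add, Complex.ofReal_mul, map_mul, x.eval_mul,
          Real.log_mul (eval_hybC_pos x (hexp0 t)).ne' (eval_hybC_pos x (hexp0 t')).ne'] } with hψ
  have hψ1 : ∀ t, ψ t ≤ max 0 t := by
    intro t
    have h1 := eval_hybC_le x (hexp0 t)
    rw [Complex.norm_of_nonneg (Real.exp_nonneg t)] at h1
    have h2 := Real.log_le_log (eval_hybC_pos x (hexp0 t)) h1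
    refine h2.trans ?_
    rcases le_total t 0 with ht | ht
    · rw [max_eq_left (Real.exp_le_one_iff.2 ht), Real.log_one]
      exact le_max_left _ _
    · rw [max_eq_right (Real.one_le_exp ht), Real.log_exp]
      exact le_max_right _ _
  have hψc : Continuous ψ := by
    refine AddMonoidHomClass.continuous_of_bound ψ 1 fun t => ?_
    rw [Real.norm_eq_abs, Real.norm_eq_abs, one_mul, abs_le]
    have h1 := hψ1 t
    have h2 := hψ1 (-t)
    rw [map_neg] at h2
    constructor
    · have := h2.trans (max_le (abs_nonneg t) (neg_le_abs t)); linarith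
    · exact h1.trans (max_le (abs_nonneg t) (le_abs_self t))
  have hψlin : ∀ t, ψ t = t * ψ 1 := fun t => by
    have := map_real_smul ψ hψc t 1
    simpa using this
  refine ⟨ψ 1, ?_, ?_, fun a ha => ?_⟩
  · have := hψ1 (-1)
    rw [map_neg] at this
    simpa using this
  · simpa using hψ1 1
  · have ha' : 0 < ‖a‖ := norm_pos_iff.2 ha
    have h1 : a = (a / ‖a‖) * (‖a‖ : ℂ) :=
      (div_mul_cancel₀ a (by exact_mod_cast ha'.ne')).symm
    have h2 : x.eval (hybC a) = x.eval (hybC (‖a‖ : ℂ)) := by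
      conv_lhs => rw [h1]
      rw [map_mul, x.eval_mul, hunit, one_mul]
      simp [ha]
    rw [h2, Real.rpow_def_of_pos ha', ← hψlin]
    simp only [hψ, AddMonoidHom.coe_mk, ZeroHom.coe_mk, Real.exp_log ha']
    rw [Real.exp_log]
    exact eval_hybC_pos x (by exact_mod_cast ha'.ne')

lemma eval_hybX_sub_le_of_monic {m : ℝ} (hm0 : 0 ≤ m) (hm : ∀ a, m ≤ x.eval (hybX - hybC a))
    {Q : Polynomial ℂ} (hQ : Q.Monic) : m ^ Q.natDegree ≤ x.eval (hybPoly Q) := by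
  have h1 := (IsAlgClosed.splits Q).eq_prod_roots
  rw [(IsAlgClosed.splits Q).natDegree_eq_card_roots]
  rw [hQ.leadingCoeff, map_one, one_mul] at h1
  rw [h1]
  simp only [Polynomial.roots_multiset_prod_X_sub_C]
  generalize Q.roots = S
  induction S using Multiset.induction_on with
  | empty => simp [BerkovichSpectrum.eval_one]
  | cons a S ih =>
    simp only [Multiset.map_cons, Multiset.prod_cons, map_mul, BerkovichSpectrum.eval_mul,
      Multiset.card_cons, pow_succ', map_sub, hybPoly_C, hybPoly_X]
    exact mul_le_mul (hm a) ih (pow_nonneg hm0 _) (x.eval_nonneg _)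

/-- If the constants carry a nontrivial absolute value, then some linear polynomial vanishes at the
point. This is the Gelfand-Mazur argument: a positive minimum of `|t - a|_x` over `a` would be
attained on an open and closed set of `a`. -/
lemma exists_eval_hybX_sub_eq_zero {s : ℝ} (hs : 0 < s)
    (hx : ∀ a : ℂ, x.eval (hybC a) = ‖a‖ ^ s) : ∃ a, x.eval (hybX - hybC a) = 0 := by
  set φ : ℂ → ℝ := fun a => x.eval (hybX - hybC a) with hφ
  have hφc : Continuous φ := by
    rw [continuous_iff_continuousAt]
    intro a
    have h1 : ∀ b, dist (φ b) (φ a) ≤ ‖a - b‖ ^ s := fun b => by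
      rw [Real.dist_eq, ← hx]
      refine (x.abs_eval_sub_le _ _).trans (le_of_eq ?_)
      rw [map_sub]
      congr 1
      ring
    rw [ContinuousAt, tendsto_iff_dist_tendsto_zero]
    refine squeeze_zero (fun _ => dist_nonneg) h1 ?_
    have h2 : Continuous fun b : ℂ => ‖a - b‖ ^ s :=
      (by fun_prop : Continuous fun b : ℂ => ‖a - b‖).rpow_const fun _ => Or.inr hs.le
    have h3 := h2.tendsto a
    simpa [Real.zero_rpow hs.ne'] using h3
  have hlow : ∀ a, ‖a‖ ^ s - r ≤ φ a := fun a => by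
    have h1 := x.eval_le_add_sub (hybC a) hybX
    rw [hx, eval_hybX, x.eval_sub_rev] at h1
    linarith
  have htop : Tendsto φ (cocompact ℂ) atTop := by
    refine tendsto_atTop_mono hlow (tendsto_atTop_add_const_right _ _ ?_)
    exact (tendsto_rpow_atTop hs).comp (tendsto_norm_cocompact_atTop (E := ℂ))
  obtain ⟨a₀, ha₀⟩ := hφc.exists_forall_le htop
  set m := φ a₀ with hm
  by_cases hm0 : m = 0
  · exact ⟨a₀, hm0⟩
  have hmpos : 0 < m := (x.eval_nonneg _).lt_of_ne' hm0
  exfalso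
  have hstep : ∀ a, φ a = m → ∀ c : ℂ, ‖c‖ ^ s < m → φ (a + c) = m := by
    intro a ha c hc
    refine le_antisymm ?_ (ha₀ _)
    -- dividing `(t - a) ^ n - c ^ n` by its root `a + c` leaves a monic polynomial
    have key : ∀ n : ℕ, φ (a + c) ≤ m * (1 + (‖c‖ ^ s / m) ^ (n + 1)) := by
      intro n
      set P : Polynomial ℂ :=
        (Polynomial.X - Polynomial.C a) ^ (n + 1) - Polynomial.C (c ^ (n + 1)) with hP
      have hPm : P.Monic := by
        refine ((Polynomial.monic_X_sub_C a).pow _).sub_of_left ?_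
        refine Polynomial.degree_C_le.trans_lt ?_
        rw [Polynomial.degree_pow, Polynomial.degree_X_sub_C]
        simp only [nsmul_eq_mul, mul_one]
        exact_mod_cast Nat.succ_pos n
      have hPd : P.natDegree = n + 1 := by
        rw [hP, Polynomial.natDegree_sub_C, Polynomial.natDegree_pow,
          Polynomial.natDegree_X_sub_C, mul_one]
      have hroot : P.IsRoot (a + c) := by
        simp [hP, Polynomial.IsRoot]
      obtain ⟨Q, hQ⟩ := Polynomial.dvd_iff_isRoot.2 hroot
      have hQm : Q.Monic := (Polynomial.monic_X_sub_C (a + c)).of_mul_monic_left (hQ ▸ hPm)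
      have hQd : Q.natDegree = n := by
        have h1 := hPd
        rw [hQ, (Polynomial.monic_X_sub_C (a + c)).natDegree_mul hQm,
          Polynomial.natDegree_X_sub_C] at h1
        omega
      have h2 := eval_hybX_sub_le_of_monic x hmpos.le ha₀ hQm
      rw [hQd] at h2
      have h3 : x.eval (hybPoly P) = φ (a + c) * x.eval (hybPoly Q) := by
        rw [hQ, map_mul, x.eval_mul, map_sub, hybPoly_X, hybPoly_C]
      have h4 : x.eval (hybPoly P) ≤ m ^ (n + 1) + (‖c‖ ^ s) ^ (n + 1) := by
        have h5 : (hybPoly P : hybridRing r) =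
            (hybX - hybC a) ^ (n + 1) + -(hybC c ^ (n + 1)) := by
          simp only [hP, map_sub, map_pow, hybPoly_X, hybPoly_C]
          ring
        rw [h5]
        refine (x.eval_add_le _ _).trans (le_of_eq ?_)
        rw [x.eval_neg, x.eval_pow, x.eval_pow, hx, ← ha]
      have h6 : φ (a + c) * m ^ n ≤ m ^ (n + 1) + (‖c‖ ^ s) ^ (n + 1) := by
        refine le_trans ?_ h4
        rw [h3]
        exact mul_le_mul_of_nonneg_left h2 (x.eval_nonneg _)
      rw [← le_div_iff₀ (by positivity)] at h6
      refine h6.trans (le_of_eq ?_)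
      rw [div_pow]
      field_simp
      ring
    have hlim : Tendsto (fun n : ℕ => m * (1 + (‖c‖ ^ s / m) ^ (n + 1))) atTop
        (𝓝 (m * (1 + 0))) := by
      refine ((tendsto_const_nhds).add ?_).const_mul m
      have h7 : ‖c‖ ^ s / m < 1 := (div_lt_one hmpos).2 hc
      exact (tendsto_pow_atTop_nhds_zero_of_lt_one (by positivity) h7).comp
        (tendsto_add_atTop_nat 1)
    rw [add_zero, mul_one] at hlim
    exact ge_of_tendsto' hlim key
  have hopen : IsOpen {a | φ a = m} := by
    rw [isOpen_iff_mem_nhds]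
    intro a ha
    have h2 : Continuous fun b : ℂ => ‖b - a‖ ^ s :=
      (by fun_prop : Continuous fun b : ℂ => ‖b - a‖).rpow_const fun _ => Or.inr hs.le
    have h3 : ∀ᶠ b in 𝓝 a, ‖b - a‖ ^ s < m := by
      refine h2.tendsto a |>.eventually (gt_mem_nhds ?_)
      simpa [Real.zero_rpow hs.ne'] using hmpos
    filter_upwards [h3] with b hb
    have := hstep a ha (b - a) hb
    rwa [add_sub_cancel] at this
  have hclopen : IsClopen {a | φ a = m} := ⟨isClosed_eq hφc continuous_const, hopen⟩
  have huniv := hclopen.eq_univ ⟨a₀, rfl⟩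
  obtain ⟨a, ha⟩ := (htop.eventually (eventually_gt_atTop m)).exists
  have h8 : a ∈ {a | φ a = m} := huniv ▸ Set.mem_univ a
  exact ha.ne' h8

end Classification

lemma adic_eval (f : hybridRing r) : (adicPoint : HybridCircle r).eval f = adicAbs f := rfl

lemma arch_eval {t : ℂ} (ht0 : t ≠ 0) (ht : ‖t‖ ≤ r) (f : hybridRing r) :
    (archPoint t ht0 ht).eval f = ‖evalAt t f‖ ^ (Real.log r / Real.log ‖t‖) := rfl

/-- Evaluation at a point of the punctured disk, as a ring homomorphism. -/
noncomputable def evalHom {t : ℂ} (ht0 : t ≠ 0) (ht : ‖t‖ ≤ r) : hybridRing r →+* ℂ where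
  toFun := evalAt t
  map_one' := evalAt_one t
  map_mul' := evalAt_mul ht0 ht
  map_zero' := evalAt_zero t
  map_add' := evalAt_add ht0 ht

lemma evalAt_mono (t : ℂ) (n : ℤ) (a : ℂ) : evalAt t (mono n a : hybridRing r) = a * t ^ n := by
  rw [evalAt, tsum_eq_single n, coe_mono, HahnSeries.coeff_single_same]
  intro k hk
  rw [coe_mono, HahnSeries.coeff_single_of_ne hk, zero_mul]

lemma evalAt_hybC (t a : ℂ) : evalAt t (hybC a : hybridRing r) = a := by
  rw [hybC_apply, evalAt_mono, zpow_zero, mul_one]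

lemma evalAt_hybX (t : ℂ) : evalAt t (hybX : hybridRing r) = t := by
  rw [hybX, evalAt_mono, zpow_one, one_mul]

lemma evalAt_hybX_sub {t : ℂ} (ht0 : t ≠ 0) (ht : ‖t‖ ≤ r) (a : ℂ) :
    evalAt t (hybX - hybC a : hybridRing r) = t - a := by
  rw [sub_eq_add_neg, evalAt_add ht0 ht, evalAt_neg, evalAt_hybX, evalAt_hybC, sub_eq_add_neg]

lemma evalAt_hybPoly {t : ℂ} (ht0 : t ≠ 0) (ht : ‖t‖ ≤ r) (P : Polynomial ℂ) :
    evalAt t (hybPoly P : hybridRing r) = P.eval t := by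
  have h : (evalHom ht0 ht).comp hybPoly = Polynomial.evalRingHom t := by
    ext a
    · simpa [hybPoly_C] using! evalAt_hybC (r := r) t a
    · simpa [hybPoly_X] using! evalAt_hybX (r := r) t
  exact DFunLike.congr_fun h P

lemma adicAbs_hybC {a : ℂ} (ha : a ≠ 0) : adicAbs (hybC a : hybridRing r) = 1 := by
  have h : (hybC a : hybridRing r) ≠ 0 := (map_ne_zero_iff _ hybC.injective).2 ha
  rw [adicAbs_of_ne h, hybC_apply, coe_mono, HahnSeries.order_single ha, zpow_zero]

/-- The points of the hybrid circle are the points `τ t`. -/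
theorem tau_surjective :
    Function.Surjective (tau : Metric.closedBall (0 : ℂ) r → HybridCircle r) := by
  intro x
  obtain ⟨s, hs0, hs1, hs⟩ := exists_eval_hybC_eq_rpow x
  rcases hs0.eq_or_lt with rfl | hspos
  · refine ⟨⟨0, Metric.mem_closedBall_self r.2.1.le⟩, ?_⟩
    rw [tau, dif_pos rfl]
    have hC : ∀ y : HybridCircle r, (∀ a : ℂ, a ≠ 0 → y.eval (hybC a) = 1) →
        ∀ a : ℂ, a ≠ 0 → y.eval (hybX - hybC a) = 1 := by
      intro y hy a ha
      have hnat : ∀ n : ℕ, y.eval n ≤ 1 := by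
        intro n
        rcases eq_or_ne n 0 with rfl | hn
        · simp [y.eval_zero]
        · have h1 := hy (n : ℂ) (by exact_mod_cast hn)
          rw [map_natCast] at h1
          exact h1.le
      refine le_antisymm ?_ ?_
      · rw [sub_eq_add_neg]
        refine (y.eval_add_le_max hnat _ _).trans ?_
        rw [y.eval_neg, hy a ha, eval_hybX]
        exact max_le r.2.2.le le_rfl
      · have h1 := y.eval_add_le_max hnat hybX (-(hybX - hybC a))
        rw [y.eval_neg, eval_hybX, show hybX + -(hybX - hybC a) = (hybC a : hybridRing r) by ring,
          hy a ha] at h1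
        rcases le_max_iff.1 h1 with h2 | h2
        · exact absurd r.2.2 (not_lt.2 h2)
        · exact h2
    have hx1 : ∀ a : ℂ, a ≠ 0 → x.eval (hybC a) = 1 := fun a ha => by
      rw [hs a ha, Real.rpow_zero]
    have ha1 : ∀ a : ℂ, a ≠ 0 → (adicPoint : HybridCircle r).eval (hybC a) = 1 :=
      fun a ha => adicAbs_hybC ha
    refine hybridCircle_ext (fun a => ?_) fun a => ?_
    · rcases eq_or_ne a 0 with rfl | ha
      · simp [BerkovichSpectrum.eval_zero]
      · rw [hx1 a ha, ha1 a ha]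
    · rcases eq_or_ne a 0 with rfl | ha
      · simp only [map_zero, sub_zero, eval_hybX]
      · rw [hC x hx1 a ha, hC _ ha1 a ha]
  · have hs' : ∀ a : ℂ, x.eval (hybC a) = ‖a‖ ^ s := fun a => by
      rcases eq_or_ne a 0 with rfl | ha
      · simp [x.eval_zero, Real.zero_rpow hspos.ne']
      · exact hs a ha
    obtain ⟨t, ht⟩ := exists_eval_hybX_sub_eq_zero x hspos hs'
    have hr0 := r.2.1
    have hsub : ∀ a, x.eval (hybX - hybC a) = ‖t - a‖ ^ s := fun a => by
      rw [← hs', map_sub]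
      have h1 := x.abs_eval_sub_le (hybX - hybC a) (hybC t - hybC a)
      rw [sub_sub_sub_cancel_right, ht] at h1
      exact sub_eq_zero.1 (abs_nonpos_iff.1 h1)
    have htr : ‖t‖ ^ s = r := by
      have h1 := hsub 0
      rwa [map_zero, sub_zero, sub_zero, eval_hybX, eq_comm] at h1
    have ht0 : t ≠ 0 := by
      rintro rfl
      rw [norm_zero, Real.zero_rpow hspos.ne'] at htr
      exact hr0.ne htr
    have htn : 0 < ‖t‖ := norm_pos_iff.2 ht0
    have ht1 : ‖t‖ < 1 := by
      by_contra! h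
      have := Real.one_le_rpow h hspos.le
      rw [htr] at this
      exact absurd r.2.2 (not_lt.2 this)
    have htle : ‖t‖ ≤ r := by
      rw [← htr]
      conv_lhs => rw [← Real.rpow_one ‖t‖]
      exact Real.rpow_le_rpow_of_exponent_ge htn ht1.le hs1
    have hsexp : s = Real.log r / Real.log ‖t‖ := by
      rw [← htr, Real.log_rpow htn, mul_div_cancel_right₀]
      exact (Real.log_neg htn ht1).ne
    refine ⟨⟨t, mem_closedBall_zero_iff.2 htle⟩, ?_⟩
    rw [tau, dif_neg ht0]
    refine hybridCircle_ext (fun a => ?_) fun a => ?_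
    · rw [arch_eval, evalAt_hybC, ← hsexp, hs']
    · rw [arch_eval, evalAt_hybX_sub ht0 htle, ← hsexp, hsub]

/-! ### The topology of the hybrid circle -/

/-- A nonzero element of the hybrid ring is `t ^ n` times a function which is continuous on the
closed disk, holomorphic on the open disk, and nonzero at the origin. -/
lemma exists_evalAt_eq_zpow_mul {f : hybridRing r} (hf : f ≠ 0) :
    ∃ g : ℂ → ℂ, ContinuousOn g (Metric.closedBall 0 r) ∧
      DifferentiableOn ℂ g (Metric.ball 0 r) ∧ g 0 ≠ 0 ∧
      ∀ t : ℂ, t ≠ 0 → evalAt t f = t ^ (f : LaurentSeries ℂ).order * g t := by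
  set o := (f : LaurentSeries ℂ).order with ho
  set b : ℕ → ℂ := fun k => (f : LaurentSeries ℂ).coeff (o + k) with hb
  have hr0 := r.2.1
  have hinj : Function.Injective fun k : ℕ => o + (k : ℤ) := fun i j h => by
    simpa using h
  have hsum : Summable fun k : ℕ => ‖b k‖ * (r : ℝ) ^ k := by
    have h1 := ((summable_hyb f).comp_injective hinj).mul_left ((r : ℝ) ^ o)⁻¹
    refine Summable.of_nonneg_of_le (fun k => by positivity) (fun k => ?_) h1
    simp only [Function.comp]
    rw [zpow_add₀ hr0.ne', zpow_natCast]
    calc ‖b k‖ * (r : ℝ) ^ k ≤ hybNorm (b k) * (r : ℝ) ^ k := by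
          gcongr; exact norm_le_hybNorm _
      _ = ((r : ℝ) ^ o)⁻¹ * (hybNorm (b k) * ((r : ℝ) ^ o * (r : ℝ) ^ k)) := by
          have : ((r : ℝ) ^ o) ≠ 0 := zpow_ne_zero _ hr0.ne'
          field_simp
  have hbound : ∀ (k : ℕ) (t : ℂ), ‖t‖ ≤ r → ‖b k * t ^ k‖ ≤ ‖b k‖ * (r : ℝ) ^ k := fun k t ht => by
    rw [norm_mul, norm_pow]
    gcongr
  refine ⟨fun t => ∑' k : ℕ, b k * t ^ k, ?_, ?_, ?_, ?_⟩
  · exact continuousOn_tsum (fun k => by fun_prop) hsum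
      fun k t ht => hbound k t (mem_closedBall_zero_iff.1 ht)
  · exact Complex.differentiableOn_tsum_of_summable_norm hsum (fun k => by fun_prop)
      Metric.isOpen_ball
      fun k t ht => hbound k t (mem_ball_zero_iff.1 ht).le
  · simp only
    rw [tsum_eq_single 0]
    · have hf' : (f : LaurentSeries ℂ) ≠ 0 := fun h0 => hf (Subtype.ext h0)
      simp only [hb, Nat.cast_zero, add_zero, pow_zero, mul_one]
      exact HahnSeries.coeff_order_eq_zero.not.2 hf'
    · intro k hk
      simp [hk]
  · intro t ht0
    rw [← tsum_mul_left, evalAt]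
    rw [← hinj.tsum_eq]
    · refine tsum_congr fun k => ?_
      rw [zpow_add₀ ht0, zpow_natCast]
      ring
    · intro n hn
      rw [Function.mem_support] at hn
      have h1 : (f : LaurentSeries ℂ).coeff n ≠ 0 := fun h => hn (by rw [h, zero_mul])
      have h2 : o ≤ n := HahnSeries.order_le_of_coeff_ne_zero h1
      exact ⟨(n - o).toNat, by simp only; rw [Int.toNat_of_nonneg (by omega)]; ring⟩

/-- The exponent `log r / log |t|` of the point `τ t`; its value at `t = 0` is `0`, which is also
its limit there. -/
noncomputable def hybExp (r : ℝ) (t : ℂ) : ℝ := Real.log r / Real.log ‖t‖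

lemma hybExp_zero (ρ : ℝ) : hybExp ρ 0 = 0 := by simp [hybExp]

lemma continuousOn_hybExp : ContinuousOn (hybExp r) (Metric.closedBall 0 r) := by
  intro t ht
  refine ContinuousAt.continuousWithinAt ?_
  rcases eq_or_ne t 0 with rfl | ht0
  · rw [continuousAt_iff_punctured_nhds, hybExp_zero]
    unfold hybExp
    have h1 : Tendsto (fun t : ℂ => Real.log ‖t‖) (𝓝[≠] 0) atBot :=
      Real.tendsto_log_nhdsGT_zero.comp tendsto_norm_nhdsNE_zero
    exact h1.const_div_atBot _
  · have h := Real.log_neg (norm_pos_iff.2 ht0) ((mem_closedBall_zero_iff.1 ht).trans_lt r.2.2)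
    exact continuousAt_const.div (continuous_norm.continuousAt.log (norm_ne_zero_iff.2 ht0)) h.ne

lemma tau_zero (h : (0 : ℂ) ∈ Metric.closedBall (0 : ℂ) (r : ℝ)) :
    tau (⟨0, h⟩ : Metric.closedBall (0 : ℂ) r) = adicPoint := by
  rw [tau, dif_pos rfl]

lemma tau_of_ne {t : Metric.closedBall (0 : ℂ) r} (ht : (t : ℂ) ≠ 0) :
    tau t = archPoint t ht (mem_closedBall_zero_iff.1 t.2) := by
  rw [tau, dif_neg ht]

lemma tau_eval_of_ne {t : Metric.closedBall (0 : ℂ) r} (ht : (t : ℂ) ≠ 0) (f : hybridRing r) :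
    (tau t).eval f = ‖evalAt (t : ℂ) f‖ ^ hybExp r t := by
  rw [tau_of_ne ht, arch_eval, hybExp]

/-- The values at the points `τ t` of an element `t ^ n g(t)` of the hybrid ring. -/
lemma tau_eval_eq {f : hybridRing r} (hf : f ≠ 0) {g : ℂ → ℂ}
    (hg : ∀ t : ℂ, t ≠ 0 → evalAt t f = t ^ (f : LaurentSeries ℂ).order * g t)
    (t : Metric.closedBall (0 : ℂ) r) :
    (tau t).eval f = (r : ℝ) ^ (f : LaurentSeries ℂ).order * ‖g t‖ ^ hybExp r t := by
  obtain ⟨t, ht⟩ := t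
  rcases eq_or_ne t 0 with rfl | ht0
  · rw [tau_zero, adic_eval, adicAbs_of_ne hf]
    simp [hybExp_zero]
  · rw [tau_eval_of_ne (t := ⟨t, ht⟩) ht0, hg t ht0, norm_mul, norm_zpow,
      Real.mul_rpow (by positivity) (norm_nonneg _)]
    congr 1
    rw [← Real.rpow_intCast, ← Real.rpow_mul (norm_nonneg _), mul_comm,
      Real.rpow_mul (norm_nonneg _), hybExp,
      norm_rpow_exponent ht0 (mem_closedBall_zero_iff.1 ht), Real.rpow_intCast]

lemma hybExp_pos {t : ℂ} (ht0 : t ≠ 0) (ht : ‖t‖ ≤ r) : 0 < hybExp r t := exponent_pos ht0 ht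

theorem continuous_tau : Continuous (tau : Metric.closedBall (0 : ℂ) r → HybridCircle r) := by
  rw [continuous_induced_rng, continuous_pi_iff]
  intro f
  simp only [Function.comp]
  by_cases hf : f = 0
  · simp only [hf, BerkovichSpectrum.eval_zero]
    exact continuous_const
  · obtain ⟨g, hgc, -, hg0, hg⟩ := exists_evalAt_eq_zpow_mul hf
    simp_rw [tau_eval_eq hf hg]
    refine continuous_const.mul ?_
    have h1 : Continuous fun t : Metric.closedBall (0 : ℂ) r => ‖g t‖ :=
      (continuousOn_iff_continuous_domRestrict.1 hgc).norm
    have h2 : Continuous fun t : Metric.closedBall (0 : ℂ) r => hybExp r t :=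
      continuousOn_iff_continuous_domRestrict.1 continuousOn_hybExp
    refine h1.rpow h2 fun t => ?_
    rcases eq_or_ne (t : ℂ) 0 with h0 | h0
    · left; rw [h0]; exact norm_ne_zero_iff.2 hg0
    · right; exact hybExp_pos h0 (mem_closedBall_zero_iff.1 t.2)

instance : CompactSpace (HybridCircle r) := by
  have : CompactSpace (Metric.closedBall (0 : ℂ) r) :=
    isCompact_iff_compactSpace.1 (isCompact_closedBall _ _)
  exact tau_surjective.compactSpace continuous_tau

lemma isQuotientMap_tau :
    IsQuotientMap (tau : Metric.closedBall (0 : ℂ) r → HybridCircle r) := by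
  have : CompactSpace (Metric.closedBall (0 : ℂ) r) :=
    isCompact_iff_compactSpace.1 (isCompact_closedBall _ _)
  exact IsQuotientMap.of_surjective_continuous tau_surjective continuous_tau

/-- The images of the points of the punctured open disk are dense in the hybrid circle. -/
lemma denseRange_tau :
    DenseRange fun t : PuncturedDisk (r : ℝ) => tau t.toClosedDisk := by
  have h : DenseRange fun t : PuncturedDisk (r : ℝ) => t.toClosedDisk := by
    intro t
    rw [Metric.mem_closure_iff]
    intro ε hε
    have h1 : (t : ℂ) ∈ closure (Metric.ball (0 : ℂ) r) := by
      rw [closure_ball _ r.2.1.ne']; exact t.2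
    have h2 : (t : ℂ) ∈ closure (Metric.ball (0 : ℂ) r ∩ {0}ᶜ) :=
      closure_minimal ((dense_compl_singleton (0 : ℂ)).open_subset_closure_inter
        Metric.isOpen_ball) isClosed_closure h1
    obtain ⟨u, hu, hut⟩ := Metric.mem_closure_iff.1 h2 ε hε
    exact ⟨_, ⟨⟨u, norm_pos_iff.2 hu.2, by simpa using hu.1⟩, rfl⟩, hut⟩
  exact tau_surjective.denseRange.comp h continuous_tau

lemma hybX_sub_hybC_ne_zero {a : ℂ} (ha : a ≠ 0) : (hybX - hybC a : hybridRing r) ≠ 0 := by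
  intro h
  have h2 := (adicPoint : HybridCircle r).abs_eval_sub_le hybX (hybC a)
  rw [h, BerkovichSpectrum.eval_zero, eval_hybX, adic_eval, adicAbs_hybC ha] at h2
  exact r.2.2.ne (sub_eq_zero.1 (abs_nonpos_iff.1 h2))

/-- The only point of the hybrid circle with zero kernel is `τ 0`. -/
lemma eq_adicPoint_of_isZariskiDense {x : HybridCircle r} (hx : x.IsZariskiDense) :
    x = adicPoint := by
  obtain ⟨t, rfl⟩ := tau_surjective x
  by_contra h
  have ht0 : (t : ℂ) ≠ 0 := fun h0 => h (by rw [tau, dif_pos h0])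
  have htr := mem_closedBall_zero_iff.1 t.2
  refine hybX_sub_hybC_ne_zero ht0 (hx _ ?_)
  rw [tau_eval_of_ne ht0, evalAt_hybX_sub ht0 htr, sub_self, norm_zero,
    Real.zero_rpow (hybExp_pos ht0 htr).ne']

lemma adicPoint_isZariskiDense : (adicPoint : HybridCircle r).IsZariskiDense := by
  intro f hf
  by_contra h
  rw [adic_eval, adicAbs_of_ne h] at hf
  exact zpow_ne_zero _ r.2.1.ne' hf

/-! ### Means over circles of extended-real-valued functions -/

section CircleMean

variable {u v : ℂ → EReal} {z : ℂ} {s : ℝ}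

lemma circleMean_mono_ae (h : ∀ᵐ θ ∂(volume.restrict (Set.Ioc 0 (2 * Real.pi))),
    u (circleMap z s θ) ≤ v (circleMap z s θ)) : circleMean u z s ≤ circleMean v z s := by
  unfold circleMean
  refine EReal.sub_le_sub ?_ ?_
  · refine EReal.coe_ennreal_le_coe_ennreal_iff.2 (mul_le_mul_right (lintegral_mono_ae ?_) _)
    filter_upwards [h] with θ hθ using EReal.toENNReal_le_toENNReal hθ
  · refine EReal.coe_ennreal_le_coe_ennreal_iff.2 (mul_le_mul_right (lintegral_mono_ae ?_) _)
    filter_upwards [h] with θ hθ using EReal.toENNReal_le_toENNReal (EReal.neg_le_neg_iff.2 hθ)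

lemma circleMean_mono (hs : 0 < s) (h : ∀ w ∈ Metric.sphere z s, u w ≤ v w) :
    circleMean u z s ≤ circleMean v z s :=
  circleMean_mono_ae (Eventually.of_forall fun θ => h _ (circleMap_mem_sphere z hs.le θ))

lemma circleMean_coe {g : ℂ → ℝ} (hg : CircleIntegrable g z s) :
    circleMean (fun w => (g w : EReal)) z s = ((Real.circleAverage g z s : ℝ) : EReal) := by
  have hi : Integrable (fun θ => g (circleMap z s θ))
      (volume.restrict (Set.Ioc 0 (2 * Real.pi))) := by
    have := hg
    rw [CircleIntegrable, intervalIntegrable_iff_integrableOn_Ioc_of_le (by positivity)] at this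
    exact this
  rw [circleAverage_eq_setIntegral, integral_eq_lintegral_pos_part_sub_lintegral_neg_part hi]
  unfold circleMean
  simp only [← EReal.coe_neg, EReal.real_coe_toENNReal]
  have h1 := hi.lintegral_lt_top
  have h2 : ∫⁻ θ in Set.Ioc 0 (2 * Real.pi), ENNReal.ofReal (-g (circleMap z s θ)) < ⊤ :=
    hi.neg.lintegral_lt_top
  have hp : (0 : ℝ) ≤ (2 * Real.pi)⁻¹ := by positivity
  rw [← ENNReal.ofReal_toReal h1.ne, ← ENNReal.ofReal_toReal h2.ne,
    ← ENNReal.ofReal_mul hp, ← ENNReal.ofReal_mul hp, EReal.coe_ennreal_ofReal,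
    EReal.coe_ennreal_ofReal, max_eq_left (by positivity), max_eq_left (by positivity),
    ENNReal.toReal_ofReal ENNReal.toReal_nonneg, ENNReal.toReal_ofReal ENNReal.toReal_nonneg,
    ← EReal.coe_sub, mul_sub]

/-- If a function is bounded above by an integrable real function on a circle, then so are the
means. -/
lemma circleMean_le_circleAverage {g : ℂ → ℝ} (hs : 0 < s) (hg : CircleIntegrable g z s)
    (h : ∀ w ∈ Metric.sphere z s, u w ≤ (g w : EReal)) :
    circleMean u z s ≤ ((Real.circleAverage g z s : ℝ) : EReal) :=
  (circleMean_mono hs h).trans_eq (circleMean_coe hg)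

/-- Monotone convergence for decreasing sequences. -/
lemma tendsto_circleMean_iInf {w : ℕ → ℂ → EReal} (hs : 0 < s)
    (hw : ∀ n, Measurable fun θ : ℝ => w n (circleMap z s θ))
    (hanti : ∀ x ∈ Metric.sphere z s, Antitone fun n => w n x)
    {C : ℝ} (hC : ∀ x ∈ Metric.sphere z s, w 0 x ≤ (C : EReal)) :
    Tendsto (fun n => circleMean (w n) z s) atTop (𝓝 (circleMean (fun x => ⨅ n, w n x) z s)) := by
  have hmem := fun θ => circleMap_mem_sphere z hs.le θ
  have htop : ∀ θ, (w 0 (circleMap z s θ)).toENNReal ≤ ENNReal.ofReal C := fun θ => by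
    rw [← EReal.real_coe_toENNReal]
    exact EReal.toENNReal_le_toENNReal (hC _ (hmem θ))
  have hpt : ∀ θ, Tendsto (fun n => w n (circleMap z s θ)) atTop
      (𝓝 (⨅ n, w n (circleMap z s θ))) := fun θ => tendsto_atTop_iInf (hanti _ (hmem θ))
  have hfin : ∫⁻ θ in Set.Ioc 0 (2 * Real.pi), (w 0 (circleMap z s θ)).toENNReal ≠ ⊤ := by
    refine ne_top_of_le_ne_top ?_ (lintegral_mono htop)
    simp [ENNReal.mul_eq_top]
  have h1 : Tendsto (fun n => ∫⁻ θ in Set.Ioc 0 (2 * Real.pi), (w n (circleMap z s θ)).toENNReal)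
      atTop (𝓝 (∫⁻ θ in Set.Ioc 0 (2 * Real.pi), (⨅ n, w n (circleMap z s θ)).toENNReal)) := by
    refine lintegral_tendsto_of_tendsto_of_antitone
      (fun n => (hw n).ereal_toENNReal.aemeasurable) (Eventually.of_forall fun θ i j hij => ?_)
      hfin (Eventually.of_forall fun θ => ?_)
    · exact EReal.toENNReal_le_toENNReal (hanti _ (hmem θ) hij)
    · exact (EReal.continuous_toENNReal.tendsto _).comp (hpt θ)
  have h2 : Tendsto (fun n => ∫⁻ θ in Set.Ioc 0 (2 * Real.pi), (-w n (circleMap z s θ)).toENNReal)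
      atTop (𝓝 (∫⁻ θ in Set.Ioc 0 (2 * Real.pi), (-⨅ n, w n (circleMap z s θ)).toENNReal)) := by
    refine lintegral_tendsto_of_tendsto_of_monotone
      (fun n => (hw n).neg.ereal_toENNReal.aemeasurable)
      (Eventually.of_forall fun θ i j hij => ?_) (Eventually.of_forall fun θ => ?_)
    · exact EReal.toENNReal_le_toENNReal (EReal.neg_le_neg_iff.2 (hanti _ (hmem θ) hij))
    · exact (EReal.continuous_toENNReal.tendsto _).comp
        ((continuous_neg.tendsto _).comp (hpt θ))
  have hpne : ENNReal.ofReal (2 * Real.pi)⁻¹ ≠ ⊤ := ENNReal.ofReal_ne_top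
  have h1' := (continuous_coe_ennreal_ereal.tendsto _).comp
    (ENNReal.Tendsto.const_mul h1 (Or.inr hpne))
  have h2' := (continuous_neg.tendsto _).comp ((continuous_coe_ennreal_ereal.tendsto _).comp
    (ENNReal.Tendsto.const_mul h2 (Or.inr hpne)))
  have hA : (∫⁻ θ in Set.Ioc 0 (2 * Real.pi), (⨅ n, w n (circleMap z s θ)).toENNReal) ≠ ⊤ :=
    ne_top_of_le_ne_top hfin (lintegral_mono fun θ =>
      EReal.toENNReal_le_toENNReal (iInf_le _ 0))
  refine (EReal.continuousAt_add (Or.inl ?_) (Or.inl ?_)).tendsto.comp (h1'.prodMk_nhds h2')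
  · exact EReal.coe_ennreal_eq_top_iff.not.2 (ENNReal.mul_ne_top hpne hA)
  · exact EReal.coe_ennreal_ne_bot _

end CircleMean

/-! ### Logarithms with values in the extended reals -/

/-- The logarithm of a nonnegative real number, with the value `-∞` at `0`. -/
noncomputable def elog (y : ℝ) : EReal := ENNReal.log (ENNReal.ofReal y)

lemma elog_of_pos {y : ℝ} (hy : 0 < y) : elog y = (Real.log y : EReal) :=
  ENNReal.log_ofReal_of_pos hy

lemma elog_zero : elog 0 = ⊥ := by simp [elog]

lemma elog_mono : Monotone elog := fun _ _ h =>
  ENNReal.log_monotone (ENNReal.ofReal_le_ofReal h)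

lemma elog_lt_top (y : ℝ) : elog y < ⊤ :=
  ENNReal.log_lt_top_iff.2 ENNReal.ofReal_lt_top

lemma continuous_elog : Continuous elog := ENNReal.continuous_log.comp ENNReal.continuous_ofReal

lemma elog_exp (c : ℝ) : elog (Real.exp c) = (c : EReal) := by
  rw [elog_of_pos (Real.exp_pos c), Real.log_exp]

lemma elog_mul {x y : ℝ} (hx : 0 ≤ x) : elog (x * y) = elog x + elog y := by
  rw [elog, ENNReal.ofReal_mul hx, ENNReal.log_mul_add, elog, elog]

lemma elog_rpow {x a : ℝ} (hx : 0 ≤ x) (ha : 0 ≤ a) : elog (x ^ a) = (a : EReal) * elog x := by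
  rw [elog, ← ENNReal.ofReal_rpow_of_nonneg hx ha, ENNReal.log_rpow, elog]

lemma logAbs_eq_elog {A : Type*} [CommRing A] [Norm A] (f : A) (x : BerkovichSpectrum A) :
    logAbs f x = elog (x.eval f) := rfl

/-- Jensen's inequality. -/
lemma log_norm_le_circleAverage {g : ℂ → ℂ} {z : ℂ} {s : ℝ} (hs : 0 < s)
    (hg : AnalyticOnNhd ℂ g (Metric.closedBall z s)) (h0 : g z ≠ 0) :
    Real.log ‖g z‖ ≤ Real.circleAverage (fun w => Real.log ‖g w‖) z s := by
  have habs : |s| = s := abs_of_pos hs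
  have hg' : AnalyticOnNhd ℂ g (Metric.closedBall z |s|) := by rwa [habs]
  rw [hg'.circleAverage_log_norm hs.ne' h0]
  refine le_add_of_nonneg_left (finsum_nonneg fun w => ?_)
  by_cases hw : w ∈ Metric.closedBall z |s|
  · refine mul_nonneg ?_ ?_
    · have := MeromorphicOn.AnalyticOnNhd.divisor_nonneg hg'
      exact_mod_cast this w
    · rcases eq_or_ne z w with rfl | hne
      · simp
      refine Real.log_nonneg ?_
      have h1 : 0 < ‖z - w‖ := norm_pos_iff.2 (sub_ne_zero.2 hne)
      rw [← div_eq_mul_inv, one_le_div h1, ← dist_eq_norm, dist_comm]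
      simpa [habs] using hw
  · rw [Function.locallyFinsuppWithin.apply_eq_zero_of_notMem _ hw]
    simp

/-- The sub-mean value inequality for `a log |g| + b log |z|`, where `a > 0` and `b ≥ 0`. -/
lemma elog_le_circleMean {g : ℂ → ℂ} {z : ℂ} {s a b : ℝ} (hs : 0 < s) (ha : 0 < a) (hb : 0 ≤ b)
    (hg : AnalyticOnNhd ℂ g (Metric.closedBall z s)) :
    elog (‖g z‖ ^ a * ‖z‖ ^ b) ≤ circleMean (fun w => elog (‖g w‖ ^ a * ‖w‖ ^ b)) z s := by
  by_cases h0 : g z = 0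
  · simp [h0, Real.zero_rpow ha.ne', elog_zero]
  by_cases h1 : ‖z‖ ^ b = 0
  · simp [h1, elog_zero]
  have habs : |s| = s := abs_of_pos hs
  -- the function agrees almost everywhere on the circle with its real-valued version
  have hae : ∀ᵐ θ ∂(volume.restrict (Set.Ioc 0 (2 * Real.pi))), g (circleMap z s θ) ≠ 0 := by
    have h2 := hg.preimage_zero_mem_codiscreteWithin h0 (Metric.mem_closedBall_self hs.le)
      ((convex_closedBall z s).isConnected ⟨z, Metric.mem_closedBall_self hs.le⟩)
    have h3 := codiscreteWithin_mono (Metric.sphere_subset_closedBall) h2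
    rw [← habs] at h3
    exact ae_restrict_le_codiscreteWithin measurableSet_Ioc
      (codiscreteWithin_mono (Set.subset_univ _) (circleMap_preimage_codiscrete hs.ne' h3))
  have hae' : ∀ᵐ θ ∂(volume.restrict (Set.Ioc 0 (2 * Real.pi))), circleMap z s θ ≠ 0 :=
    ae_restrict_of_ae (((Set.countable_singleton (0 : ℂ)).preimage_circleMap z hs.ne').ae_notMem _)
  have hi1 : CircleIntegrable (fun w => Real.log ‖g w‖) z s :=
    MeromorphicOn.circleIntegrable_log_norm
      ((hg.mono (by rw [habs]; exact Metric.sphere_subset_closedBall)).meromorphicOn)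
  have hi2 : CircleIntegrable (fun w : ℂ => Real.log ‖w‖) z s :=
    MeromorphicOn.circleIntegrable_log_norm analyticOnNhd_id.meromorphicOn
  have hi : CircleIntegrable (fun w => a * Real.log ‖g w‖ + b * Real.log ‖w‖) z s :=
    (hi1.const_mul a).add (hi2.const_mul b)
  have hge : ((Real.circleAverage (fun w => a * Real.log ‖g w‖ + b * Real.log ‖w‖) z s : ℝ) :
      EReal) ≤
      circleMean (fun w => elog (‖g w‖ ^ a * ‖w‖ ^ b)) z s := by
    rw [← circleMean_coe hi]
    refine circleMean_mono_ae ?_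
    filter_upwards [hae, hae'] with θ h2 h3
    have h2' := norm_pos_iff.2 h2
    have h3' := norm_pos_iff.2 h3
    rw [elog_of_pos (by positivity), Real.log_mul (by positivity) (by positivity),
      Real.log_rpow h2', Real.log_rpow h3']
  refine le_trans ?_ hge
  have h0' := norm_pos_iff.2 h0
  have hzb : 0 < ‖z‖ ^ b := lt_of_le_of_ne (by positivity) (Ne.symm h1)
  rw [elog_of_pos (by positivity), EReal.coe_le_coe_iff, Real.log_mul (by positivity) hzb.ne',
    Real.log_rpow h0']
  have e1 : Real.circleAverage (fun w => a * Real.log ‖g w‖ + b * Real.log ‖w‖) z s =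
      a * Real.circleAverage (fun w => Real.log ‖g w‖) z s +
        b * Real.circleAverage (fun w : ℂ => Real.log ‖w‖) z s := by
    have hi1' : CircleIntegrable (fun w => a * Real.log ‖g w‖) z s := hi1.const_mul a
    have hi2' : CircleIntegrable (fun w : ℂ => b * Real.log ‖w‖) z s := hi2.const_mul b
    rw [Real.circleAverage_fun_add hi1' hi2']
    simp only [← smul_eq_mul, Real.circleAverage_fun_smul]
  rw [e1]
  refine add_le_add (mul_le_mul_of_nonneg_left (log_norm_le_circleAverage hs hg h0) ha.le) ?_
  rcases hb.eq_or_lt with rfl | hb'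
  · simp
  have hz : z ≠ 0 := fun hz => h1 (by rw [hz, norm_zero, Real.zero_rpow hb'.ne'])
  rw [Real.log_rpow (norm_pos_iff.2 hz)]
  exact mul_le_mul_of_nonneg_left (log_norm_le_circleAverage hs analyticOnNhd_id hz) hb

/-! ### Affine transformations of the extended reals -/

/-- Translation by a real number, as an order isomorphism of the extended reals. -/
noncomputable def addIso (c : ℝ) : EReal ≃o EReal where
  toFun x := x + (c : EReal)
  invFun x := x - (c : EReal)
  left_inv x := EReal.add_sub_cancel_right
  right_inv x := EReal.sub_add_cancel
  map_rel_iff' := by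
    intro x y
    exact ⟨fun h => by
        have := EReal.sub_le_sub h (le_refl (c : EReal))
        simpa only [Equiv.coe_fn_mk, EReal.add_sub_cancel_right] using this,
      fun h => add_le_add_left h _⟩

/-- Multiplication by a positive real number, as an order isomorphism of the extended reals. -/
noncomputable def mulIso (a : ℝ) (ha : 0 < a) : EReal ≃o EReal where
  toFun x := (a : EReal) * x
  invFun x := x / (a : EReal)
  left_inv x := by
    have ha' : (a : EReal) ≠ 0 := by exact_mod_cast ha.ne'
    simp only
    rw [← EReal.mul_div, EReal.mul_div_cancel (EReal.coe_ne_bot _) (EReal.coe_ne_top _) ha']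
  right_inv x := by
    have ha' : (a : EReal) ≠ 0 := by exact_mod_cast ha.ne'
    exact EReal.mul_div_cancel (EReal.coe_ne_bot _) (EReal.coe_ne_top _) ha'
  map_rel_iff' := by
    intro x y
    have ha' : (a : EReal) ≠ 0 := by exact_mod_cast ha.ne'
    have ha0 : (0 : EReal) ≤ a := by exact_mod_cast ha.le
    refine ⟨fun h => ?_, fun h => mul_le_mul_of_nonneg_left h ha0⟩
    have := EReal.div_le_div_right_of_nonneg ha0 h
    simp only [Equiv.coe_fn_mk] at this
    rwa [← EReal.mul_div, ← EReal.mul_div,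
      EReal.mul_div_cancel (EReal.coe_ne_bot _) (EReal.coe_ne_top _) ha',
      EReal.mul_div_cancel (EReal.coe_ne_bot _) (EReal.coe_ne_top _) ha'] at this

lemma addIso_apply (c : ℝ) (x : EReal) : addIso c x = x + (c : EReal) := rfl

lemma mulIso_apply {a : ℝ} (ha : 0 < a) (x : EReal) : mulIso a ha x = (a : EReal) * x := rfl

lemma mulIso_elog {a : ℝ} (ha : 0 < a) {y : ℝ} (hy : 0 ≤ y) :
    mulIso a ha (elog y) = elog (y ^ a) := by
  rw [mulIso_apply, elog_rpow hy ha.le]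

lemma addIso_elog (c : ℝ) {y : ℝ} (hy : 0 ≤ y) : addIso c (elog y) = elog (y * Real.exp c) := by
  rw [addIso_apply, elog_mul hy, elog_exp]

/-! ### Tropical Fubini–Study functions -/

section FubiniStudy

variable {A : Type*} [CommRing A] [Norm A]

lemma isTropicalFS_iff {φ : BerkovichSpectrum A → EReal} :
    IsTropicalFS φ ↔ ∃ (m : ℕ) (k : ℕ) (f : Fin k → A) (c : Fin k → ℝ), 1 ≤ m ∧
      (∀ p : PrimeSpectrum A, ∃ j, f j ∉ p.asIdeal) ∧
      ∀ x, φ x = ⨆ j, elog (x.eval (f j) ^ (m : ℝ)⁻¹ * Real.exp (c j)) := by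
  have key : ∀ (m : ℕ) (_ : 1 ≤ m) (k : ℕ) (f : Fin k → A) (c : Fin k → ℝ)
      (x : BerkovichSpectrum A),
      (((m : ℝ)⁻¹ : ℝ) : EReal) * ⨆ j, (logAbs (f j) x + (c j : EReal)) =
        ⨆ j, elog (x.eval (f j) ^ (m : ℝ)⁻¹ * Real.exp ((m : ℝ)⁻¹ * c j)) := by
    intro m hm k f c x
    have hm' : (0 : ℝ) < (m : ℝ)⁻¹ := by positivity
    rw [← mulIso_apply hm', OrderIso.map_iSup]
    congr 1 with j : 1
    have h0 := x.eval_nonneg (f j)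
    rw [logAbs_eq_elog, ← addIso_apply, addIso_elog _ h0, mulIso_elog _ (by positivity),
      Real.mul_rpow h0 (Real.exp_pos _).le, ← Real.exp_mul, mul_comm (c j)]
  constructor
  · rintro ⟨m, k, f, c, hm, hf, hφ⟩
    exact ⟨m, k, f, fun j => (m : ℝ)⁻¹ * c j, hm, hf, fun x => by rw [hφ, key m hm]⟩
  · rintro ⟨m, k, f, c, hm, hf, hφ⟩
    refine ⟨m, k, f, fun j => m * c j, hm, hf, fun x => ?_⟩
    have hm' : (m : ℝ) ≠ 0 := by positivity
    rw [hφ, key m hm]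
    simp [hm']

lemma iSup_elog_lt_top {k : ℕ} (y : Fin k → ℝ) : ⨆ j, elog (y j) < ⊤ := by
  rw [← Finset.sup_univ_eq_iSup, Finset.sup_lt_iff (by simp)]
  exact fun j _ => elog_lt_top _

lemma IsTropicalFS.lt_top {φ : BerkovichSpectrum A → EReal} (hφ : IsTropicalFS φ)
    (x : BerkovichSpectrum A) : φ x < ⊤ := by
  obtain ⟨m, k, f, c, -, -, h⟩ := isTropicalFS_iff.1 hφ
  rw [h]
  exact iSup_elog_lt_top _

lemma IsTropicalFS.continuous {φ : BerkovichSpectrum A → EReal} (hφ : IsTropicalFS φ) :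
    Continuous φ := by
  obtain ⟨m, k, f, c, hm, -, h⟩ := isTropicalFS_iff.1 hφ
  obtain rfl : φ = _ := funext h
  simp_rw [← Finset.sup_univ_eq_iSup]
  refine Continuous.finset_sup_apply fun j _ => continuous_elog.comp ?_
  refine ((BerkovichSpectrum.continuous_eval (f j)).rpow_const fun x => Or.inr ?_).mul
    continuous_const
  positivity

end FubiniStudy

lemma inv_hybExp (t : ℂ) : (hybExp r t)⁻¹ = Real.logb r ‖t‖ := by
  rw [hybExp, inv_div, Real.logb]

lemma logb_pos {t : ℂ} (ht0 : t ≠ 0) (ht : ‖t‖ ≤ r) : 0 < Real.logb r ‖t‖ := by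
  rw [← inv_hybExp]
  exact inv_pos.2 (hybExp_pos ht0 ht)

lemma PuncturedDisk.ne_zero {R : ℝ} (t : PuncturedDisk R) : (t : ℂ) ≠ 0 := norm_pos_iff.1 t.2.1

lemma rho_eq_mulIso (φ : HybridCircle r → EReal) (t : PuncturedDisk (r : ℝ)) :
    rho r φ t = mulIso _ (logb_pos t.ne_zero t.2.2.le) (φ (tau t.toClosedDisk)) := rfl

/-- The rescaling of one of the functions of which a tropical Fubini–Study function is the maximum,
as a function on the whole open disk. The bound on its value at `τ 0` makes the exponent of `|t|`
nonnegative. -/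
lemma exists_rescaling {f : hybridRing r} {a c d : ℝ} (ha : 0 < a)
    (h : elog ((adicPoint : HybridCircle r).eval f ^ a * Real.exp d) ≤
      ((c * Real.log r : ℝ) : EReal)) :
    ∃ (g : ℂ → ℂ) (b : ℝ), 0 ≤ b ∧ DifferentiableOn ℂ g (Metric.ball 0 r) ∧
      ∀ t : PuncturedDisk (r : ℝ), mulIso _ (logb_pos t.ne_zero t.2.2.le)
        (elog ((tau t.toClosedDisk).eval f ^ a * Real.exp d)) =
        elog (‖g t‖ ^ a * ‖(t : ℂ)‖ ^ b) + ((c * Real.log ‖(t : ℂ)‖ : ℝ) : EReal) := by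
  have hr0 := r.2.1
  have hlog : Real.log r < 0 := Real.log_neg r.2.1 r.2.2
  by_cases hf : f = 0
  · refine ⟨0, 0, le_rfl, differentiableOn_const 0, fun t => ?_⟩
    simp [hf, BerkovichSpectrum.eval_zero, Real.zero_rpow ha.ne', elog_zero]
  obtain ⟨g, -, hg, -, hgt⟩ := exists_evalAt_eq_zpow_mul hf
  set n := (f : LaurentSeries ℂ).order with hn
  refine ⟨g, n * a + d / Real.log r - c, ?_, hg, fun t => ?_⟩
  · rw [adic_eval, adicAbs_of_ne hf, elog_of_pos (by positivity), EReal.coe_le_coe_iff,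
      Real.log_mul (by positivity) (by positivity), Real.log_exp, Real.log_rpow (by positivity),
      Real.log_zpow, ← hn] at h
    have h1 : (c - n * a - d / Real.log r) * -Real.log r ≤ 0 := by
      have h4 : d / Real.log r * Real.log r = d := div_mul_cancel₀ _ hlog.ne
      linarith
    have h2 : c - n * a - d / Real.log r ≤ 0 := by
      by_contra! h3
      nlinarith [mul_pos h3 (neg_pos.2 hlog)]
    linarith
  · have ht := t.2.1
    have ht0 := t.ne_zero
    have hlt : Real.log ‖(t : ℂ)‖ < 0 := Real.log_neg ht (t.2.2.trans r.2.2)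
    have h0 := (tau t.toClosedDisk).eval_nonneg f
    have hpow : ∀ y : ℝ, Real.exp (y * Real.log ‖(t : ℂ)‖) = ‖(t : ℂ)‖ ^ y := fun y => by
      rw [Real.rpow_def_of_pos ht, mul_comm]
    rw [mulIso_elog _ (by positivity), ← addIso_apply, addIso_elog _ (by positivity),
      tau_eval_of_ne (t := t.toClosedDisk) ht0, ← inv_hybExp]
    have he : hybExp r (t : ℂ) ≠ 0 := (hybExp_pos ht0 t.2.2.le).ne'
    congr 1
    have e0 : ((t.toClosedDisk : Metric.closedBall (0 : ℂ) r) : ℂ) = t := rfl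
    rw [e0, Real.mul_rpow (by positivity) (by positivity), ← Real.rpow_mul (by positivity),
      ← Real.rpow_mul (by positivity), ← Real.exp_mul, hgt _ ht0, hpow]
    have e1 : hybExp r (t : ℂ) * (a * (hybExp r (t : ℂ))⁻¹) = a := by field_simp
    have e2 : d * (hybExp r (t : ℂ))⁻¹ = d / Real.log r * Real.log ‖(t : ℂ)‖ := by
      rw [inv_hybExp, Real.logb]; ring
    rw [e1, e2, hpow, norm_mul, norm_zpow, Real.mul_rpow (by positivity) (by positivity),
      ← Real.rpow_intCast, ← Real.rpow_mul (by positivity)]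
    rw [Real.rpow_sub ht, Real.rpow_add ht]
    have : ‖(t : ℂ)‖ ^ c ≠ 0 := by positivity
    field_simp

lemma continuousOn_rescaling {g : ℂ → ℂ} {a b : ℝ} (ha : 0 ≤ a) (hb : 0 ≤ b) {U : Set ℂ}
    (hg : ContinuousOn g U) : ContinuousOn (fun z => elog (‖g z‖ ^ a * ‖z‖ ^ b)) U :=
  continuous_elog.comp_continuousOn
    ((hg.norm.rpow_const fun _ _ => Or.inr ha).mul
      (continuous_norm.continuousOn.rpow_const fun _ _ => Or.inr hb))

/-- The rescaling of a tropical Fubini–Study function is continuous and satisfies the sub-mean value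
inequality up to a multiple of `log |t|`. -/
lemma IsTropicalFS.exists_rescaling {u : HybridCircle r → EReal} (hu : IsTropicalFS u) {c : ℝ}
    (hc : u adicPoint ≤ ((c * Real.log r : ℝ) : EReal)) :
    ∃ w : ℂ → EReal, ContinuousOn w (Metric.ball 0 r) ∧ (∀ z, w z < ⊤) ∧
      (∀ (z : ℂ) (s : ℝ), 0 < s → Metric.closedBall z s ⊆ Metric.ball 0 r →
        w z ≤ circleMean w z s) ∧
      ∀ t : PuncturedDisk (r : ℝ), rho r u t = w t + ((c * Real.log ‖(t : ℂ)‖ : ℝ) : EReal) := by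
  obtain ⟨m, k, f, d, hm, -, h⟩ := isTropicalFS_iff.1 hu
  have hm' : (0 : ℝ) < (m : ℝ)⁻¹ := by positivity
  rw [h] at hc
  choose g b hb hg hgt using fun j => Hybrid.exists_rescaling hm' ((le_iSup _ j).trans hc)
  refine ⟨fun z => ⨆ j, elog (‖g j z‖ ^ (m : ℝ)⁻¹ * ‖z‖ ^ b j), ?_, fun z => iSup_elog_lt_top _,
    fun z s hs hzs => iSup_le fun j => ?_, fun t => ?_⟩
  · simp_rw [← Finset.sup_univ_eq_iSup]
    exact ContinuousOn.finset_sup_apply fun j _ =>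
      continuousOn_rescaling hm'.le (hb j) (hg j).continuousOn
  · have h1 := (hg j).analyticOnNhd Metric.isOpen_ball
    refine (elog_le_circleMean hs hm' (hb j) (h1.mono hzs)).trans (circleMean_mono hs fun w _ => ?_)
    exact le_iSup (fun j => elog (‖g j w‖ ^ (m : ℝ)⁻¹ * ‖w‖ ^ b j)) j
  · rw [rho_eq_mulIso, h, OrderIso.map_iSup, ← addIso_apply, OrderIso.map_iSup]
    exact iSup_congr fun j => hgt j t

/-! ### Decreasing nets of subharmonic functions -/

/-- The infimum of a decreasing net of upper semicontinuous functions is the infimum of a decreasing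
sequence extracted from the net. -/
lemma exists_seq_iInf_eq {X ι : Type*} [TopologicalSpace X] [HereditarilyLindelofSpace X]
    [Preorder ι] [IsDirectedOrder ι] [Nonempty ι] {w : ι → X → EReal}
    (hw : ∀ i, UpperSemicontinuous (w i)) (hanti : Antitone w) :
    ∃ j : ℕ → ι, Monotone j ∧ ∀ x, ⨅ i, w i x = ⨅ n, w (j n) x := by
  classical
  have h1 : IsGLB (Set.range w) (⨅ i, w i) := isGLB_iInf
  obtain ⟨F, hFw, hFc, hF⟩ := exists_countable_upperSemicontinuous_isGLB
    (by rintro _ ⟨i, rfl⟩; exact hw i) h1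
  obtain ⟨i₀⟩ := ‹Nonempty ι›
  obtain ⟨e, he⟩ := (hFc.insert (w i₀)).exists_eq_range (Set.insert_nonempty _ _)
  have h2 : ∀ n, ∃ i, w i = e n := fun n => by
    have : e n ∈ insert (w i₀) F := he ▸ Set.mem_range_self n
    rcases this with h | h
    · exact ⟨i₀, h.symm⟩
    · exact hFw h
  choose i hi using h2
  choose d hd1 hd2 using fun a b : ι => directed_of (· ≤ ·) a b
  -- dominate the indices `i n` successively, to obtain a monotone sequence in the directed set
  let j : ℕ → ι := fun n => Nat.rec (i 0) (fun n a => d a (i (n + 1))) n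
  have hj : Monotone j := monotone_nat_of_le_succ fun n => hd1 _ _
  have hij : ∀ n, i n ≤ j n := by
    rintro (_ | n)
    · exact le_rfl
    · exact hd2 _ _
  refine ⟨j, hj, fun x => le_antisymm (le_iInf fun n => iInf_le _ _) ?_⟩
  have h3 : (⨅ n, w (j n)) ≤ ⨅ i, w i := by
    refine (le_isGLB_iff hF).2 fun f hf => ?_
    obtain ⟨n, hn⟩ : f ∈ Set.range e := he ▸ Set.mem_insert_of_mem _ hf
    refine (iInf_le _ n).trans ((hanti (hij n)).trans ?_)
    rw [hi, hn]
  simpa [iInf_apply] using h3 x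

/-- The infimum of a decreasing net of continuous functions satisfying the sub-mean value inequality
is subharmonic, unless it is identically `-∞`. -/
lemma isSubharmonicOn_iInf {ι : Type*} [Preorder ι] [IsDirectedOrder ι] [Nonempty ι] {U : Set ℂ}
    {w : ι → ℂ → EReal} (hc : ∀ i, ContinuousOn (w i) U) (htop : ∀ i z, w i z < ⊤)
    (hmean : ∀ (i : ι) (z : ℂ) (s : ℝ), 0 < s → Metric.closedBall z s ⊆ U →
      w i z ≤ circleMean (w i) z s)
    (hanti : ∀ i j, i ≤ j → ∀ z ∈ U, w j z ≤ w i z)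
    (hbot : ∃ z ∈ U, ⨅ i, w i z ≠ ⊥) : IsSubharmonicOn (fun z => ⨅ i, w i z) U := by
  obtain ⟨i₀⟩ := ‹Nonempty ι›
  refine ⟨upperSemicontinuousOn_iInf fun i => (hc i).upperSemicontinuousOn,
    fun z _ => (iInf_le _ i₀).trans_lt (htop i₀ z), hbot, fun z s hs hzs => ?_⟩
  have : Nonempty ι := ⟨i₀⟩
  obtain ⟨j, hj, hjw⟩ := exists_seq_iInf_eq (X := U) (w := fun i z => w i z)
    (fun i => (continuousOn_iff_continuous_domRestrict.1 (hc i)).upperSemicontinuous)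
    (fun i k hik z => hanti i k hik z z.2)
  have hsub : Metric.sphere z s ⊆ U := Metric.sphere_subset_closedBall.trans hzs
  have hcc : ∀ n, Continuous fun θ : ℝ => w (j n) (circleMap z s θ) := fun n =>
    (hc (j n)).comp_continuous (continuous_circleMap z s)
      fun θ => hsub (circleMap_mem_sphere z hs.le θ)
  obtain ⟨C, hC⟩ : ∃ C : ℝ, ∀ x ∈ Metric.sphere z s, w (j 0) x ≤ (C : EReal) := by
    obtain ⟨x, -, hx⟩ := (isCompact_sphere z s).exists_isMaxOn
      (NormedSpace.sphere_nonempty.2 hs.le) ((hc (j 0)).mono hsub)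
    exact ⟨(w (j 0) x).toReal, fun y hy => (hx hy).trans (EReal.le_coe_toReal (htop _ x).ne)⟩
  have hlim := tendsto_circleMean_iInf (w := fun n => w (j n)) hs (fun n => (hcc n).measurable)
    (fun x hx => fun a b hab => hanti _ _ (hj hab) x (hsub hx)) hC
  have heq : circleMean (fun x => ⨅ n, w (j n) x) z s ≤ circleMean (fun z => ⨅ i, w i z) z s :=
    circleMean_mono hs fun x hx => (hjw ⟨x, hsub hx⟩).ge
  refine le_trans (ge_of_tendsto' hlim fun n => ?_) heq
  exact (iInf_le _ (j n)).trans (hmean (j n) z s hs hzs)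

/-! ### The rescaling of plurisubharmonic functions -/

lemma nhdsWithin_ball_sdiff_singleton_neBot {R : ℝ} (hR : 0 < R) :
    (𝓝[Metric.ball (0 : ℂ) R \ {0}] (0 : ℂ)).NeBot := by
  have h : 𝓝[Metric.ball (0 : ℂ) R \ {0}] (0 : ℂ) = 𝓝[≠] 0 := by
    rw [Set.sdiff_eq, Set.inter_comm, nhdsWithin_inter_of_mem']
    exact mem_nhdsWithin_of_mem_nhds (Metric.ball_mem_nhds 0 hR)
  rw [h]
  infer_instance

/-- The rescaling of a plurisubharmonic function is the sum of a subharmonic function and a multiple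
of `log |t|`, unless it is identically `-∞`. -/
theorem rho_mem_SHLog {φ : HybridCircle r → EReal} (hφ : φ ∈ PSH (hybridRing r)) :
    rho r φ ∈ SHLog r ∨ ∀ t, rho r φ t = ⊥ := by
  obtain ⟨⟨ι, _, _, ⟨i₀⟩, u, hu, hFS, hlim⟩, -⟩ := hφ
  by_cases hbot : ∀ t, rho r φ t = ⊥
  · exact Or.inr hbot
  left
  push Not at hbot
  obtain ⟨t₀, ht₀⟩ := hbot
  have hlog : Real.log r < 0 := Real.log_neg r.2.1 r.2.2
  -- normalise by the slope at `0` of one of the functions of the net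
  obtain ⟨c, hc⟩ : ∃ c : ℝ, u i₀ adicPoint ≤ ((c * Real.log r : ℝ) : EReal) :=
    ⟨(u i₀ adicPoint).toReal / Real.log r, by
      rw [div_mul_cancel₀ _ hlog.ne]
      exact EReal.le_coe_toReal ((hFS i₀).lt_top _).ne⟩
  choose w hwc hwtop hwmean hwrho using fun i : Set.Ici i₀ =>
    (hFS i).exists_rescaling ((hu i.2 adicPoint).trans hc)
  have hanti' : ∀ i j : Set.Ici i₀, i ≤ j → ∀ z ∈ Metric.ball (0 : ℂ) r \ {0}, w j z ≤ w i z := by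
    intro i j hij z hz
    have hz' : 0 < ‖z‖ ∧ ‖z‖ < r := ⟨norm_pos_iff.2 hz.2, mem_ball_zero_iff.1 hz.1⟩
    have h1 := hwrho i ⟨z, hz'⟩
    have h2 := hwrho j ⟨z, hz'⟩
    rw [← addIso_apply] at h1 h2
    rw [← (addIso (c * Real.log ‖z‖)).le_iff_le, ← h1, ← h2, rho_eq_mulIso, rho_eq_mulIso,
      OrderIso.le_iff_le]
    exact hu hij _
  have hanti : ∀ i j : Set.Ici i₀, i ≤ j → ∀ z ∈ Metric.ball (0 : ℂ) r, w j z ≤ w i z := by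
    intro i j hij z hz
    rcases eq_or_ne z 0 with rfl | hz0
    · have := nhdsWithin_ball_sdiff_singleton_neBot r.2.1
      have hsub : Metric.ball (0 : ℂ) r \ {0} ⊆ Metric.ball (0 : ℂ) r := Set.sdiff_subset
      exact le_of_tendsto_of_tendsto ((hwc j 0 hz).mono_left (nhdsWithin_mono _ hsub))
        ((hwc i 0 hz).mono_left (nhdsWithin_mono _ hsub))
        (eventually_nhdsWithin_of_forall (hanti' i j hij))
    · exact hanti' i j hij z ⟨hz, hz0⟩
  have : Nonempty (Set.Ici i₀) := ⟨⟨i₀, le_rfl⟩⟩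
  have hdir : IsDirectedOrder (Set.Ici i₀) := ⟨fun a b => by
    obtain ⟨d, h1, h2⟩ := directed_of (· ≤ ·) (a : ι) b
    exact ⟨⟨d, le_trans a.2 h1⟩, h1, h2⟩⟩
  have hφ : ∀ x, φ x = ⨅ i : Set.Ici i₀, u i x := fun x => by
    have : Nonempty ι := ⟨i₀⟩
    have h1 : φ x = ⨅ i, u i x := tendsto_nhds_unique (hlim x)
      (tendsto_atTop_iInf fun i j hij => hu hij x)
    rw [h1]
    refine le_antisymm (le_iInf fun i => iInf_le _ _) (le_iInf fun i => ?_)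
    obtain ⟨d, h1, h2⟩ := directed_of (· ≤ ·) i i₀
    exact (iInf_le _ (⟨d, h2⟩ : Set.Ici i₀)).trans (hu h1 x)
  have hrho : ∀ t : PuncturedDisk (r : ℝ), rho r φ t =
      (⨅ i, w i t) + ((c * Real.log ‖(t : ℂ)‖ : ℝ) : EReal) := fun t => by
    rw [rho_eq_mulIso, hφ, OrderIso.map_iInf, ← addIso_apply, OrderIso.map_iInf]
    exact iInf_congr fun i => hwrho i t
  refine ⟨fun z => ⨅ i, w i z, isSubharmonicOn_iInf hwc hwtop hwmean hanti
    ⟨t₀, mem_ball_zero_iff.2 t₀.2.2, fun h => ht₀ ?_⟩, c, hrho⟩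
  rw [hrho, h, EReal.bot_add]

lemma rho_monotone {φ ψ : HybridCircle r → EReal} (h : φ ≤ ψ) : rho r φ ≤ rho r ψ := fun t => by
  rw [rho_eq_mulIso, rho_eq_mulIso, OrderIso.le_iff_le]
  exact h _

lemma rho_eq_iff {φ ψ : HybridCircle r → EReal} : rho r φ = rho r ψ ↔
    ∀ t : PuncturedDisk (r : ℝ), φ (tau t.toClosedDisk) = ψ (tau t.toClosedDisk) := by
  rw [funext_iff]
  refine forall_congr' fun t => ?_
  rw [rho_eq_mulIso, rho_eq_mulIso, EmbeddingLike.apply_eq_iff_eq]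

/-- Continuous functions are determined by their values on the dense set `τ(𝔻_r^*)`. -/
lemma rho_injOn_continuous : Set.InjOn (rho r) {φ | Continuous φ} := fun _ hφ _ hψ h =>
  denseRange_tau.equalizer hφ hψ (funext fun t => rho_eq_iff.1 h t)

/-! ### Lelong numbers of continuous functions -/

lemma lelong_eq_coe {R : ℝ} {f : PuncturedDisk R → EReal} {ν : ℝ}
    (h1 : ∀ γ < ν, ∃ C ε : ℝ, 0 < ε ∧ ∀ t : PuncturedDisk R, ‖(t : ℂ)‖ < ε →
      f t ≤ ((γ * Real.log ‖(t : ℂ)‖ + C : ℝ) : EReal))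
    (h2 : ∀ γ C ε : ℝ, 0 < ε → (∀ t : PuncturedDisk R, ‖(t : ℂ)‖ < ε →
      f t ≤ ((γ * Real.log ‖(t : ℂ)‖ + C : ℝ) : EReal)) → γ ≤ ν) : lelong f = (ν : EReal) := by
  refine le_antisymm (iSup_le ?_) (le_of_forall_lt fun x hx => ?_)
  · rintro ⟨γ, C, ε, hε, h⟩
    exact EReal.coe_le_coe_iff.2 (h2 γ C ε hε h)
  · obtain ⟨γ, hxγ, hγ⟩ := EReal.lt_iff_exists_real_btwn.1 hx
    exact hxγ.trans_le (le_iSup (fun γ : {γ : ℝ // ∃ C ε : ℝ, 0 < ε ∧ ∀ t : PuncturedDisk R,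
      ‖(t : ℂ)‖ < ε → f t ≤ ((γ * Real.log ‖(t : ℂ)‖ + C : ℝ) : EReal)} => ((γ : ℝ) : EReal))
        ⟨γ, h1 γ (EReal.coe_lt_coe_iff.1 hγ)⟩)

lemma PSH.lt_top {φ : HybridCircle r → EReal} (hφ : φ ∈ PSH (hybridRing r)) (x : HybridCircle r) :
    φ x < ⊤ := by
  obtain ⟨⟨ι, _, _, ⟨i₀⟩, u, hu, hFS, hlim⟩, -⟩ := hφ
  have : Nonempty ι := ⟨i₀⟩
  refine lt_of_le_of_lt (le_of_tendsto (hlim x) ?_) ((hFS i₀).lt_top x)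
  filter_upwards [eventually_ge_atTop i₀] with i hi using hu hi x

/-- The value at `τ 0` of a continuous plurisubharmonic function is the Lelong number of its
rescaling, up to the factor `log r`. -/
theorem apply_tau_zero_eq_lelong {φ : HybridCircle r → EReal} (hφ : φ ∈ PSH (hybridRing r))
    (hcont : Continuous φ) : rho r φ ∈ SHLog r ∧
      φ adicPoint = ((Real.log r : ℝ) : EReal) * lelong (rho r φ) := by
  have hlog : Real.log r < 0 := Real.log_neg r.2.1 r.2.2
  have hbot : φ adicPoint ≠ ⊥ := hφ.2 _ adicPoint_isZariskiDense
  obtain ⟨L, hL⟩ : ∃ L : ℝ, φ adicPoint = (L : EReal) :=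
    ⟨_, (EReal.coe_toReal (PSH.lt_top hφ _).ne hbot).symm⟩
  refine ⟨(rho_mem_SHLog hφ).resolve_right fun h => hbot ?_, ?_⟩
  · have h1 : φ = fun _ => ⊥ := denseRange_tau.equalizer hcont continuous_const
      (funext fun t => by
        have := h t
        rw [rho_eq_mulIso] at this
        exact (mulIso _ (logb_pos t.ne_zero t.2.2.le)).injective
          (this.trans (OrderIso.map_bot _).symm))
    rw [h1]
  · have hφt : Tendsto (fun t : PuncturedDisk (r : ℝ) => φ (tau t.toClosedDisk))
        (comap (fun t : PuncturedDisk (r : ℝ) => (t : ℂ)) (𝓝 0)) (𝓝 (L : EReal)) := by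
      have h0 : (0 : ℂ) ∈ Metric.closedBall (0 : ℂ) (r : ℝ) := Metric.mem_closedBall_self r.2.1.le
      have h1 := (hcont.comp continuous_tau).tendsto (⟨0, h0⟩ : Metric.closedBall (0 : ℂ) r)
      simp only [Function.comp, tau_zero] at h1
      rw [hL] at h1
      refine h1.comp ?_
      rw [tendsto_subtype_rng]
      exact tendsto_comap
    have hev : ∀ {p : PuncturedDisk (r : ℝ) → Prop},
        (∀ᶠ t in comap (fun t : PuncturedDisk (r : ℝ) => (t : ℂ)) (𝓝 0), p t) ↔
          ∃ ε > 0, ∀ t : PuncturedDisk (r : ℝ), ‖(t : ℂ)‖ < ε → p t := by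
      intro p
      rw [(Metric.nhds_basis_ball.comap _).eventually_iff]
      simp
    have hne : (comap (fun t : PuncturedDisk (r : ℝ) => (t : ℂ)) (𝓝 0)).NeBot := by
      rw [comap_neBot_iff]
      intro s hs
      obtain ⟨ε, hε, hs⟩ := Metric.mem_nhds_iff.1 hs
      have h1 : 0 < min ε r := lt_min hε r.2.1
      have h2 : ‖((min ε r / 2 : ℝ) : ℂ)‖ = min ε r / 2 := by
        rw [Complex.norm_real, Real.norm_of_nonneg (by positivity)]
      refine ⟨⟨((min ε r / 2 : ℝ) : ℂ), by rw [h2]; positivity, ?_⟩, hs ?_⟩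
      · rw [h2]; linarith [min_le_right ε (r : ℝ)]
      · rw [mem_ball_zero_iff, h2]; linarith [min_le_left ε (r : ℝ)]
    have hrho : lelong (rho r φ) = ((L / Real.log r : ℝ) : EReal) := by
      refine lelong_eq_coe (fun γ hγ => ?_) (fun γ C ε hε h => ?_)
      · have h1 : L < γ * Real.log r := by
          rwa [lt_div_iff_of_neg hlog] at hγ
        obtain ⟨ε, hε, h2⟩ := hev.1 (hφt.eventually_lt_const (EReal.coe_lt_coe_iff.2 h1))
        refine ⟨0, ε, hε, fun t ht => ?_⟩
        rw [rho_eq_mulIso]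
        refine ((OrderIso.monotone _) (h2 t ht).le).trans_eq ?_
        rw [mulIso_apply, ← EReal.coe_mul, Real.logb]
        congr 1
        have := hlog.ne
        field_simp
        rw [add_zero]
      · have hlim : Tendsto (fun t : PuncturedDisk (r : ℝ) =>
            ((γ * Real.log r + C * hybExp r t : ℝ) : EReal))
            (comap (fun t : PuncturedDisk (r : ℝ) => (t : ℂ)) (𝓝 0))
            (𝓝 ((γ * Real.log r : ℝ) : EReal)) := by
          have h0 := continuousOn_hybExp (r := r) 0 (Metric.mem_closedBall_self r.2.1.le)
          rw [ContinuousWithinAt, hybExp_zero] at h0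
          have h3 : Tendsto (fun t : PuncturedDisk (r : ℝ) => hybExp r t)
              (comap (fun t : PuncturedDisk (r : ℝ) => (t : ℂ)) (𝓝 0)) (𝓝 0) :=
            h0.comp (tendsto_nhdsWithin_iff.2 ⟨tendsto_comap,
              Eventually.of_forall fun t => mem_closedBall_zero_iff.2 t.2.2.le⟩)
          have h4 := (h3.const_mul C).const_add (γ * Real.log r)
          rw [mul_zero, add_zero] at h4
          exact (continuous_coe_real_ereal.tendsto _).comp h4
        have h1 := le_of_tendsto_of_tendsto hφt hlim (hev.2 ⟨ε, hε, fun t ht => by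
          have h2 := h t ht
          rw [rho_eq_mulIso] at h2
          rw [← (mulIso _ (logb_pos t.ne_zero t.2.2.le)).le_iff_le]
          refine h2.trans_eq ?_
          rw [mulIso_apply, ← EReal.coe_mul, Real.logb, hybExp]
          congr 1
          have : Real.log ‖(t : ℂ)‖ ≠ 0 := (Real.log_neg t.2.1 (t.2.2.trans r.2.2)).ne
          have := hlog.ne
          field_simp⟩)
        rw [EReal.coe_le_coe_iff] at h1
        rwa [le_div_iff_of_neg hlog]
    rw [hrho, hL, ← EReal.coe_mul, mul_div_cancel₀ _ hlog.ne]

/-! ### The maximum principle on annuli -/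

lemma circleAverage_log_norm_eq {z : ℂ} {s : ℝ} (hs : 0 < s) (hzs : s < ‖z‖) :
    CircleIntegrable (fun w : ℂ => Real.log ‖w‖) z s ∧
      Real.circleAverage (fun w : ℂ => Real.log ‖w‖) z s = Real.log ‖z‖ := by
  refine ⟨MeromorphicOn.circleIntegrable_log_norm analyticOnNhd_id.meromorphicOn, ?_⟩
  refine AnalyticOnNhd.circleAverage_log_norm_of_ne_zero analyticOnNhd_id fun w hw h0 => ?_
  rw [abs_of_pos hs, mem_closedBall_iff_norm] at hw
  obtain rfl : w = 0 := h0
  rw [zero_sub, norm_neg] at hw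
  linarith

lemma circleAverage_re_mul (a z : ℂ) (s : ℝ) :
    CircleIntegrable (fun w : ℂ => (a * w).re) z s ∧
      Real.circleAverage (fun w : ℂ => (a * w).re) z s = (a * z).re := by
  have ha : AnalyticOnNhd ℂ (fun w : ℂ => a * w) Set.univ := fun w _ => by fun_prop
  refine ⟨ContinuousOn.circleIntegrable' (by fun_prop), ?_⟩
  exact InnerProductSpace.HarmonicOnNhd.circleAverage_eq
    (fun x _ => (ha x (Set.mem_univ x)).harmonicAt_re)

/-- Comparison with a multiple of `log |w|` on an annulus. The error term `b ^ 2` comes from the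
strictly subharmonic perturbation `‖w‖ ^ 2`, which excludes interior maxima. -/
lemma IsSubharmonicOn.le_of_annulus {u : ℂ → EReal} {U : Set ℂ} (hu : IsSubharmonicOn u U)
    {a b γ B : ℝ} (ha : 0 < a) (hU : Metric.closedBall 0 b ⊆ U)
    (hbd : ∀ w : ℂ, ‖w‖ = a ∨ ‖w‖ = b → u w ≤ ((γ * Real.log ‖w‖ + B : ℝ) : EReal)) {w : ℂ}
    (haw : a ≤ ‖w‖) (hwb : ‖w‖ ≤ b) :
    u w ≤ ((γ * Real.log ‖w‖ + B + b ^ 2 : ℝ) : EReal) := by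
  set K : Set ℂ := Metric.closedBall 0 b ∩ {w | a ≤ ‖w‖} with hK
  have hKc : IsCompact K := (isCompact_closedBall _ _).inter_right
    (isClosed_le continuous_const continuous_norm)
  have hKU : K ⊆ U := Set.inter_subset_left.trans hU
  have hK0 : ∀ w ∈ K, 0 < ‖w‖ := fun w hw => ha.trans_le hw.2
  set q : ℂ → ℝ := fun w => ‖w‖ ^ 2 - γ * Real.log ‖w‖ - B with hq
  have hqc : ContinuousOn q K := by
    refine ((continuous_norm.pow 2).continuousOn.sub (continuousOn_const.mul
      (continuous_norm.continuousOn.log fun w hw => (hK0 w hw).ne'))).sub continuousOn_const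
  have husc : UpperSemicontinuousOn (fun w => u w + (q w : EReal)) K := by
    refine UpperSemicontinuousOn.add' (hu.usc.mono hKU) ?_ fun x hx => ?_
    · exact (continuous_coe_real_ereal.comp_continuousOn hqc).upperSemicontinuousOn
    · exact EReal.continuousAt_add (Or.inr (EReal.coe_ne_bot _)) (Or.inr (EReal.coe_ne_top _))
  have hwK : w ∈ K := ⟨mem_closedBall_zero_iff.2 hwb, haw⟩
  obtain ⟨z, hzK, hz⟩ := husc.exists_isMaxOn ⟨w, hwK⟩ hKc
  have hzw : ∀ w ∈ K, u w + (q w : EReal) ≤ u z + (q z : EReal) := fun w hw => hz hw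
  have hconv : ∀ {M : ℝ} {w : ℂ}, u w + (q w : EReal) ≤ (M : EReal) →
      u w ≤ ((M - q w : ℝ) : EReal) := by
    intro M w h
    rw [EReal.coe_sub]
    exact (EReal.le_sub_iff_add_le (Or.inl (EReal.coe_ne_bot _)) (Or.inl (EReal.coe_ne_top _))).2 h
  have hfin : ∀ {M : ℝ}, M ≤ b ^ 2 → u z + (q z : EReal) ≤ (M : EReal) →
      u w ≤ ((γ * Real.log ‖w‖ + B + b ^ 2 : ℝ) : EReal) := by
    intro M hM h
    refine (hconv ((hzw w hwK).trans h)).trans (EReal.coe_le_coe_iff.2 ?_)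
    simp only [hq]
    nlinarith [sq_nonneg ‖w‖]
  have hzb := mem_closedBall_zero_iff.1 hzK.1
  have hza : a ≤ ‖z‖ := hzK.2
  have hztop := hu.lt_top z (hKU hzK)
  by_cases hbdz : ‖z‖ = a ∨ ‖z‖ = b
  · refine hfin (M := ‖z‖ ^ 2) (by gcongr) ?_
    calc u z + (q z : EReal) ≤ ((γ * Real.log ‖z‖ + B : ℝ) : EReal) + (q z : EReal) := by
          gcongr; exact hbd z hbdz
      _ = ((‖z‖ ^ 2 : ℝ) : EReal) := by
          rw [← EReal.coe_add]; simp only [hq]; congr 1; ring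
  by_cases hzbot : u z = ⊥
  · refine hfin (M := 0) (by positivity) ?_
    rw [hzbot, EReal.bot_add]
    exact bot_le
  exfalso
  obtain ⟨x, hx⟩ : ∃ x : ℝ, u z = (x : EReal) := ⟨_, (EReal.coe_toReal hztop.ne hzbot).symm⟩
  push Not at hbdz
  have hza' : a < ‖z‖ := lt_of_le_of_ne hza (Ne.symm hbdz.1)
  have hzb' : ‖z‖ < b := lt_of_le_of_ne hzb hbdz.2
  obtain ⟨s, hs, hsa, hsb⟩ : ∃ s : ℝ, 0 < s ∧ s < ‖z‖ - a ∧ s < b - ‖z‖ := by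
    obtain ⟨s, h1, h2⟩ := exists_between (lt_min (sub_pos.2 hza') (sub_pos.2 hzb'))
    exact ⟨s, h1, h2.trans_le (min_le_left _ _), h2.trans_le (min_le_right _ _)⟩
  have hball : Metric.closedBall z s ⊆ K := by
    intro w hw
    rw [mem_closedBall_iff_norm] at hw
    have h1 := norm_sub_norm_le z w
    have h2 := norm_sub_norm_le w z
    rw [norm_sub_rev] at h1
    exact ⟨mem_closedBall_zero_iff.2 (by linarith), by simp only [Set.mem_ofPred_eq]; linarith⟩
  obtain ⟨hi1, ha1⟩ := circleAverage_log_norm_eq hs (by linarith : s < ‖z‖)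
  obtain ⟨hi2, ha2⟩ := circleAverage_re_mul (2 * (starRingEnd ℂ) z) z s
  -- on the circle, `‖w‖ ^ 2` is the restriction of a harmonic function
  set h : ℂ → ℝ := fun w => (x + q z + B + ‖z‖ ^ 2 - s ^ 2) +
    (γ * Real.log ‖w‖ - (2 * (starRingEnd ℂ) z * w).re) with hh
  have hi3 : CircleIntegrable (fun w : ℂ => γ * Real.log ‖w‖) z s := hi1.const_mul γ
  have hi4 : CircleIntegrable (fun w : ℂ => γ * Real.log ‖w‖ -
      (2 * (starRingEnd ℂ) z * w).re) z s := hi3.sub hi2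
  have hi5 : CircleIntegrable (fun _ : ℂ => x + q z + B + ‖z‖ ^ 2 - s ^ 2) z s :=
    circleIntegrable_const _ _ _
  have hav : Real.circleAverage h z s = x - s ^ 2 := by
    have e1 : Real.circleAverage (fun w : ℂ => γ * Real.log ‖w‖) z s = γ * Real.log ‖z‖ := by
      rw [← ha1]
      simp only [← smul_eq_mul, Real.circleAverage_fun_smul]
    rw [hh, Real.circleAverage_fun_add hi5 hi4, Real.circleAverage_const,
      Real.circleAverage_fun_sub hi3 hi2, e1, ha2]
    have e2 : (2 * (starRingEnd ℂ) z * z).re = 2 * ‖z‖ ^ 2 := by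
      rw [mul_assoc, Complex.conj_mul']
      norm_cast
    rw [e2]
    simp only [hq]
    ring
  have hle : ∀ w ∈ Metric.sphere z s, u w ≤ (h w : EReal) := by
    intro w hw
    have h1 := hzw w (hball (Metric.sphere_subset_closedBall hw))
    rw [hx, ← EReal.coe_add] at h1
    refine (hconv h1).trans_eq ?_
    congr 1
    have h2 : ‖w‖ ^ 2 = s ^ 2 - ‖z‖ ^ 2 + (2 * (starRingEnd ℂ) z * w).re := by
      rw [← mem_sphere_iff_norm.1 hw, ← Complex.normSq_eq_norm_sq, ← Complex.normSq_eq_norm_sq,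
        ← Complex.normSq_eq_norm_sq]
      simp [Complex.normSq_apply]
      ring
    simp only [hq, hh, h2]
    ring
  have hi : CircleIntegrable h z s := hi5.add hi4
  have hfinal := (hu.le_mean z s hs (hball.trans hKU)).trans
    (circleMean_le_circleAverage hs hi hle)
  rw [hx, hav, EReal.coe_le_coe_iff] at hfinal
  nlinarith [sq_nonneg s, pow_pos hs 2]

/-- A subharmonic function on a disk does not tend to `-∞` at the origin faster than all the
multiples of `log |t|`. -/
lemma IsSubharmonicOn.exists_not_le {u : ℂ → EReal} {R : ℝ}
    (hu : IsSubharmonicOn u (Metric.ball 0 R)) :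
    ∃ γ : ℝ, ∀ C ε : ℝ, 0 < ε → ∃ t : ℂ, 0 < ‖t‖ ∧ ‖t‖ < ε ∧
      ((γ * Real.log ‖t‖ + C : ℝ) : EReal) < u t := by
  by_contra! hcon
  -- compare on annuli whose inner radius tends to `0`, and then let the slope tend to infinity
  have hbot : ∀ t : ℂ, t ≠ 0 → ‖t‖ < R → u t = ⊥ := by
    intro t ht0 htR
    have ht0' := norm_pos_iff.2 ht0
    obtain ⟨b, htb, hbR⟩ := exists_between htR
    have hsub : Metric.closedBall (0 : ℂ) b ⊆ Metric.ball 0 R := Metric.closedBall_subset_ball hbR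
    obtain ⟨x, hxb, hx⟩ := (hu.usc.mono hsub).exists_isMaxOn
      ⟨t, mem_closedBall_zero_iff.2 htb.le⟩ (isCompact_closedBall _ _)
    set B := (u x).toReal
    have hB : ∀ w : ℂ, ‖w‖ ≤ b → u w ≤ (B : EReal) := fun w hw =>
      (hx (mem_closedBall_zero_iff.2 hw)).trans
        (EReal.le_coe_toReal (hu.lt_top x (hsub hxb)).ne)
    have key : ∀ γ : ℝ, u t ≤
        ((γ * Real.log ‖t‖ + (B - γ * Real.log b) + b ^ 2 : ℝ) : EReal) := by
      intro γ
      obtain ⟨C, ε, hε, h⟩ := hcon (γ + 1)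
      obtain ⟨a, ha, hat, haε, hlog⟩ : ∃ a : ℝ, 0 < a ∧ a ≤ ‖t‖ ∧ a < ε ∧
          Real.log a + C ≤ B - γ * Real.log b := by
        have h1 : ∀ᶠ a in 𝓝[>] (0 : ℝ), Real.log a < B - γ * Real.log b - C :=
          Real.tendsto_log_nhdsGT_zero.eventually_lt_atBot _
        have h2 : ∀ᶠ a in 𝓝[>] (0 : ℝ), a ∈ Set.Ioo 0 (min ‖t‖ ε) :=
          Ioo_mem_nhdsGT (lt_min ht0' hε)
        obtain ⟨a, h3, h4⟩ := (h1.and h2).exists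
        exact ⟨a, h4.1, (h4.2.trans_le (min_le_left _ _)).le, h4.2.trans_le (min_le_right _ _),
          by linarith⟩
      refine hu.le_of_annulus ha hsub ?_ hat htb.le
      rintro w (hw | hw)
      · refine (h w (hw ▸ ha) (hw ▸ haε)).trans (EReal.coe_le_coe_iff.2 ?_)
        rw [hw]
        linarith
      · refine (hB w hw.le).trans (EReal.coe_le_coe_iff.2 ?_)
        rw [hw]
        linarith
    have hlt : Real.log ‖t‖ - Real.log b < 0 := sub_neg.2 (Real.log_lt_log ht0' htb)
    refine (EReal.eq_bot_iff_forall_lt _).2 fun y => ?_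
    refine (key ((y - 1 - B - b ^ 2) / (Real.log ‖t‖ - Real.log b))).trans_lt
      (EReal.coe_lt_coe_iff.2 ?_)
    have := div_mul_cancel₀ (y - 1 - B - b ^ 2) hlt.ne
    linarith
  obtain ⟨z, hz, hz'⟩ := hu.exists_ne_bot
  rw [mem_ball_zero_iff] at hz
  rcases eq_or_ne z 0 with rfl | hz0
  · refine hz' ((EReal.eq_bot_iff_forall_lt _).2 fun y => ?_)
    obtain ⟨s, hs, hsR⟩ := exists_between ((norm_nonneg (0 : ℂ)).trans_lt hz)
    have h1 := hu.le_mean 0 s hs (Metric.closedBall_subset_ball hsR)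
    refine (h1.trans (circleMean_le_circleAverage (g := fun _ => y - 1) hs
      (circleIntegrable_const _ _ _) fun w hw => ?_)).trans_lt ?_
    · rw [mem_sphere_zero_iff_norm] at hw
      rw [hbot w (norm_pos_iff.1 (hw ▸ hs)) (hw ▸ hsR)]
      exact bot_le
    · rw [Real.circleAverage_const]
      exact EReal.coe_lt_coe_iff.2 (by linarith)
  · exact hz' (hbot z hz0 hz)

lemma IsSubharmonicOn.mono_ball {u : ℂ → EReal} {R R' : ℝ}
    (hu : IsSubharmonicOn u (Metric.ball 0 R')) (hR : 0 < R) (hRR' : R ≤ R') :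
    IsSubharmonicOn u (Metric.ball 0 R) := by
  have hsub : Metric.ball (0 : ℂ) R ⊆ Metric.ball 0 R' := Metric.ball_subset_ball hRR'
  refine ⟨hu.usc.mono hsub, fun z hz => hu.lt_top z (hsub hz), ?_,
    fun z s hs h => hu.le_mean z s hs (h.trans hsub)⟩
  obtain ⟨γ, h⟩ := hu.exists_not_le
  obtain ⟨t, -, h1, h2⟩ := h 0 R hR
  exact ⟨t, mem_ball_zero_iff.2 h1, (bot_le.trans_lt h2).ne'⟩

lemma restrictDisk_mem_SHLog {R R' : ℝ} (hR : 0 < R) (hRR' : R < R') {f : PuncturedDisk R' → EReal}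
    (hf : f ∈ SHLog R') : restrictDisk hRR' f ∈ SHLog R := by
  obtain ⟨u, hu, c, h⟩ := hf
  exact ⟨u, hu.mono_ball hR hRR'.le, c, fun t => h _⟩

/-! ### Generalized Lelong numbers -/

section Lelong

variable {R : ℝ} {f : PuncturedDisk R → EReal}

lemma exists_le_of_lt_lelong {γ : ℝ} (h : (γ : EReal) < lelong f) :
    ∃ C ε : ℝ, 0 < ε ∧ ∀ t : PuncturedDisk R, ‖(t : ℂ)‖ < ε →
      f t ≤ ((γ * Real.log ‖(t : ℂ)‖ + C : ℝ) : EReal) := by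
  obtain ⟨⟨γ', C, ε, hε, hf⟩, hγ⟩ := lt_iSup_iff.1 h
  refine ⟨C, min ε 1, lt_min hε one_pos, fun t ht => ?_⟩
  refine (hf t (ht.trans_le (min_le_left _ _))).trans (EReal.coe_le_coe_iff.2 ?_)
  have h1 : Real.log ‖(t : ℂ)‖ ≤ 0 := Real.log_nonpos t.2.1.le (ht.trans_le (min_le_right _ _)).le
  have h2 : γ ≤ γ' := (EReal.coe_lt_coe_iff.1 hγ).le
  nlinarith

/-- A function which is smaller near the origin has a larger Lelong number. The radii of the two
disks may differ, as only the germs at the origin matter. -/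
lemma lelong_anti {R' : ℝ} {g : PuncturedDisk R' → EReal} {δ : ℝ} (hδ : 0 < δ)
    (h : ∀ (t : ℂ) (h1 : 0 < ‖t‖ ∧ ‖t‖ < R) (h2 : 0 < ‖t‖ ∧ ‖t‖ < R'), ‖t‖ < δ →
      f ⟨t, h1⟩ ≤ g ⟨t, h2⟩) (hR : 0 < R') : lelong g ≤ lelong f := by
  refine iSup_le ?_
  rintro ⟨γ, C, ε, hε, hg⟩
  refine le_iSup (fun γ : {γ : ℝ // ∃ C ε : ℝ, 0 < ε ∧ ∀ t : PuncturedDisk R,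
      ‖(t : ℂ)‖ < ε → f t ≤ ((γ * Real.log ‖(t : ℂ)‖ + C : ℝ) : EReal)} => ((γ : ℝ) : EReal))
    ⟨γ, C, min ε (min δ R'), lt_min hε (lt_min hδ hR), fun t ht => ?_⟩
  have h1 := ht.trans_le (min_le_left _ _)
  have h2 := ht.trans_le ((min_le_right _ _).trans (min_le_left _ _))
  have h3 := ht.trans_le ((min_le_right _ _).trans (min_le_right _ _))
  exact (h t t.2 ⟨t.2.1, h3⟩ h2).trans (hg ⟨t, t.2.1, h3⟩ h1)

/-- The generalized Lelong number of a function in `SH(𝔻_R) + ℝ log |t|` is finite. -/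
lemma exists_lelong_eq_coe (hf : f ∈ SHLog R) : ∃ ν : ℝ, lelong f = (ν : EReal) := by
  obtain ⟨u, hu, c, hfu⟩ := hf
  have hR : 0 < R := by
    obtain ⟨z, hz, -⟩ := hu.exists_ne_bot
    exact Metric.pos_of_mem_ball hz
  suffices h : lelong f ≠ ⊤ ∧ lelong f ≠ ⊥ from ⟨_, (EReal.coe_toReal h.1 h.2).symm⟩
  constructor
  · intro htop
    obtain ⟨γ, hγ⟩ := hu.exists_not_le
    obtain ⟨C, ε, hε, h⟩ := exists_le_of_lt_lelong (f := f) (γ := γ + c)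
      (by rw [htop]; exact EReal.coe_lt_top _)
    obtain ⟨t, ht0, ht, hlt⟩ := hγ C (min ε R) (lt_min hε hR)
    have h1 := h ⟨t, ht0, ht.trans_le (min_le_right _ _)⟩ (ht.trans_le (min_le_left _ _))
    rw [hfu] at h1
    simp only at h1
    have h2 : ((γ * Real.log ‖t‖ + C : ℝ) : EReal) + ((c * Real.log ‖t‖ : ℝ) : EReal) <
        u t + ((c * Real.log ‖t‖ : ℝ) : EReal) := (addIso (c * Real.log ‖t‖)).strictMono hlt
    rw [← EReal.coe_add] at h2
    refine (h2.trans_le h1).ne ?_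
    congr 1
    ring
  · obtain ⟨b, hb, hbR⟩ := exists_between hR
    have hsub : Metric.closedBall (0 : ℂ) b ⊆ Metric.ball 0 R := Metric.closedBall_subset_ball hbR
    obtain ⟨x, hxb, hx⟩ := (hu.usc.mono hsub).exists_isMaxOn
      ⟨0, mem_closedBall_zero_iff.2 (by simpa using hb.le)⟩ (isCompact_closedBall _ _)
    have h1 : ((c : ℝ) : EReal) ≤ lelong f :=
      le_iSup (fun γ : {γ : ℝ // ∃ C ε : ℝ, 0 < ε ∧ ∀ t : PuncturedDisk R, ‖(t : ℂ)‖ < ε →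
        f t ≤ ((γ * Real.log ‖(t : ℂ)‖ + C : ℝ) : EReal)} => ((γ : ℝ) : EReal))
        ⟨c, (u x).toReal, b, hb, fun t ht => by
          rw [hfu, EReal.coe_add, add_comm]
          gcongr
          exact (hx (mem_closedBall_zero_iff.2 ht.le)).trans
            (EReal.le_coe_toReal (hu.lt_top x (hsub hxb)).ne)⟩
    exact ((EReal.bot_lt_coe c).trans_le h1).ne'

end Lelong

/-! ### Truncated subharmonic functions -/

/-- Truncation from below: if `v = u + κ log |t|`, with `u` subharmonic, is bounded above by `-N`
near the origin, then `max v (-N)` is a bounded function satisfying the sub-mean value inequality on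
small circles, including those around the origin. It is cut off outside a smaller disk. -/
lemma IsSubharmonicOn.exists_truncation {u : ℂ → EReal} {R R' κ N ε : ℝ}
    (hu : IsSubharmonicOn u (Metric.ball 0 R')) (hRR' : R < R') (hε : 0 < ε)
    (h0 : ∀ w : ℂ, 0 < ‖w‖ → ‖w‖ < ε → ‖w‖ < R' →
      u w + ((κ * Real.log ‖w‖ : ℝ) : EReal) ≤ ((-N : ℝ) : EReal)) :
    ∃ (G : ℂ → ℝ) (M : ℝ), Measurable G ∧ (∀ w, |G w| ≤ M) ∧ (∀ w, R < ‖w‖ → G w = 0) ∧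
      (∀ w, ‖w‖ < R → UpperSemicontinuousAt G w) ∧
      (∀ w, ‖w‖ < ε → ‖w‖ < R → G w = -N) ∧
      (∀ w, 0 < ‖w‖ → ‖w‖ < R →
        (G w : EReal) = max (u w + ((κ * Real.log ‖w‖ : ℝ) : EReal)) ((-N : ℝ) : EReal)) ∧
      ∀ w ρ, 0 < ρ → ρ < ε → ‖w‖ + ρ < R → G w ≤ Real.circleAverage G w ρ := by
  set v : ℂ → EReal := fun w => u w + ((κ * Real.log ‖w‖ : ℝ) : EReal) with hv
  set g : ℂ → ℝ := fun w => if ‖w‖ < ε then -N else (max (v w) ((-N : ℝ) : EReal)).toReal with hg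
  have hvtop : ∀ w : ℂ, ‖w‖ < R' → v w < ⊤ := fun w hw =>
    EReal.add_lt_top (hu.lt_top w (mem_ball_zero_iff.2 hw)).ne (EReal.coe_ne_top _)
  have hgv : ∀ w, 0 < ‖w‖ → ‖w‖ < R' → (g w : EReal) = max (v w) ((-N : ℝ) : EReal) := by
    intro w hw0 hwR
    simp only [hg]
    split_ifs with h
    · rw [max_eq_right (h0 w hw0 h hwR)]
    · refine EReal.coe_toReal (max_lt (hvtop w hwR) (EReal.coe_lt_top _)).ne ?_
      exact ((EReal.bot_lt_coe _).trans_le (le_max_right _ _)).ne'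
  have hgN : ∀ w, ‖w‖ < R' → -N ≤ g w := by
    intro w hwR
    rcases eq_or_ne w 0 with rfl | hw
    · simp [hg, hε]
    · rw [← EReal.coe_le_coe_iff, hgv w (norm_pos_iff.2 hw) hwR]
      exact le_max_right _ _
  have husc : ∀ w, ‖w‖ < R' → UpperSemicontinuousAt g w := by
    intro w hwR y hy
    rcases eq_or_ne w 0 with rfl | hw
    · filter_upwards [Metric.ball_mem_nhds (0 : ℂ) hε] with x hx
      have h1 : g x = g 0 := by
        simp [hg, hε, mem_ball_zero_iff.1 hx]
      rwa [h1]
    · have hw0 := norm_pos_iff.2 hw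
      rw [← EReal.coe_lt_coe_iff, hgv w hw0 hwR, max_lt_iff] at hy
      have hopen : IsOpen (Metric.ball (0 : ℂ) R' \ {0}) :=
        Metric.isOpen_ball.sdiff isClosed_singleton
      have hvusc : UpperSemicontinuousOn v (Metric.ball (0 : ℂ) R' \ {0}) := by
        refine UpperSemicontinuousOn.add' (hu.usc.mono Set.sdiff_subset) ?_ fun x hx => ?_
        · refine (continuous_coe_real_ereal.comp_continuousOn
            (continuousOn_const.mul (continuous_norm.continuousOn.log ?_))).upperSemicontinuousOn
          exact fun x hx => norm_ne_zero_iff.2 hx.2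
        · exact EReal.continuousAt_add (Or.inr (EReal.coe_ne_bot _)) (Or.inr (EReal.coe_ne_top _))
      have hmem : w ∈ Metric.ball (0 : ℂ) R' \ {0} := ⟨mem_ball_zero_iff.2 hwR, hw⟩
      have h1 := hvusc w hmem y hy.1
      rw [hopen.nhdsWithin_eq hmem] at h1
      filter_upwards [h1, hopen.mem_nhds hmem] with x hx hxm
      rw [← EReal.coe_lt_coe_iff, hgv x (norm_pos_iff.2 hxm.2) (mem_ball_zero_iff.1 hxm.1)]
      exact max_lt hx hy.2
  obtain ⟨C, hC⟩ : ∃ C, ∀ w, ‖w‖ ≤ R → g w ≤ C := by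
    have h1 : UpperSemicontinuousOn g (Metric.closedBall 0 R) := fun w hw =>
      (husc w ((mem_closedBall_zero_iff.1 hw).trans_lt hRR')).upperSemicontinuousWithinAt _
    obtain ⟨C, hC⟩ := h1.bddAbove_of_isCompact (isCompact_closedBall _ _)
    exact ⟨C, fun w hw => hC ⟨w, mem_closedBall_zero_iff.2 hw, rfl⟩⟩
  set G : ℂ → ℝ := (Metric.ball (0 : ℂ) R).indicator g with hG
  have hGg : ∀ w, ‖w‖ < R → G w = g w := fun w hw =>
    Set.indicator_of_mem (mem_ball_zero_iff.2 hw) _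
  have hG0 : ∀ w, ¬ ‖w‖ < R → G w = 0 := fun w hw =>
    Set.indicator_of_notMem (fun h => hw (mem_ball_zero_iff.1 h)) _
  have hM : ∀ w, |G w| ≤ max |N| |C| := by
    intro w
    by_cases hw : ‖w‖ < R
    · rw [hGg w hw]
      simpa using abs_le_max_abs_abs (hgN w (hw.trans hRR')) (hC w hw.le)
    · rw [hG0 w hw, abs_zero]
      exact (abs_nonneg _).trans (le_max_left _ _)
  have hmeas : Measurable G := by
    refine measurable_of_Iio fun y => ?_
    have h1 : G ⁻¹' Set.Iio y = (Metric.ball (0 : ℂ) R ∩ {w | g w < y}) ∪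
        ((Metric.ball (0 : ℂ) R)ᶜ ∩ {_w | 0 < y}) := by
      ext w
      by_cases hw : ‖w‖ < R
      · simp [hGg w hw, hw]
      · simp [hG0 w hw, hw]
    rw [h1]
    refine MeasurableSet.union (IsOpen.measurableSet ?_)
      (Metric.isOpen_ball.measurableSet.compl.inter (MeasurableSet.const _))
    refine isOpen_iff_mem_nhds.2 fun w hw => ?_
    filter_upwards [Metric.isOpen_ball.mem_nhds hw.1,
      husc w ((mem_ball_zero_iff.1 hw.1).trans hRR') y hw.2] with x h1 h2 using ⟨h1, h2⟩
  refine ⟨G, _, hmeas, hM, fun w hw => hG0 w hw.le.not_gt, fun w hw => ?_, fun w hw hwR => ?_,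
    fun w hw hwR => ?_, fun w ρ hρ hρε hwρ => ?_⟩
  · intro y hy
    rw [hGg w hw] at hy
    filter_upwards [husc w (hw.trans hRR') y hy, Metric.isOpen_ball.mem_nhds
      (mem_ball_zero_iff.2 hw)] with x h1 h2
    rwa [hGg x (mem_ball_zero_iff.1 h2)]
  · rw [hGg w hwR]
    simp [hg, hw]
  · rw [hGg w hwR]
    exact hgv w hw (hwR.trans hRR')
  · have hwR : ‖w‖ < R := by linarith
    have hsph : ∀ x ∈ Metric.sphere w ρ, ‖x‖ < R := fun x hx => by
      have h1 := norm_sub_norm_le x w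
      rw [mem_sphere_iff_norm.1 hx] at h1
      linarith
    have hGi := circleIntegrable_of_bounded hmeas hM w ρ
    by_cases hwN : G w ≤ -N
    · refine hwN.trans ?_
      rw [← Real.circleAverage_const (-N) w ρ]
      refine Real.circleAverage_mono (circleIntegrable_const _ _ _) hGi fun x hx => ?_
      rw [abs_of_pos hρ] at hx
      rw [hGg x (hsph x hx)]
      exact hgN x ((hsph x hx).trans hRR')
    · push Not at hwN
      rw [hGg w hwR] at hwN ⊢
      have hεw : ε ≤ ‖w‖ := by
        by_contra! h
        simp [hg, h] at hwN
      have hw0 : 0 < ‖w‖ := hε.trans_le hεw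
      have hgw := hgv w hw0 (hwR.trans hRR')
      rw [max_eq_left_of_lt] at hgw
      swap
      · by_contra! h
        rw [max_eq_right h, EReal.coe_eq_coe_iff] at hgw
        linarith
      obtain ⟨hi1, ha1⟩ := circleAverage_log_norm_eq hρ (hρε.trans_le hεw)
      have hi2 : CircleIntegrable (fun x : ℂ => κ * Real.log ‖x‖) w ρ := hi1.const_mul κ
      have hsub : Metric.closedBall w ρ ⊆ Metric.ball 0 R' := fun x hx => by
        have h1 := norm_sub_norm_le x w
        rw [mem_closedBall_iff_norm] at hx
        rw [mem_ball_zero_iff]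
        linarith
      have h1 := (hu.le_mean w ρ hρ hsub).trans
        (circleMean_le_circleAverage (g := fun x => G x - κ * Real.log ‖x‖) hρ (hGi.sub hi2)
          fun x hx => ?_)
      · have e1 : Real.circleAverage (fun x : ℂ => κ * Real.log ‖x‖) w ρ = κ * Real.log ‖w‖ := by
          rw [← ha1]
          simp only [← smul_eq_mul, Real.circleAverage_fun_smul]
        rw [Real.circleAverage_fun_sub hGi hi2, e1] at h1
        rw [← EReal.coe_le_coe_iff, hgw, hv]
        refine ((addIso (κ * Real.log ‖w‖)).monotone h1).trans_eq ?_
        rw [addIso_apply, ← EReal.coe_add, sub_add_cancel]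
      · have hx0 : 0 < ‖x‖ := by
          have h2 := norm_sub_norm_le w x
          rw [norm_sub_rev, mem_sphere_iff_norm.1 hx] at h2
          linarith
        rw [EReal.coe_sub]
        refine (EReal.le_sub_iff_add_le (Or.inl (EReal.coe_ne_bot _))
          (Or.inl (EReal.coe_ne_top _))).2 ?_
        rw [hGg x (hsph x hx), hgv x hx0 ((hsph x hx).trans hRR')]
        exact le_max_left _ _

/-- On a compact set, an upper semicontinuous function lying strictly below a lower semicontinuous
one does so uniformly, also after moving its argument by a small amount. -/
lemma eventually_add_le_of_lt {G H : ℂ → ℝ} {K : Set ℂ} (hK : IsCompact K)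
    (hG : ∀ z ∈ K, UpperSemicontinuousAt G z) (hH : LowerSemicontinuousOn H K)
    (hlt : ∀ z ∈ K, G z < H z) :
    ∀ᶠ s in 𝓝[>] (0 : ℝ), ∀ z ∈ K, ∀ w, ‖z - w‖ < s → G w + 2 * s ≤ H z := by
  have key : ∀ᶠ s in 𝓝 (0 : ℝ), ∀ z ∈ K, z ∈ K → ∀ w, ‖z - w‖ < s → G w + 2 * s ≤ H z := by
    refine hK.eventually_forall_of_forall_eventually fun y hy => ?_
    obtain ⟨a, ha1, ha2⟩ := exists_between (hlt y hy)
    obtain ⟨b, hb1, hb2⟩ := exists_between ha2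
    obtain ⟨δ, hδ, h1⟩ := Metric.eventually_nhds_iff_ball.1 (hG y hy a ha1)
    have h2 : ∀ᶠ z in 𝓝 y, z ∈ K → b < H z :=
      eventually_nhdsWithin_iff.1 (hH y hy b hb2)
    have h3 : ∀ᶠ s in 𝓝 (0 : ℝ), s < min (δ / 2) ((b - a) / 2) :=
      Iio_mem_nhds (lt_min (by positivity) (by linarith))
    have h4 : ∀ᶠ z in 𝓝 y, z ∈ Metric.ball y (δ / 2) := Metric.ball_mem_nhds y (half_pos hδ)
    rw [nhds_prod_eq]
    filter_upwards [h3.prod_inl (𝓝 y), h2.prod_inr (𝓝 (0 : ℝ)), h4.prod_inr (𝓝 (0 : ℝ))]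
    rintro ⟨s, z⟩ hs hz hzy hzK w hw
    simp only at hs hz hzy hzK hw
    have hs1 := hs.trans_le (min_le_left _ _)
    have hs2 := hs.trans_le (min_le_right _ _)
    have hwy : w ∈ Metric.ball y δ := by
      have := dist_triangle w z y
      rw [dist_comm w z, dist_eq_norm z w] at this
      rw [Metric.mem_ball] at hzy ⊢
      linarith
    linarith [h1 w hwy, hz hzK]
  filter_upwards [nhdsWithin_le_nhds key] with s hs z hz w hw using hs z hz hz w hw

/-! ### Constructions of tropical Fubini–Study functions -/

section FubiniStudy

variable {A : Type*} [CommRing A] [Norm A]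

/-- The kernel of a point of a Berkovich spectrum, as a point of the prime spectrum. -/
def BerkovichSpectrum.ker (x : BerkovichSpectrum A) : PrimeSpectrum A where
  asIdeal :=
    { carrier := {f | x.eval f = 0}
      add_mem' := fun {f g} (hf : x.eval f = 0) (hg : x.eval g = 0) =>
        le_antisymm ((x.eval_add_le f g).trans (by rw [hf, hg, add_zero])) (x.eval_nonneg _)
      zero_mem' := x.eval_zero
      smul_mem' := fun f g (hg : x.eval g = 0) => by
        simp only [Set.mem_ofPred_eq, smul_eq_mul, x.eval_mul, hg, mul_zero] }
  isPrime := by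
    refine ⟨fun h => ?_, fun {f g} h => ?_⟩
    · have h1 : x.eval 1 = 0 := (Ideal.eq_top_iff_one _).1 h
      exact one_ne_zero (x.eval_one.symm.trans h1)
    · have h1 : x.eval (f * g) = 0 := h
      rw [x.eval_mul] at h1
      exact mul_eq_zero.1 h1

lemma IsTropicalFS.ne_bot {φ : BerkovichSpectrum A → EReal} (hφ : IsTropicalFS φ)
    (x : BerkovichSpectrum A) : φ x ≠ ⊥ := by
  obtain ⟨m, k, f, c, -, hf, h⟩ := isTropicalFS_iff.1 hφ
  obtain ⟨j, hj⟩ := hf x.ker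
  have h0 : 0 < x.eval (f j) := lt_of_le_of_ne (x.eval_nonneg _) (Ne.symm hj)
  have h1 := le_iSup (fun j => elog (x.eval (f j) ^ (m : ℝ)⁻¹ * Real.exp (c j))) j
  rw [← h, elog_of_pos (by positivity)] at h1
  exact ((EReal.bot_lt_coe _).trans_le h1).ne'

lemma IsTropicalFS.max {φ ψ : BerkovichSpectrum A → EReal} (hφ : IsTropicalFS φ)
    (hψ : IsTropicalFS ψ) : IsTropicalFS fun x => Max.max (φ x) (ψ x) := by
  obtain ⟨m, k, f, c, hm, hf, h⟩ := isTropicalFS_iff.1 hφ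
  obtain ⟨n, l, g, d, hn, hg, h'⟩ := isTropicalFS_iff.1 hψ
  refine isTropicalFS_iff.2 ⟨m * n, k + l, Fin.append (fun i => f i ^ n) (fun i => g i ^ m),
    Fin.append c d, Nat.mul_pos hm hn, fun p => ?_, fun x => ?_⟩
  · obtain ⟨j, hj⟩ := hf p
    refine ⟨Fin.castAdd l j, ?_⟩
    rw [Fin.append_left]
    exact fun hp => hj (p.isPrime.mem_of_pow_mem _ hp)
  · have hm' : (m : ℝ) ≠ 0 := by positivity
    have hn' : (n : ℝ) ≠ 0 := by positivity
    have e1 : ∀ y : ℝ, 0 ≤ y → (y ^ n) ^ ((m * n : ℕ) : ℝ)⁻¹ = y ^ (m : ℝ)⁻¹ := fun y hy => by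
      rw [← Real.rpow_natCast, ← Real.rpow_mul hy]
      congr 1
      push_cast
      field_simp
    have e2 : ∀ y : ℝ, 0 ≤ y → (y ^ m) ^ ((m * n : ℕ) : ℝ)⁻¹ = y ^ (n : ℝ)⁻¹ := fun y hy => by
      rw [← Real.rpow_natCast, ← Real.rpow_mul hy]
      congr 1
      push_cast
      field_simp
    rw [h, h', ← finSumFinEquiv.iSup_comp, iSup_sum]
    simp only [finSumFinEquiv_apply_left, finSumFinEquiv_apply_right, Fin.append_left,
      Fin.append_right, BerkovichSpectrum.eval_pow, e1 _ (x.eval_nonneg _),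
      e2 _ (x.eval_nonneg _)]

end FubiniStudy

lemma elog_lt_elog {x y : ℝ} (hxy : x < y) (hy : 0 < y) : elog x < elog y :=
  ENNReal.log_strictMono ((ENNReal.ofReal_lt_ofReal_iff hy).2 hxy)

lemma tau_injective : Function.Injective (tau : Metric.closedBall (0 : ℂ) r → HybridCircle r) := by
  have key : ∀ s t : Metric.closedBall (0 : ℂ) r, (s : ℂ) ≠ 0 → tau s = tau t → s = t := by
    intro s t hs h
    have hsr := mem_closedBall_zero_iff.1 s.2
    have h1 : (tau s).eval (hybX - hybC (s : ℂ)) = 0 := by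
      rw [tau_eval_of_ne hs, evalAt_hybX_sub hs hsr, sub_self, norm_zero,
        Real.zero_rpow (hybExp_pos hs hsr).ne']
    by_cases ht : (t : ℂ) = 0
    · exfalso
      have h2 : tau t = adicPoint := by rw [tau, dif_pos ht]
      rw [h, h2] at h1
      exact hybX_sub_hybC_ne_zero hs (adicPoint_isZariskiDense _ h1)
    · have htr := mem_closedBall_zero_iff.1 t.2
      rw [h, tau_eval_of_ne ht, evalAt_hybX_sub ht htr,
        Real.rpow_eq_zero (norm_nonneg _) (hybExp_pos ht htr).ne', norm_eq_zero] at h1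
      exact Subtype.ext (sub_eq_zero.1 h1).symm
  intro s t h
  by_cases hs : (s : ℂ) = 0
  · by_cases ht : (t : ℂ) = 0
    · exact Subtype.ext (hs.trans ht.symm)
    · exact (key t s ht h.symm).symm
  · exact key s t hs h

lemma adicPoint_eval_hybPoly_le (P : Polynomial ℂ) :
    (adicPoint : HybridCircle r).eval (hybPoly P) ≤ 1 := by
  have hC : ∀ a : ℂ, (adicPoint : HybridCircle r).eval (hybC a) ≤ 1 := by
    intro a
    rcases eq_or_ne a 0 with rfl | ha
    · rw [map_zero, BerkovichSpectrum.eval_zero]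
      exact zero_le_one
    · rw [adic_eval, adicAbs_hybC ha]
  have hN : ∀ n : ℕ, (adicPoint : HybridCircle r).eval (n : hybridRing r) ≤ 1 := fun n => by
    rw [← map_natCast hybC]
    exact hC n
  induction P using Polynomial.induction_on' with
  | add p q hp hq =>
    rw [map_add]
    exact (BerkovichSpectrum.eval_add_le_max _ hN _ _).trans (max_le hp hq)
  | monomial n a =>
    rw [← Polynomial.C_mul_X_pow_eq_monomial, map_mul, map_pow, hybPoly_C, hybPoly_X,
      BerkovichSpectrum.eval_mul, BerkovichSpectrum.eval_pow, eval_hybX]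
    exact mul_le_one₀ (hC a) (pow_nonneg r.2.1.le _) (pow_le_one₀ r.2.1.le r.2.2.le)

/-- The function `γ log |t| + max (m⁻¹ log |P|, -N)` defines a tropical Fubini–Study function on the
hybrid circle. The real number `γ` need not be rational: as `|t|_x = r` at all points, the term
`γ log |t|` enters through the constants `c_j = γ log r` only. -/
lemma isTropicalFS_polynomial {m : ℕ} (hm : 1 ≤ m) (P : Polynomial ℂ) (N γ : ℝ) :
    IsTropicalFS fun x : HybridCircle r =>
      Max.max (elog (x.eval (hybPoly P) ^ (m : ℝ)⁻¹ * Real.exp (γ * Real.log r)))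
        (elog (x.eval (hybC (Real.exp (-(m * N)) : ℂ)) ^ (m : ℝ)⁻¹ *
          Real.exp (γ * Real.log r))) := by
  refine isTropicalFS_iff.2 ⟨m, 2, ![hybPoly P, hybC (Real.exp (-(m * N)) : ℂ)],
    fun _ => γ * Real.log r, hm, fun p => ⟨1, ?_⟩, fun x => ?_⟩
  · have h1 : IsUnit (hybC (Real.exp (-(m * N)) : ℂ) : hybridRing r) :=
      (IsUnit.mk0 _ (by exact_mod_cast (Real.exp_pos _).ne')).map hybC
    exact fun h => p.isPrime.ne_top (Ideal.eq_top_of_isUnit_mem _ h h1)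
  · rw [← Finset.sup_univ_eq_iSup]
    simp [Fin.univ_succ]

/-! ### The function on the hybrid circle defined by a function on a larger disk -/

section Extend

variable {r' : ℝ}

open Classical in
/-- The function on the hybrid circle whose value at `τ t` is `f(t) / log_r |t|` for `t ≠ 0`, and
whose value at `τ 0` is the Lelong number of `f` times `log r`. -/
noncomputable def extendDisk (h : (r : ℝ) < r') (f : PuncturedDisk r' → EReal) :
    HybridCircle r → EReal := fun x =>
  let t := Function.surjInv tau_surjective x
  if ht : (t : ℂ) = 0 then ((Real.log r : ℝ) : EReal) * lelong f
  else f ⟨t, norm_pos_iff.2 ht, (mem_closedBall_zero_iff.1 t.2).trans_lt h⟩ /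
    ((Real.logb r ‖(t : ℂ)‖ : ℝ) : EReal)

variable (h : (r : ℝ) < r') (f : PuncturedDisk r' → EReal)

lemma surjInv_tau (t : Metric.closedBall (0 : ℂ) r) :
    Function.surjInv tau_surjective (tau t) = t :=
  tau_injective (Function.surjInv_eq tau_surjective _)

lemma extendDisk_tau {t : Metric.closedBall (0 : ℂ) r} (ht : 0 < ‖(t : ℂ)‖) :
    extendDisk h f (tau t) = f ⟨t, ht, (mem_closedBall_zero_iff.1 t.2).trans_lt h⟩ /
      ((Real.logb r ‖(t : ℂ)‖ : ℝ) : EReal) := by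
  simp only [extendDisk, surjInv_tau]
  rw [dif_neg (norm_pos_iff.1 ht)]

lemma extendDisk_tau_zero {t : Metric.closedBall (0 : ℂ) r} (ht : (t : ℂ) = 0) :
    extendDisk h f (tau t) = ((Real.log r : ℝ) : EReal) * lelong f := by
  simp only [extendDisk, surjInv_tau]
  rw [dif_pos ht]

variable {f}

lemma coe_logb_pos {t : ℂ} (ht0 : t ≠ 0) (ht : ‖t‖ ≤ r) :
    (0 : EReal) < ((Real.logb r ‖t‖ : ℝ) : EReal) := by
  exact_mod_cast logb_pos ht0 ht

/-- Upper semicontinuity of the extension; at `0` it follows from the definition of the Lelong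
number. -/
lemma upperSemicontinuous_extendDisk (hf : f ∈ SHLog r') :
    UpperSemicontinuous fun t : Metric.closedBall (0 : ℂ) r => extendDisk h f (tau t) := by
  have hlog : Real.log r < 0 := Real.log_neg r.2.1 r.2.2
  intro t y hy
  obtain ⟨a, hta, hay⟩ := EReal.lt_iff_exists_real_btwn.1 hy
  beta_reduce at hta
  by_cases ht : (t : ℂ) = 0
  · rw [extendDisk_tau_zero h f ht] at hta
    obtain ⟨ν, hν⟩ := exists_lelong_eq_coe hf
    rw [hν, ← EReal.coe_mul, EReal.coe_lt_coe_iff] at hta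
    -- a slope `γ < ν` for which still `γ log r < a`
    obtain ⟨γ, haγ, hγν⟩ : ∃ γ, a / Real.log r < γ ∧ γ < ν := exists_between (by
      rwa [div_lt_iff_of_neg hlog, mul_comm])
    rw [div_lt_iff_of_neg hlog] at haγ
    obtain ⟨C, ε, hε, hC⟩ := exists_le_of_lt_lelong (f := f) (γ := γ)
      (by rw [hν]; exact EReal.coe_lt_coe_iff.2 hγν)
    have h1 : ContinuousWithinAt (fun z => γ * Real.log r + C * hybExp r z)
        (Metric.closedBall 0 r) 0 :=
      continuousWithinAt_const.add (continuousWithinAt_const.mul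
        (continuousOn_hybExp 0 (Metric.mem_closedBall_self r.2.1.le)))
    have h2 := h1.eventually_lt_const (show γ * Real.log r + C * hybExp r 0 < a by
      rw [hybExp_zero, mul_zero, add_zero]; exact haγ)
    replace h2 : ∀ᶠ z : ℂ in 𝓝 t, z ∈ Metric.closedBall (0 : ℂ) r →
        γ * Real.log r + C * hybExp r z < a := by
      rw [ht]
      exact eventually_nhdsWithin_iff.1 h2
    have h3 : ∀ᶠ z : ℂ in 𝓝 t, z ∈ Metric.ball (0 : ℂ) ε := by
      rw [ht]; exact Metric.ball_mem_nhds 0 hε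
    filter_upwards [(continuous_subtype_val.tendsto t).eventually (h2.and h3)] with s hs
    rcases eq_or_ne (s : ℂ) 0 with hs0 | hs0
    · rw [extendDisk_tau_zero h f hs0, hν, ← EReal.coe_mul]
      exact (EReal.coe_lt_coe_iff.2 hta).trans hay
    · have hsr := mem_closedBall_zero_iff.1 s.2
      rw [extendDisk_tau h f (norm_pos_iff.2 hs0)]
      have h4 := hC ⟨s, norm_pos_iff.2 hs0, hsr.trans_lt h⟩ (mem_ball_zero_iff.1 hs.2)
      refine lt_of_le_of_lt (EReal.div_le_div_right_of_nonneg (coe_logb_pos hs0 hsr).le h4) ?_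
      refine lt_trans ?_ hay
      rw [← EReal.coe_div, EReal.coe_lt_coe_iff]
      refine lt_of_eq_of_lt ?_ (hs.1 s.2)
      have h5 : Real.log ‖(s : ℂ)‖ ≠ 0 :=
        (Real.log_neg (norm_pos_iff.2 hs0) (hsr.trans_lt r.2.2)).ne
      have := hlog.ne
      rw [Real.logb, hybExp]
      field_simp
  · obtain ⟨u, hu, c, hfu⟩ := hf
    have htr := mem_closedBall_zero_iff.1 t.2
    have hopen : IsOpen (Metric.ball (0 : ℂ) r' \ {0}) :=
      Metric.isOpen_ball.sdiff isClosed_singleton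
    have husc : UpperSemicontinuousOn (fun z => u z +
        ((c * Real.log ‖z‖ - a * Real.logb r ‖z‖ : ℝ) : EReal)) (Metric.ball (0 : ℂ) r' \ {0}) := by
      refine UpperSemicontinuousOn.add' (hu.usc.mono Set.sdiff_subset) ?_ fun x hx => ?_
      · have h1 : ContinuousOn (fun z : ℂ => Real.log ‖z‖) (Metric.ball (0 : ℂ) r' \ {0}) :=
          continuous_norm.continuousOn.log fun x hx => norm_ne_zero_iff.2 hx.2
        exact (continuous_coe_real_ereal.comp_continuousOn ((continuousOn_const.mul h1).sub
          (continuousOn_const.mul (h1.div_const _)))).upperSemicontinuousOn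
      · exact EReal.continuousAt_add (Or.inr (EReal.coe_ne_bot _)) (Or.inr (EReal.coe_ne_top _))
    have hiff : ∀ s : Metric.closedBall (0 : ℂ) r, (s : ℂ) ≠ 0 →
        (extendDisk h f (tau s) < (a : EReal) ↔
          u s + ((c * Real.log ‖(s : ℂ)‖ - a * Real.logb r ‖(s : ℂ)‖ : ℝ) : EReal) < 0) := by
      intro s hs0
      have hsr := mem_closedBall_zero_iff.1 s.2
      rw [extendDisk_tau h f (norm_pos_iff.2 hs0),
        EReal.div_lt_iff (coe_logb_pos hs0 hsr) (EReal.coe_ne_top _), hfu, ← EReal.coe_mul,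
        ← (addIso (-(a * Real.logb r ‖(s : ℂ)‖))).lt_iff_lt, addIso_apply, addIso_apply, add_assoc,
        ← EReal.coe_add, ← EReal.coe_add, add_neg_cancel, EReal.coe_zero, sub_eq_add_neg]
    have hmem : (t : ℂ) ∈ Metric.ball (0 : ℂ) r' \ {0} :=
      ⟨mem_ball_zero_iff.2 (htr.trans_lt h), ht⟩
    have h1 := husc t hmem 0 ((hiff t ht).1 hta)
    rw [hopen.nhdsWithin_eq hmem] at h1
    filter_upwards [(continuous_subtype_val.tendsto t).eventually
      (h1.and (hopen.mem_nhds hmem))] with s hs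
    exact ((hiff s hs.2.2).2 hs.1).trans hay

/-- The core of the approximation: below a continuous function `k` and above the value at one given
point of the extension of `f` there is a tropical Fubini–Study function. -/
lemma exists_tropicalFS_at (hf : f ∈ SHLog r') {k : HybridCircle r → ℝ} (hk : Continuous k)
    (hlt : ∀ x, extendDisk h f x < (k x : EReal)) :
    ∀ x₀, ∃ w : HybridCircle r → EReal, IsTropicalFS w ∧ (∀ x, w x < (k x : EReal)) ∧
      extendDisk h f x₀ < w x₀ := by
  classical
  have hr0 := r.2.1
  have hlog : Real.log r < 0 := Real.log_neg r.2.1 r.2.2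
  obtain ⟨ν, hν⟩ := exists_lelong_eq_coe hf
  obtain ⟨u, hu, c, hfu⟩ := id hf
  have h0mem : (0 : ℂ) ∈ Metric.closedBall (0 : ℂ) (r : ℝ) := Metric.mem_closedBall_self r.2.1.le
  have hν0 : Real.log r * ν < k adicPoint := by
    have := hlt (tau ⟨0, h0mem⟩)
    rwa [extendDisk_tau_zero h f rfl, tau_zero, hν, ← EReal.coe_mul, EReal.coe_lt_coe_iff] at this
  -- slopes `γ < γ' < ν`
  obtain ⟨γ, hkγ, hγν⟩ : ∃ γ, k adicPoint / Real.log r < γ ∧ γ < ν := exists_between (by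
      rwa [div_lt_iff_of_neg hlog, mul_comm])
  rw [div_lt_iff_of_neg hlog] at hkγ
  obtain ⟨γ', hγγ', hγ'ν⟩ := exists_between hγν
  obtain ⟨C, ε, hε, hC⟩ := exists_le_of_lt_lelong (f := f) (γ := γ')
    (by rw [hν]; exact EReal.coe_lt_coe_iff.2 hγ'ν)
  -- the upper bound `k`, as a bound for `f - γ log |t|`
  set K := Metric.closedBall (0 : ℂ) (r : ℝ) with hK
  set k' : ℂ → ℝ := fun z => if hz : z ∈ K then k (tau ⟨z, hz⟩) else 0 with hk'
  have hk'K : ∀ t : K, k' t = k (tau t) := fun t => by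
    simp only [hk']
    rw [dif_pos t.2]
  have hk'c : ContinuousOn k' K := by
    rw [continuousOn_iff_continuous_domRestrict]
    convert! hk.comp continuous_tau using 1
    exact funext hk'K
  set H : ℂ → ℝ := fun z => Real.logb r ‖z‖ * (k' z - γ * Real.log r) with hH
  have hH0 : H 0 = 0 := by simp [hH]
  have hHlsc : LowerSemicontinuousOn H K := by
    intro z hz
    rcases eq_or_ne z 0 with rfl | hz0
    · intro y hy
      rw [hH0] at hy
      have h1 : γ * Real.log r < k' 0 := by
        have := hk'K ⟨0, h0mem⟩
        rw [tau_zero] at this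
        rwa [this]
      filter_upwards [(hk'c 0 h0mem).eventually_const_lt h1, self_mem_nhdsWithin] with x hx hxK
      refine hy.trans_le ?_
      rcases eq_or_ne x 0 with rfl | hx0
      · exact hH0.ge
      · exact mul_nonneg (logb_pos hx0 (mem_closedBall_zero_iff.1 hxK)).le (sub_nonneg.2 hx.le)
    · refine ContinuousWithinAt.lowerSemicontinuousWithinAt ?_
      refine ContinuousWithinAt.mul ?_ ((hk'c z hz).sub continuousWithinAt_const)
      exact ((continuous_norm.continuousAt.log
        (norm_ne_zero_iff.2 hz0)).div_const _).continuousWithinAt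
  have hKc : IsCompact K := isCompact_closedBall _ _
  obtain ⟨N, hN⟩ : ∃ N : ℝ, ∀ z ∈ K, -N < H z := by
    obtain ⟨b, hb⟩ := hHlsc.bddBelow_of_isCompact hKc
    exact ⟨1 - b, fun z hz => by linarith [hb ⟨z, hz, rfl⟩]⟩
  -- the truncation of `f - γ log |t|`
  obtain ⟨δ, hδ, hδN⟩ : ∃ δ > 0, ∀ w : ℂ, 0 < ‖w‖ → ‖w‖ < δ → ‖w‖ < r' →
      u w + (((c - γ) * Real.log ‖w‖ : ℝ) : EReal) ≤ ((-N : ℝ) : EReal) := by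
    have h1 : Tendsto (fun x : ℝ => (γ' - γ) * Real.log x) (𝓝[>] 0) atBot :=
      Real.tendsto_log_nhdsGT_zero.const_mul_atBot (sub_pos.2 hγγ')
    obtain ⟨δ, hδ, h2⟩ := (mem_nhdsGT_iff_exists_Ioo_subset).1
      (h1.eventually_lt_atBot (-N - C))
    refine ⟨min δ ε, lt_min hδ hε, fun w hw0 hw hwr => ?_⟩
    have h3 := hC ⟨w, hw0, hwr⟩ (hw.trans_le (min_le_right _ _))
    have h4 : (γ' - γ) * Real.log ‖w‖ < -N - C := h2 ⟨hw0, hw.trans_le (min_le_left _ _)⟩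
    rw [hfu] at h3
    have h5 := (addIso (-(γ * Real.log ‖w‖))).monotone h3
    rw [addIso_apply, addIso_apply, add_assoc, ← EReal.coe_add, ← EReal.coe_add] at h5
    have e1 : c * Real.log ‖w‖ + -(γ * Real.log ‖w‖) = (c - γ) * Real.log ‖w‖ := by ring
    simp only [e1] at h5
    refine h5.trans (EReal.coe_le_coe_iff.2 ?_)
    linarith
  obtain ⟨R, hrR, hRr'⟩ := exists_between h
  obtain ⟨G, M, hGm, hGM, hGR, hGusc, hGδ, hGmax, hGsub⟩ := hu.exists_truncation hRr' hδ hδN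
  have hKR : ∀ z ∈ K, ‖z‖ < R := fun z hz => (mem_closedBall_zero_iff.1 hz).trans_lt hrR
  have hGH : ∀ z ∈ K, G z < H z := by
    intro z hz
    rcases eq_or_ne z 0 with rfl | hz0
    · rw [hGδ 0 (by simpa using hδ) (hKR 0 hz)]
      exact hN 0 hz
    · have hz0' := norm_pos_iff.2 hz0
      have hzr := mem_closedBall_zero_iff.1 hz
      rw [← EReal.coe_lt_coe_iff, hGmax z hz0' (hKR z hz)]
      refine max_lt ?_ (EReal.coe_lt_coe_iff.2 (hN z hz))
      have h1 := hlt (tau ⟨z, hz⟩)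
      rw [extendDisk_tau h f (t := ⟨z, hz⟩) hz0',
        EReal.div_lt_iff (coe_logb_pos hz0 hzr) (EReal.coe_ne_top _), hfu, ← EReal.coe_mul,
        ← hk'K ⟨z, hz⟩] at h1
      have h2 := (addIso (-(γ * Real.log ‖z‖))).strictMono h1
      rw [addIso_apply, addIso_apply, add_assoc, ← EReal.coe_add, ← EReal.coe_add] at h2
      convert! h2 using 2
      · congr 1; ring
      · have e1 : Real.logb r ‖z‖ * Real.log r = Real.log ‖z‖ := by
          rw [Real.logb, div_mul_cancel₀ _ hlog.ne]
        simp only [hH]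
        rw [← e1]
        ring
  obtain ⟨s, hs, hsδ, hsR, hsH⟩ : ∃ s > 0, s < δ ∧ (r : ℝ) < R - s ∧
      ∀ z ∈ K, ∀ w, ‖z - w‖ < s → G w + 2 * s ≤ H z := by
    have h1 := eventually_add_le_of_lt hKc (fun z hz => hGusc z (hKR z hz)) hHlsc hGH
    have h2 : ∀ᶠ s in 𝓝[>] (0 : ℝ), s ∈ Set.Ioo 0 (min δ (R - r)) :=
      Ioo_mem_nhdsGT (lt_min hδ (sub_pos.2 hrR))
    obtain ⟨s, h3, h4⟩ := (h1.and h2).exists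
    exact ⟨s, h4.1, h4.2.trans_le (min_le_left _ _),
      by linarith [h4.2.trans_le (min_le_right δ (R - r))], h3⟩
  intro x₀
  obtain ⟨t₀, rfl⟩ := tau_surjective x₀
  obtain ⟨m, P, hm, hP, hP₀⟩ := exists_polynomial_approx hGm (M := M) (R := R) (r := r) (s := s)
    (ε := s) hs hGM hGR r.2.1.le hsR
    (fun w hw ρ hρ hρs => hGsub w ρ hρ (hρs.trans_lt hsδ) (by linarith))
    (z₀ := t₀) (mem_closedBall_zero_iff.1 t₀.2) hs (H := fun z => H z - 2 * s)
    (fun z hz w hzw => by linarith [hsH z (mem_closedBall_zero_iff.2 hz) w hzw])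
  have hm' : (m : ℝ) ≠ 0 := by positivity
  have hexp : ∀ (t : K) (a : ℝ), (Real.exp (m * a) ^ hybExp r t) ^ (m : ℝ)⁻¹ *
      Real.exp (γ * Real.log r) = Real.exp (hybExp r t * a + γ * Real.log r) := by
    intro t a
    rw [← Real.exp_mul, ← Real.exp_mul, ← Real.exp_add]
    congr 2
    field_simp
  have hkH : ∀ t : K, (t : ℂ) ≠ 0 →
      hybExp r t * H t + γ * Real.log r = k (tau t) := by
    intro t ht
    have h1 := (hybExp_pos ht (mem_closedBall_zero_iff.1 t.2)).ne'
    simp only [hH]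
    rw [hk'K, ← inv_hybExp]
    field_simp
    ring
  refine ⟨_, isTropicalFS_polynomial hm P N γ, fun x => ?_, ?_⟩
  · obtain ⟨t, rfl⟩ := tau_surjective x
    by_cases ht : (t : ℂ) = 0
    · have ht' : tau t = adicPoint := by rw [tau, dif_pos ht]
      have hc0 : ((Real.exp (-(m * N)) : ℝ) : ℂ) ≠ 0 := by exact_mod_cast (Real.exp_pos _).ne'
      rw [ht', adic_eval (hybC _), adicAbs_hybC hc0, Real.one_rpow, one_mul, elog_exp]
      refine max_lt ?_ (EReal.coe_lt_coe_iff.2 hkγ)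
      refine lt_of_le_of_lt ?_ (EReal.coe_lt_coe_iff.2 hkγ)
      rw [← elog_exp]
      refine elog_mono (mul_le_of_le_one_left (Real.exp_pos _).le ?_)
      exact Real.rpow_le_one (BerkovichSpectrum.eval_nonneg _ _) (adicPoint_eval_hybPoly_le P)
        (by positivity)
    · have htr := mem_closedBall_zero_iff.1 t.2
      have he := hybExp_pos ht htr
      simp only [tau_eval_of_ne ht, evalAt_hybPoly ht htr, evalAt_hybC]
      rw [← hkH t ht, ← elog_exp]
      refine max_lt (elog_lt_elog ?_ (Real.exp_pos _)) (elog_lt_elog ?_ (Real.exp_pos _))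
      · have h1 : ‖P.eval (t : ℂ)‖ ≤ Real.exp (m * (H t - s)) := by
          refine (hP t htr).trans_eq ?_
          congr 1; ring
        refine lt_of_le_of_lt (b := (Real.exp (m * (H t - s)) ^ hybExp r t) ^ (m : ℝ)⁻¹ *
          Real.exp (γ * Real.log r)) (by gcongr) ?_
        rw [hexp, Real.exp_lt_exp]
        nlinarith
      · rw [Complex.norm_real, Real.norm_of_nonneg (Real.exp_pos _).le, ← mul_neg, hexp,
          Real.exp_lt_exp]
        have := mul_lt_mul_of_pos_left (hN t t.2) he
        linarith
  · by_cases ht : (t₀ : ℂ) = 0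
    · refine lt_max_of_lt_right ?_
      have ht' : tau t₀ = adicPoint := by rw [tau, dif_pos ht]
      have hc0 : ((Real.exp (-(m * N)) : ℝ) : ℂ) ≠ 0 := by exact_mod_cast (Real.exp_pos _).ne'
      rw [extendDisk_tau_zero h f ht, ht', adic_eval, adicAbs_hybC hc0, Real.one_rpow, one_mul,
        elog_exp, hν, ← EReal.coe_mul, EReal.coe_lt_coe_iff]
      nlinarith
    · refine lt_max_of_lt_left ?_
      have htr := mem_closedBall_zero_iff.1 t₀.2
      have he := hybExp_pos ht htr
      have ht0 := norm_pos_iff.2 ht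
      rw [tau_eval_of_ne ht, evalAt_hybPoly ht htr, extendDisk_tau h f ht0]
      have h1 : f ⟨t₀, ht0, htr.trans_lt h⟩ ≤
          ((G t₀ + γ * Real.log ‖(t₀ : ℂ)‖ : ℝ) : EReal) := by
        have h2 := (le_max_left _ _).trans_eq (hGmax t₀ ht0 (hKR t₀ t₀.2)).symm
        have h3 := (addIso (γ * Real.log ‖(t₀ : ℂ)‖)).monotone h2
        rw [addIso_apply, addIso_apply, add_assoc, ← EReal.coe_add, ← EReal.coe_add] at h3
        rw [hfu]
        refine le_trans (le_of_eq ?_) h3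
        congr 2; ring
      refine lt_of_le_of_lt (EReal.div_le_div_right_of_nonneg (coe_logb_pos ht htr).le h1) ?_
      have h4 : elog ((Real.exp (m * G t₀) ^ hybExp r t₀) ^ (m : ℝ)⁻¹ *
          Real.exp (γ * Real.log r)) <
          elog ((‖P.eval (t₀ : ℂ)‖ ^ hybExp r t₀) ^ (m : ℝ)⁻¹ * Real.exp (γ * Real.log r)) := by
        have h5 : 0 < ‖P.eval (t₀ : ℂ)‖ := (Real.exp_pos _).trans hP₀
        refine elog_lt_elog ?_ (by positivity)
        gcongr
      refine lt_of_eq_of_lt ?_ h4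
      rw [hexp, elog_exp, ← EReal.coe_div]
      congr 1
      have h6 : Real.log ‖(t₀ : ℂ)‖ ≠ 0 := (Real.log_neg ht0 (htr.trans_lt r.2.2)).ne
      have := hlog.ne
      rw [Real.logb, hybExp]
      field_simp

lemma extendDisk_lt_top (hf : f ∈ SHLog r') (x : HybridCircle r) : extendDisk h f x < ⊤ := by
  obtain ⟨t, rfl⟩ := tau_surjective x
  by_cases ht : (t : ℂ) = 0
  · obtain ⟨ν, hν⟩ := exists_lelong_eq_coe hf
    rw [extendDisk_tau_zero h f ht, hν, ← EReal.coe_mul]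
    exact EReal.coe_lt_top _
  · obtain ⟨u, hu, c, hfu⟩ := hf
    have htr := mem_closedBall_zero_iff.1 t.2
    rw [extendDisk_tau h f (norm_pos_iff.2 ht),
      EReal.div_lt_iff (coe_logb_pos ht htr) (EReal.coe_ne_top _),
      EReal.top_mul_of_pos (coe_logb_pos ht htr), hfu]
    exact EReal.add_lt_top (hu.lt_top _ (mem_ball_zero_iff.2 (htr.trans_lt h))).ne
      (EReal.coe_ne_top _)

/-- Between the extension of `f` and a larger continuous function lies a tropical Fubini–Study
function. -/
lemma exists_tropicalFS_between (hf : f ∈ SHLog r') {k : HybridCircle r → ℝ} (hk : Continuous k)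
    (hlt : ∀ x, extendDisk h f x < (k x : EReal)) :
    ∃ w : HybridCircle r → EReal, IsTropicalFS w ∧ (∀ x, w x < (k x : EReal)) ∧
      ∀ x, extendDisk h f x < w x := by
  have : CompactSpace (Metric.closedBall (0 : ℂ) r) :=
    isCompact_iff_compactSpace.1 (isCompact_closedBall _ _)
  have key : ∃ w : HybridCircle r → EReal, IsTropicalFS w ∧ (∀ x, w x < (k x : EReal)) ∧
      ∀ t ∈ (Set.univ : Set (Metric.closedBall (0 : ℂ) r)), extendDisk h f (tau t) < w (tau t) := by
    refine isCompact_univ.induction_on (p := fun S => ∃ w : HybridCircle r → EReal,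
      IsTropicalFS w ∧ (∀ x, w x < (k x : EReal)) ∧
        ∀ t ∈ S, extendDisk h f (tau t) < w (tau t)) ?_ ?_ ?_ ?_
    · obtain ⟨w, hw, hwk, -⟩ := exists_tropicalFS_at h hf hk hlt adicPoint
      exact ⟨w, hw, hwk, fun t ht => ht.elim⟩
    · rintro S T hST ⟨w, hw, hwk, hwT⟩
      exact ⟨w, hw, hwk, fun t ht => hwT t (hST ht)⟩
    · rintro S T ⟨w, hw, hwk, hwS⟩ ⟨w', hw', hwk', hwT⟩
      refine ⟨_, hw.max hw', fun x => max_lt (hwk x) (hwk' x), ?_⟩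
      rintro t (ht | ht)
      · exact lt_max_of_lt_left (hwS t ht)
      · exact lt_max_of_lt_right (hwT t ht)
    · intro t _
      obtain ⟨w, hw, hwk, hwt⟩ := exists_tropicalFS_at h hf hk hlt (tau t)
      obtain ⟨a, ha, haw⟩ := exists_between hwt
      refine ⟨{s | extendDisk h f (tau s) < w (tau s)}, mem_nhdsWithin_of_mem_nhds ?_,
        w, hw, hwk, fun s hs => hs⟩
      filter_upwards [upperSemicontinuous_extendDisk h hf t a ha,
        (hw.continuous.comp continuous_tau).continuousAt.eventually_const_lt haw] with s h1 h2
        using h1.trans h2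
  obtain ⟨w, hw, hwk, hwf⟩ := key
  refine ⟨w, hw, hwk, fun x => ?_⟩
  obtain ⟨t, rfl⟩ := tau_surjective x
  exact hwf t (Set.mem_univ t)

/-- There are continuous functions above the extension of `f` whose value at a given point is any
given larger number. -/
lemma exists_continuous_gt (hf : f ∈ SHLog r') (x₀ : HybridCircle r) {a : ℝ}
    (ha : extendDisk h f x₀ < (a : EReal)) :
    ∃ k : HybridCircle r → ℝ, Continuous k ∧ (∀ x, extendDisk h f x < (k x : EReal)) ∧
      k x₀ = a := by
  have : CompactSpace (Metric.closedBall (0 : ℂ) r) :=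
    isCompact_iff_compactSpace.1 (isCompact_closedBall _ _)
  obtain ⟨t₀, rfl⟩ := tau_surjective x₀
  have husc := upperSemicontinuous_extendDisk h hf
  obtain ⟨B, hB⟩ : ∃ B : ℝ, ∀ t : Metric.closedBall (0 : ℂ) r,
      extendDisk h f (tau t) < (B : EReal) := by
    obtain ⟨t, -, ht⟩ := (husc.upperSemicontinuousOn Set.univ).exists_isMaxOn
      ⟨t₀, Set.mem_univ t₀⟩ isCompact_univ
    obtain ⟨B, hB, -⟩ := EReal.lt_iff_exists_real_btwn.1 (extendDisk_lt_top h hf (tau t))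
    exact ⟨B, fun s => lt_of_le_of_lt (ht (Set.mem_univ s)) hB⟩
  obtain ⟨δ, hδ, hδa⟩ := Metric.eventually_nhds_iff.1 (husc t₀ a ha)
  set k : Metric.closedBall (0 : ℂ) r → ℝ := fun t => a + max (B - a) 0 * (dist t t₀ / δ) with hk
  have hkc : Continuous k := by fun_prop
  have hkt : ∀ t, extendDisk h f (tau t) < (k t : EReal) := by
    intro t
    by_cases ht : dist t t₀ < δ
    · refine (hδa ht).trans_le (EReal.coe_le_coe_iff.2 (le_add_of_nonneg_right ?_))
      positivity
    · refine (hB t).trans_le (EReal.coe_le_coe_iff.2 ?_)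
      have h1 : 1 ≤ dist t t₀ / δ := (one_le_div hδ).2 (not_lt.1 ht)
      have h2 := le_mul_of_one_le_right (le_max_right (B - a) 0) h1
      simp only [hk]
      linarith [le_max_left (B - a) 0]
  refine ⟨fun x => k (Function.surjInv tau_surjective x), ?_, fun x => ?_, ?_⟩
  · rw [isQuotientMap_tau.continuous_iff]
    convert! hkc using 1
    exact funext fun t => congrArg k (surjInv_tau t)
  · have := hkt (Function.surjInv tau_surjective x)
    rwa [Function.surjInv_eq tau_surjective x] at this
  · beta_reduce
    rw [surjInv_tau]
    simp [hk]

/-- The extension of a function in `SH(𝔻_{r'}) + ℝ log |t|` is plurisubharmonic: it is the infimum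
of the tropical Fubini–Study functions lying strictly above it, which form a decreasing net. -/
theorem extendDisk_mem_PSH (hf : f ∈ SHLog r') : extendDisk h f ∈ PSH (hybridRing r) := by
  set φ := extendDisk h f with hφ
  -- the real-valued function underlying a tropical Fubini–Study function
  have hreal : ∀ {w : HybridCircle r → EReal}, IsTropicalFS w →
      Continuous (fun x => (w x).toReal) ∧ ∀ x, (((w x).toReal : ℝ) : EReal) = w x := by
    intro w hw
    refine ⟨?_, fun x => EReal.coe_toReal (hw.lt_top x).ne (hw.ne_bot x)⟩
    exact EReal.continuousOn_toReal.comp_continuous hw.continuous fun x => by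
      simp [(hw.lt_top x).ne, hw.ne_bot x]
  let ι : Type := {w : HybridCircle r → EReal // IsTropicalFS w ∧ ∀ x, φ x < w x}ᵒᵈ
  have hinf : ∀ (x : HybridCircle r) (a : ℝ), φ x < (a : EReal) →
      ∃ w : HybridCircle r → EReal, (IsTropicalFS w ∧ ∀ x, φ x < w x) ∧ w x < (a : EReal) := by
    intro x a ha
    obtain ⟨k, hk, hφk, hkx⟩ := exists_continuous_gt h hf x ha
    obtain ⟨w, hw, hwk, hwφ⟩ := exists_tropicalFS_between h hf hk hφk
    exact ⟨w, ⟨hw, hwφ⟩, hkx ▸ hwk x⟩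
  refine ⟨⟨ι, inferInstance, ⟨fun v w => ?_⟩, ?_, fun w => (OrderDual.ofDual w).1,
    fun v w hvw => hvw, fun w => (OrderDual.ofDual w).2.1, fun x => ?_⟩, fun x hx => ?_⟩
  · obtain ⟨hv, hφv⟩ := (OrderDual.ofDual v).2
    obtain ⟨hw, hφw⟩ := (OrderDual.ofDual w).2
    obtain ⟨hvc, hv'⟩ := hreal hv
    obtain ⟨hwc, hw'⟩ := hreal hw
    obtain ⟨z, hz, hzk, hφz⟩ := exists_tropicalFS_between h hf (hvc.min hwc) fun x => by
      rw [EReal.coe_strictMono.monotone.map_min, hv', hw']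
      exact lt_min (hφv x) (hφw x)
    refine ⟨OrderDual.toDual ⟨z, hz, hφz⟩, fun x => ?_, fun x => ?_⟩
    · refine (hzk x).le.trans ?_
      rw [EReal.coe_strictMono.monotone.map_min, hv']
      exact min_le_left _ _
    · refine (hzk x).le.trans ?_
      rw [EReal.coe_strictMono.monotone.map_min, hw']
      exact min_le_right _ _
  · obtain ⟨a, ha, -⟩ := EReal.lt_iff_exists_real_btwn.1 (extendDisk_lt_top h hf adicPoint)
    obtain ⟨w, hw, -⟩ := hinf adicPoint a ha
    exact ⟨OrderDual.toDual ⟨w, hw⟩⟩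
  · refine tendsto_order.2 ⟨fun b hb => Eventually.of_forall fun w => ?_, fun b hb => ?_⟩
    · exact hb.trans ((OrderDual.ofDual w).2.2 x)
    · obtain ⟨a, ha, hab⟩ := EReal.lt_iff_exists_real_btwn.1 hb
      obtain ⟨w, hw, hwa⟩ := hinf x a ha
      filter_upwards [eventually_ge_atTop (OrderDual.toDual ⟨w, hw⟩ : ι)] with v hv
      have hvw : (OrderDual.ofDual v).1 x ≤ w x := hv x
      exact hvw.trans_lt (hwa.trans hab)
  · obtain ⟨ν, hν⟩ := exists_lelong_eq_coe hf
    have h0mem : (0 : ℂ) ∈ Metric.closedBall (0 : ℂ) (r : ℝ) := Metric.mem_closedBall_self r.2.1.le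
    rw [eq_adicPoint_of_isZariskiDense hx, ← tau_zero h0mem, hφ, extendDisk_tau_zero h f rfl, hν,
      ← EReal.coe_mul]
    exact EReal.coe_ne_bot _

/-! ### Order and injectivity -/

lemma extendDisk_mono {f g : PuncturedDisk r' → EReal} (hfg : f ≤ g) :
    extendDisk h f ≤ extendDisk h g := by
  intro x
  obtain ⟨t, rfl⟩ := tau_surjective x
  by_cases ht : (t : ℂ) = 0
  · rw [extendDisk_tau_zero h f ht, extendDisk_tau_zero h g ht, mul_comm, mul_comm _ (lelong g)]
    refine EReal.mul_le_mul_of_nonpos_right ?_ ?_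
    · exact lelong_anti one_pos (fun t h1 h2 _ => hfg ⟨t, h1⟩) (r.2.1.trans h)
    · exact_mod_cast (Real.log_neg r.2.1 r.2.2).le
  · rw [extendDisk_tau h f (norm_pos_iff.2 ht), extendDisk_tau h g (norm_pos_iff.2 ht)]
    exact EReal.div_le_div_right_of_nonneg
      (coe_logb_pos ht (mem_closedBall_zero_iff.1 t.2)).le (hfg _)

lemma extendDisk_eq_iff {f g : PuncturedDisk r' → EReal} :
    extendDisk h f = extendDisk h g ↔ ∀ t : PuncturedDisk r', ‖(t : ℂ)‖ ≤ r → f t = g t := by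
  constructor
  · intro hfg t htr
    have h1 := congrFun hfg (tau ⟨t, mem_closedBall_zero_iff.2 htr⟩)
    rw [extendDisk_tau h f (t := ⟨t, _⟩) t.2.1, extendDisk_tau h g (t := ⟨t, _⟩) t.2.1] at h1
    exact (mulIso _ (logb_pos t.ne_zero htr)).symm.injective h1
  · intro hfg
    funext x
    obtain ⟨t, rfl⟩ := tau_surjective x
    by_cases ht : (t : ℂ) = 0
    · have h0 := r.2.1.trans h
      rw [extendDisk_tau_zero h f ht, extendDisk_tau_zero h g ht]
      congr 1
      exact le_antisymm
        (lelong_anti r.2.1 (fun t h1 h2 ht => (hfg ⟨t, h1⟩ ht.le).ge) h0)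
        (lelong_anti r.2.1 (fun t h1 h2 ht => (hfg ⟨t, h1⟩ ht.le).le) h0)
    · rw [extendDisk_tau h f (norm_pos_iff.2 ht), extendDisk_tau h g (norm_pos_iff.2 ht),
        hfg _ (mem_closedBall_zero_iff.1 t.2)]

/-- The rescaling of the extension of `f` is the restriction of `f`. -/
lemma rho_extendDisk (f : PuncturedDisk r' → EReal) :
    rho r (extendDisk h f) = restrictDisk h f := by
  funext t
  rw [rho_eq_mulIso, extendDisk_tau h f (t := t.toClosedDisk) t.2.1]
  exact (mulIso _ (logb_pos t.ne_zero t.2.2.le)).apply_symm_apply _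

end Extend

end Hybrid

open Hybrid in
theorem mainTheorem11 (r : Set.Ioo (0 : ℝ) 1) :
    -- `ρ_r` takes values in `SH(𝔻_r) + ℝ log |t|`, or in the constant `-∞`
    (∀ φ ∈ PSH (hybridRing r), rho r φ ∈ SHLog r ∨ ∀ t, rho r φ t = ⊥) ∧
    -- `ρ_r` is order-preserving
    (∀ φ ∈ PSH (hybridRing r), ∀ ψ ∈ PSH (hybridRing r), φ ≤ ψ → rho r φ ≤ rho r ψ) ∧
    -- `ρ_r` is injective up to the values at `0` and on the boundary circle,
    -- and injective on continuous functions
    (∀ φ ∈ PSH (hybridRing r), ∀ ψ ∈ PSH (hybridRing r), rho r φ = rho r ψ ↔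
      ∀ t : PuncturedDisk (r : ℝ), φ (tau t.toClosedDisk) = ψ (tau t.toClosedDisk)) ∧
    Set.InjOn (rho r) {φ | φ ∈ PSH (hybridRing r) ∧ Continuous φ} ∧
    -- the Lelong number for continuous functions
    (∀ φ ∈ PSH (hybridRing r), Continuous φ → rho r φ ∈ SHLog r ∧
      φ (tau ⟨0, Metric.mem_closedBall_self r.2.1.le⟩) =
        ((Real.log r : ℝ) : EReal) * lelong (rho r φ)) ∧
    -- the converse map
    (∀ (r' : ℝ) (hr' : (r : ℝ) < r'), ∃ ρ' : SHLog r' → PSH (hybridRing r),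
      (∀ (f : SHLog r') (t : Metric.closedBall (0 : ℂ) r) (ht : 0 < ‖(t : ℂ)‖),
        (ρ' f : HybridCircle r → EReal) (tau t) =
          (f : PuncturedDisk r' → EReal)
            ⟨t, ht, (mem_closedBall_zero_iff.1 t.2).trans_lt hr'⟩ /
              ((Real.logb r ‖(t : ℂ)‖ : ℝ) : EReal)) ∧
      (∀ f : SHLog r', (ρ' f : HybridCircle r → EReal)
          (tau ⟨0, Metric.mem_closedBall_self r.2.1.le⟩) =
        ((Real.log r : ℝ) : EReal) * lelong (f : PuncturedDisk r' → EReal)) ∧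
      Monotone ρ' ∧
      (∀ f g : SHLog r', ρ' f = ρ' g ↔ ∀ t : PuncturedDisk r', ‖(t : ℂ)‖ ≤ r →
        (f : PuncturedDisk r' → EReal) t = (g : PuncturedDisk r' → EReal) t) ∧
      (∀ f : SHLog r', rho r (ρ' f) ∈ SHLog r ∧ rho r (ρ' f) = restrictDisk hr' f)) := by
  refine ⟨fun φ hφ => rho_mem_SHLog hφ, fun φ _ ψ _ h => rho_monotone h,
    fun φ _ ψ _ => rho_eq_iff, rho_injOn_continuous.mono fun φ hφ => hφ.2, fun φ hφ hc => ?_,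
    fun r' hr' => ?_⟩
  · obtain ⟨h1, h2⟩ := apply_tau_zero_eq_lelong hφ hc
    exact ⟨h1, by rw [tau_zero, h2]⟩
  · refine ⟨fun f => ⟨extendDisk hr' f, extendDisk_mem_PSH hr' f.2⟩,
      fun f t ht => extendDisk_tau hr' _ ht, fun f => extendDisk_tau_zero hr' _ rfl,
      fun f g hfg => extendDisk_mono hr' hfg,
      fun f g => Subtype.ext_iff.trans (extendDisk_eq_iff hr'), fun f => ?_⟩
    have h1 := rho_extendDisk hr' (f : PuncturedDisk r' → EReal)
    exact ⟨h1 ▸ restrictDisk_mem_SHLog r.2.1 hr' f.2, h1⟩
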